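/- **Theorem (Strongly convex).** There are an absolute constant $C>0$ and a single randomized algorithm, an implementation of Hamiltonian Monte Carlo (HMC), with the following properties. The algorithm runs on a real random access machine (unit-cost $+,-,\times,\div,\sqrt{\cdot}$ and comparisons on real numbers, rational constants, unit-cost index arithmetic and memory access, unit-cost draws of independent standard Gaussians) with an oracle that returns $\nabla f(x)$ for a query point $x\in\mathbb{R}^d$ (each evaluation takes time $d$). Let $d\in\mathbb{N}$, let $f:\mathbb{R}^d\to\mathbb{R}$ be twice differentiable with $0\prec m_2 I\preceq\nabla^2 f(x)\preceq M_2 I$ for all $x\in\mathbb{R}^d$, let $\kappa=M_2/m_2$, let $0<\epsilon<\sqrt d$, and let $x^{(0)}$ be the minimizer of $f$. On input $(d,m_2,M_2,\epsilon,x^{(0)})$ the algorithm performs a number $N$ of iterations, not depending on the random draws, of HMC with some step size $0<h\le \frac{m_2^{1/4}}{2M_2^{3/4}}$: in iteration $k=1,\dots,N$ it draws a fresh $v\sim\mathcal N(0,I_d)$ and computes a point $x^{(k)}$ with $$\|x^{(k)}-q(h)\|_2\le\bar\epsilon=\frac{\theta\,\epsilon}{2\sqrt{m_2}},\quad \theta=\frac{m_2h^2}{8},\quad\text{where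 } q''(t)=-\nabla f(q(t))\ (0\le t\le h),\ q(0)=x^{(k-1)},\ q'(0)=v .$$ Its output $X=x^{(N)}$ and $Y$ drawn from the probability density proportional to $e^{-f}$ satisfy $$W_2(X,Y)\le\frac{\epsilon}{\sqrt{m_2}},$$ where $W_2(X,Y)=\inf\big(\mathbb{E}\|X'-Y'\|_2^2\big)^{1/2}$ over all couplings $(X',Y')$ of the laws of $X$ and $Y$. The number of iterations satisfies $$N\le C\,\kappa^{3/2}\Big(1+\log\frac d\epsilon\Big).$$ The expected total number of evaluations of $\nabla f$ and the expected total running time, each divided by $N$ (that is, amortized over all iterations), are at most $$C\,\frac{\kappa^{1/4}d^{1/2}}{\epsilon}\Big(1+\log\frac{\kappa d}{\epsilon}\Big)\qquad\text{and}\qquad C\,\frac{\kappa^{1/4}d^{3/2}}{\epsilon}\Big(1+\log\frac{\kappa d}{\epsilon}\Big)$$ respectively. (For $d\ge2$ each term $1+\log(\cdot)$ is at most an absolute constant times $\log(\cdot)$, so these are the bounds $O(\kappa^{1.5}\log\frac d\epsilon)$, $O(\kappa^{1/4}d^{1/2}\epsilon^{-1}\log\frac{\kappa d}\epsilon)$ and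 $O(\kappa^{1/4}d^{3/2}\epsilon^{-1}\log\frac{\kappa d}\epsilon)$.) -/

import Mathlib

open MeasureTheory ProbabilityTheory
open scoped ENNReal

noncomputable section

namespace HMC

/-- `ℝ^d` with the Euclidean norm. -/
abbrev E (d : ℕ) := EuclideanSpace ℝ (Fin d)

/-! ### The analytic setting -/

/-- `f` is twice differentiable on `ℝ^d` and `m • I ⪯ ∇²f(x) ⪯ M • I` for every `x`
(the Hessian `∇²f(x)` is the derivative of the gradient of `f` at `x`). -/
structure HessianBounds {d : ℕ} (f : E d → ℝ) (m M : ℝ) : Prop where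
  differentiable : Differentiable ℝ f
  differentiable_gradient : Differentiable ℝ (gradient f)
  lower : ∀ x v : E d, m * ‖v‖ ^ 2 ≤ inner ℝ v (fderiv ℝ (gradient f) x v)
  upper : ∀ x v : E d, inner ℝ v (fderiv ℝ (gradient f) x v) ≤ M * ‖v‖ ^ 2

/-- The probability measure on `ℝ^d` with density proportional to `exp (-f)`. -/
def gibbs {d : ℕ} (f : E d → ℝ) : Measure (E d) :=
  (volume : Measure (E d)).tilted (fun x => -f x)

/-- The couplings of two measures. -/
def couplings {d : ℕ} (μ ν : Measure (E d)) : Set (Measure (E d × E d)) :=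
  {γ | γ.map Prod.fst = μ ∧ γ.map Prod.snd = ν}

/-- The Wasserstein distance `W₂`, with values in `[0, ∞]`. -/
def W₂ {d : ℕ} (μ ν : Measure (E d)) : ℝ≥0∞ :=
  (⨅ γ ∈ couplings μ ν, ∫⁻ p, ‖p.1 - p.2‖ₑ ^ 2 ∂γ) ^ (1 / 2 : ℝ)

/-- `q` is the solution on `[0, h]` of the Hamiltonian dynamics
`q'' = -∇f(q)`, `q(0) = x`, `q'(0) = v`, and `p = q'` is its velocity. -/
structure IsHMCPath {d : ℕ} (f : E d → ℝ) (h : ℝ) (x v : E d) (q p : ℝ → E d) : Prop where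
  position_zero : q 0 = x
  velocity_zero : p 0 = v
  deriv_position : ∀ t ∈ Set.Icc 0 h, HasDerivWithinAt q (p t) (Set.Icc 0 h) t
  deriv_velocity : ∀ t ∈ Set.Icc 0 h, HasDerivWithinAt p (-gradient f (q t)) (Set.Icc 0 h) t

/-! ### The machine model

A real random access machine with a structured program. It has index registers holding natural
numbers, real registers, and a real memory that is addressed through index registers. In unit
time it does one index operation, one of `+ - * / √` on real registers, one transfer between a
real register and the memory, one comparison, or draws one standard Gaussian. It evaluates the
gradient oracle on a block of `d` memory cells, in time `d`. There is no rounding operation from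
the reals to the naturals and the only real constants are rational. -/

/-- Conditions that a program can test. -/
inductive Test where
  | idxLt (i j : ℕ)
  | realLt (r s : ℕ)

/-- Programs. The arguments are names of index registers (`i j k`) and of real registers
(`r s t`); the first register named is the one that is written. -/
inductive Cmd where
  | setIdx (i c : ℕ)
  | addIdx (i j k : ℕ)
  | subIdx (i j k : ℕ)
  | const (r : ℕ) (c : ℚ)
  | ofIdx (r i : ℕ)
  | add (r s t : ℕ)
  | sub (r s t : ℕ)
  | mul (r s t : ℕ)
  | div (r s t : ℕ)
  | sqrt (r s : ℕ)
  /-- `r := mem[i]` -/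
  | load (r i : ℕ)
  /-- `mem[i] := r` -/
  | store (i r : ℕ)
  /-- `r :=` a fresh standard Gaussian -/
  | gauss (r : ℕ)
  /-- `mem[i .. i + d) := oracle (mem[j .. j + d))` -/
  | grad (i j : ℕ)
  | seq (c₁ c₂ : Cmd)
  | ite (b : Test) (c₁ c₂ : Cmd)
  | while (b : Test) (c : Cmd)

/-- Configurations: the registers and the memory, the number of Gaussians drawn so far, the time
used so far and the number of gradient evaluations made so far. -/
structure State where
  idx : ℕ → ℕ
  reg : ℕ → ℝ
  mem : ℕ → ℝ
  drawn : ℕ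
  time : ℕ
  queries : ℕ

namespace State

/-- The vector stored in the `d` memory cells that start at address `a`. -/
def vec (s : State) (d a : ℕ) : E d := WithLp.toLp 2 fun i : Fin d => s.mem (a + i)

/-- Spend `n` units of time. -/
def tick (s : State) (n : ℕ) : State := { s with time := s.time + n }

/-- Write an index register, in unit time. -/
def writeIdx (s : State) (i n : ℕ) : State :=
  { s with idx := Function.update s.idx i n, time := s.time + 1 }

/-- Write a real register, in unit time. -/
def writeReg (s : State) (r : ℕ) (x : ℝ) : State :=
  { s with reg := Function.update s.reg r x, time := s.time + 1 }

/-- Write a memory cell, in unit time. -/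
def writeMem (s : State) (a : ℕ) (x : ℝ) : State :=
  { s with mem := Function.update s.mem a x, time := s.time + 1 }

/-- Draw the next Gaussian of the random tape `ω` into a real register, in unit time. -/
def draw (s : State) (ω : ℕ → ℝ) (r : ℕ) : State :=
  { s with
    reg := Function.update s.reg r (ω s.drawn)
    drawn := s.drawn + 1
    time := s.time + 1 }

/-- Evaluate the oracle `G` on the block at address `src` and write the result to the block at
address `dst`: one gradient evaluation and `d` units of time. -/
def query {d : ℕ} (s : State) (G : E d → E d) (dst src : ℕ) : State :=
  { s with
    mem := fun n => if h : dst ≤ n ∧ n < dst + d then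
      G (s.vec d src) ⟨n - dst, by omega⟩ else s.mem n
    time := s.time + d
    queries := s.queries + 1 }

end State

/-- The truth value of a test. -/
def Test.Holds (s : State) : Test → Prop
  | .idxLt i j => s.idx i < s.idx j
  | .realLt r t => s.reg r < s.reg t

/-- `Run G ω c s s'`: with gradient oracle `G` and random tape `ω`, the program `c` started in
`s` halts in `s'`. -/
inductive Run {d : ℕ} (G : E d → E d) (ω : ℕ → ℝ) : Cmd → State → State → Prop
  | setIdx (s i c) : Run G ω (.setIdx i c) s (s.writeIdx i c)
  | addIdx (s i j k) : Run G ω (.addIdx i j k) s (s.writeIdx i (s.idx j + s.idx k))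
  | subIdx (s i j k) : Run G ω (.subIdx i j k) s (s.writeIdx i (s.idx j - s.idx k))
  | const (s r c) : Run G ω (.const r c) s (s.writeReg r (c : ℝ))
  | ofIdx (s r i) : Run G ω (.ofIdx r i) s (s.writeReg r (s.idx i : ℝ))
  | add (s r t u) : Run G ω (.add r t u) s (s.writeReg r (s.reg t + s.reg u))
  | sub (s r t u) : Run G ω (.sub r t u) s (s.writeReg r (s.reg t - s.reg u))
  | mul (s r t u) : Run G ω (.mul r t u) s (s.writeReg r (s.reg t * s.reg u))
  | div (s r t u) : Run G ω (.div r t u) s (s.writeReg r (s.reg t / s.reg u))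
  | sqrt (s r t) : Run G ω (.sqrt r t) s (s.writeReg r (Real.sqrt (s.reg t)))
  | load (s r i) : Run G ω (.load r i) s (s.writeReg r (s.mem (s.idx i)))
  | store (s i r) : Run G ω (.store i r) s (s.writeMem (s.idx i) (s.reg r))
  | gauss (s r) : Run G ω (.gauss r) s (s.draw ω r)
  | grad (s i j) : Run G ω (.grad i j) s (s.query G (s.idx i) (s.idx j))
  | seq {c₁ c₂ s₁ s₂ s₃} (h₁ : Run G ω c₁ s₁ s₂) (h₂ : Run G ω c₂ s₂ s₃) :
      Run G ω (.seq c₁ c₂) s₁ s₃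
  | ite_true {b c₁ c₂ s s'} (hb : b.Holds s) (h : Run G ω c₁ (s.tick 1) s') :
      Run G ω (.ite b c₁ c₂) s s'
  | ite_false {b c₁ c₂ s s'} (hb : ¬ b.Holds s) (h : Run G ω c₂ (s.tick 1) s') :
      Run G ω (.ite b c₁ c₂) s s'
  | while_true {b c s₁ s₂ s₃} (hb : b.Holds s₁) (h₁ : Run G ω c (s₁.tick 1) s₂)
      (h₂ : Run G ω (.while b c) s₂ s₃) : Run G ω (.while b c) s₁ s₃
  | while_false {b c s} (hb : ¬ b.Holds s) : Run G ω (.while b c) s (s.tick 1)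

/-- The law of the random tape: independent standard Gaussians. -/
def tapeLaw : Measure (ℕ → ℝ) := Measure.infinitePi fun _ : ℕ => gaussianReal 0 1

/-- The input: `d` in index register `0`; `m₂`, `M₂`, `ε` in the real registers `0`, `1`, `2`;
the starting point in the memory cells `0, …, d - 1`; everything else is zero. -/
def input {d : ℕ} (m₂ M₂ ε : ℝ) (x₀ : E d) : State where
  idx := fun i => if i = 0 then d else 0
  reg := fun r => if r = 0 then m₂ else if r = 1 then M₂ else if r = 2 then ε else 0
  mem := fun n => if h : n < d then x₀ ⟨n, h⟩ else 0
  drawn := 0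
  time := 0
  queries := 0

/-! ### Hamiltonian Monte Carlo -/

/-- An iterative algorithm: a preparatory program, which leaves the number `N` of iterations in
index register `1`, and a program that is then executed `N` times. The current point is kept in
the memory cells `0, …, d - 1`. -/
structure Algorithm where
  setup : Cmd
  body : Cmd

/-- `S 0, S 1, …, S N` are the configurations of the algorithm `A` after the preparation and
after each of the `N` iterations. -/
structure Algorithm.Executes {d : ℕ} (A : Algorithm) (G : E d → E d) (ω : ℕ → ℝ) (s₀ : State)
    (N : ℕ) (S : ℕ → State) : Prop where
  run_setup : Run G ω A.setup s₀ (S 0)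
  num_iterations : (S 0).idx 1 = N
  run_body : ∀ k < N, Run G ω A.body (S k) (S (k + 1))

/-- The accuracy `ε̄ = θ ε / (2 √m₂)`, with `θ = m₂ h² / 8`, to which an iteration of Hamiltonian
Monte Carlo with step size `h` follows the Hamiltonian dynamics. -/
def accuracy (m₂ ε h : ℝ) : ℝ := (m₂ * h ^ 2 / 8) * ε / (2 * Real.sqrt m₂)

/-- The configurations `S 0, …, S N` perform Hamiltonian Monte Carlo with step size `h` from
`x₀`: the iteration leading from `S k` to `S (k + 1)` draws `d` fresh Gaussians, which form the
initial velocity `v`, and moves the current point `x` to within `ε̄` of the point that the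
Hamiltonian dynamics started at `(x, v)` reaches at time `h`. -/
structure IsHMC {d : ℕ} (f : E d → ℝ) (m₂ ε h : ℝ) (x₀ : E d) (ω : ℕ → ℝ) (N : ℕ)
    (S : ℕ → State) : Prop where
  start : (S 0).vec d 0 = x₀
  fresh : ∀ k ≤ N, (S k).drawn = k * d
  step : ∀ k < N, ∃ q p : ℝ → E d,
    IsHMCPath f h ((S k).vec d 0) (WithLp.toLp 2 fun i : Fin d => ω (k * d + i)) q p ∧
    ‖(S (k + 1)).vec d 0 - q h‖ ≤ accuracy m₂ ε h

end HMC

end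

open MeasureTheory ProbabilityTheory
open scoped ENNReal

noncomputable section

namespace HMC

/-! ### Strongly convex functions with Lipschitz gradient -/

namespace HessianBounds

variable {d : ℕ} {f : E d → ℝ} {m M : ℝ}

/-! The proof couples two chains that use the same Gaussian velocities: the computed chain, started
at the minimizer, and the exact HMC chain, started from the Gibbs measure. The exact chain is
stationary, so the distance between the chains at time N bounds W₂.

Contraction (`norm_sub_le_contraction`). Let e be the difference of two paths with equal initial
velocity and w = e'. The extrapolation ψ(t) = e(t) + (h - t) w(t) joins e(0) to e(h) and satisfies
ψ' = -(h - t) g, where g is the difference of the gradients. Cocoercivity, ‖g‖² ≤ M ⟨g, e⟩, absorbs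
the drift part of ⟨ψ, g⟩ provided M³h⁴ ≤ m/16; this fixes the step size. Each step then contracts by
1 - θ with θ = mh²/8 = 1/(32 κ^{3/2}). Each integration error is at most θε/(2√m), so these errors
add up to at most ε/(2√m), and the initial distance is controlled by the second moment 2d/m of the
Gibbs measure (`second_moment_gibbs`).

Stationarity (`measurePreserving_hmcMap`). A Verlet step is a composition of shears and preserves
volume. Its iterates converge to the Hamiltonian flow, and the flow conserves energy, so it
preserves the density exp(-f(x) - ‖v‖²/2). Fatou's lemma passes to the limit, and no
differentiability of the flow is needed.

Cost (`lintegral_sum_chainSteps_le`). Since f is only twice differentiable, Verlet is used as a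
first-order method: n steps have error O(h³M(‖v‖ + h‖∇f(x)‖)/n) (`verlet_error`). The algorithm
chooses n from the observed ‖v‖ and ‖∇f(x)‖, so every iteration meets its accuracy surely and only
the cost is random. To bound its mean, `gradient_sq_le` shows by energy conservation that a step
decreases f by a multiple of h²‖∇f(x)‖², up to the term h⟨v, ∇f(x)⟩ of mean zero and noise O(‖v‖² +
d). Summed over the iterations, f telescopes, and the start at the minimizer makes the telescoped
term nonpositive. The mean of h²‖∇f‖² over the run is thus O(d), and the mean of n is O(κ^{1/4} √d /
ε). -/

theorem hasDerivAt_line (hf : HessianBounds f m M) (x u : E d) (t : ℝ) :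
    HasDerivAt (fun t : ℝ => f (x + t • u)) (inner ℝ (gradient f (x + t • u)) u) t := by
  have h1 := (hf.differentiable (x + t • u)).hasGradientAt.hasFDerivAt
  have h2 : HasDerivAt (fun t : ℝ => x + t • u) u t := by
    simpa using ((hasDerivAt_id t).smul_const u).const_add x
  exact (h1.comp_hasDerivAt t h2).congr_deriv (by simp)

theorem hasDerivAt_inner_gradient_line (hf : HessianBounds f m M) (x u : E d) (t : ℝ) :
    HasDerivAt (fun t : ℝ => inner ℝ (gradient f (x + t • u)) u)
      (inner ℝ u (fderiv ℝ (gradient f) (x + t • u) u)) t := by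
  have h1 := (hf.differentiable_gradient (x + t • u)).hasFDerivAt
  have h2 : HasDerivAt (fun t : ℝ => x + t • u) u t := by
    simpa using ((hasDerivAt_id t).smul_const u).const_add x
  have h3 := (h1.comp_hasDerivAt t h2).inner ℝ (hasDerivAt_const t u)
  simpa [real_inner_comm] using h3

/-- The mean value inequality along the segment from y to x. Only pointwise differentiability of the
gradient enters, so the Hessian need not be continuous. -/
theorem inner_gradient_sub_ge (hf : HessianBounds f m M) (x y : E d) :
    m * ‖x - y‖ ^ 2 ≤ inner ℝ (gradient f x - gradient f y) (x - y) := by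
  have h := hf.hasDerivAt_inner_gradient_line y (x - y)
  have hd : Differentiable ℝ (fun t : ℝ => inner ℝ (gradient f (y + t • (x - y))) (x - y)) :=
    fun t => (h t).differentiableAt
  have := mul_sub_le_image_sub_of_le_deriv hd (C := m * ‖x - y‖ ^ 2)
    (fun t => by rw [(h t).deriv]; exact hf.lower _ _) (zero_le_one' ℝ)
  simpa [inner_sub_left] using this

theorem inner_gradient_sub_le (hf : HessianBounds f m M) (x y : E d) :
    inner ℝ (gradient f x - gradient f y) (x - y) ≤ M * ‖x - y‖ ^ 2 := by
  have h := hf.hasDerivAt_inner_gradient_line y (x - y)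
  have hd : Differentiable ℝ (fun t : ℝ => inner ℝ (gradient f (y + t • (x - y))) (x - y)) :=
    fun t => (h t).differentiableAt
  have := image_sub_le_mul_sub_of_deriv_le hd (C := M * ‖x - y‖ ^ 2)
    (fun t => by rw [(h t).deriv]; exact hf.upper _ _) (zero_le_one' ℝ)
  simpa [inner_sub_left] using this

theorem quadratic_lower (hf : HessianBounds f m M) (x y : E d) :
    f x + inner ℝ (gradient f x) (y - x) + m / 2 * ‖y - x‖ ^ 2 ≤ f y := by
  set u := y - x with hu
  have hd : ∀ t : ℝ, HasDerivAt
      (fun t : ℝ => f (x + t • u) - t * inner ℝ (gradient f x) u - t ^ 2 * (m / 2 * ‖u‖ ^ 2))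
      (inner ℝ (gradient f (x + t • u)) u - inner ℝ (gradient f x) u
        - 2 * t * (m / 2 * ‖u‖ ^ 2)) t := fun t => by
    have h := ((hf.hasDerivAt_line x u t).sub ((hasDerivAt_id t).mul_const
      (inner ℝ (gradient f x) u))).sub ((hasDerivAt_pow 2 t).mul_const (m / 2 * ‖u‖ ^ 2))
    exact h.congr_deriv (by simp)
  have hmono : MonotoneOn (fun t : ℝ => f (x + t • u) - t * inner ℝ (gradient f x) u
      - t ^ 2 * (m / 2 * ‖u‖ ^ 2)) (Set.Icc 0 1) := by
    refine monotoneOn_of_deriv_nonneg (convex_Icc 0 1)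
      (fun t _ => (hd t).continuousAt.continuousWithinAt)
      (fun t _ => (hd t).differentiableAt.differentiableWithinAt) fun t ht => ?_
    rw [interior_Icc] at ht
    rw [(hd t).deriv]
    -- Applied to the displacement t • u, monotonicity carries a surplus factor t, which is
    -- cancelled because t > 0.
    have h := hf.inner_gradient_sub_ge (x + t • u) x
    rw [add_sub_cancel_left, inner_smul_right, norm_smul, inner_sub_left, Real.norm_eq_abs,
      mul_pow, sq_abs] at h
    have h2 : t * (m * t * ‖u‖ ^ 2) ≤
        t * (inner ℝ (gradient f (x + t • u)) u - inner ℝ (gradient f x) u) := by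
      linarith
    have := le_of_mul_le_mul_left h2 ht.1
    linarith
  have := hmono (by simp) (by simp) (zero_le_one' ℝ)
  simp [hu] at this
  simp [hu]
  linarith

theorem quadratic_upper (hf : HessianBounds f m M) (x y : E d) :
    f y ≤ f x + inner ℝ (gradient f x) (y - x) + M / 2 * ‖y - x‖ ^ 2 := by
  set u := y - x with hu
  have hd : ∀ t : ℝ, HasDerivAt
      (fun t : ℝ => f (x + t • u) - t * inner ℝ (gradient f x) u - t ^ 2 * (M / 2 * ‖u‖ ^ 2))
      (inner ℝ (gradient f (x + t • u)) u - inner ℝ (gradient f x) u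
        - 2 * t * (M / 2 * ‖u‖ ^ 2)) t := fun t => by
    have h := ((hf.hasDerivAt_line x u t).sub ((hasDerivAt_id t).mul_const
      (inner ℝ (gradient f x) u))).sub ((hasDerivAt_pow 2 t).mul_const (M / 2 * ‖u‖ ^ 2))
    exact h.congr_deriv (by simp)
  have hmono : AntitoneOn (fun t : ℝ => f (x + t • u) - t * inner ℝ (gradient f x) u
      - t ^ 2 * (M / 2 * ‖u‖ ^ 2)) (Set.Icc 0 1) := by
    refine antitoneOn_of_deriv_nonpos (convex_Icc 0 1)
      (fun t _ => (hd t).continuousAt.continuousWithinAt)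
      (fun t _ => (hd t).differentiableAt.differentiableWithinAt) fun t ht => ?_
    rw [interior_Icc] at ht
    rw [(hd t).deriv]
    have h := hf.inner_gradient_sub_le (x + t • u) x
    rw [add_sub_cancel_left, inner_smul_right, norm_smul, inner_sub_left, Real.norm_eq_abs,
      mul_pow, sq_abs] at h
    have h2 : t * (inner ℝ (gradient f (x + t • u)) u - inner ℝ (gradient f x) u) ≤
        t * (M * t * ‖u‖ ^ 2) := by
      linarith
    have := le_of_mul_le_mul_left h2 ht.1
    linarith
  have := hmono (by simp) (by simp) (zero_le_one' ℝ)
  simp [hu] at this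
  simp [hu]
  linarith

/-- Subtracting from f its affine part at x leaves a function minimized at x. A gradient step of
length 1/M from y lowers it by at least ‖w‖²/(2M), and it cannot fall below the minimum. -/
theorem half_sq_norm_gradient_sub_le (hf : HessianBounds f m M) (hm : 0 ≤ m) (hM : 0 < M)
    (x y : E d) :
    ‖gradient f y - gradient f x‖ ^ 2 / (2 * M) ≤ f y - f x - inner ℝ (gradient f x) (y - x) := by
  set w := gradient f y - gradient f x with hw
  set z := y - (1 / M) • w with hz
  have h1 := hf.quadratic_lower x z
  have h2 := hf.quadratic_upper y z
  have e1 : z - y = -((1 / M) • w) := by simp [hz]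
  have e2 : z - x = (y - x) - (1 / M) • w := by simp [hz]; abel
  rw [e1, norm_neg, inner_neg_right, inner_smul_right, norm_smul, Real.norm_eq_abs, mul_pow,
    sq_abs] at h2
  rw [e2, inner_sub_right, inner_smul_right] at h1
  have h3 : 0 ≤ m / 2 * ‖(y - x) - (1 / M) • w‖ ^ 2 := by positivity
  have h4 : inner ℝ (gradient f y) w - inner ℝ (gradient f x) w = ‖w‖ ^ 2 := by
    rw [← inner_sub_left, ← hw, real_inner_self_eq_norm_sq]
  have h5 : (1 / M) * inner ℝ (gradient f y) w = (1 / M) * inner ℝ (gradient f x) w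
      + (1 / M) * ‖w‖ ^ 2 := by rw [← h4]; ring
  have h6 : M / 2 * ((1 / M) ^ 2 * ‖w‖ ^ 2) = ‖w‖ ^ 2 / (2 * M) := by field_simp
  have h7 : 1 / M * ‖w‖ ^ 2 = 2 * (‖w‖ ^ 2 / (2 * M)) := by field_simp
  linarith

/-- Cocoercivity, by adding the previous inequality to itself with x and y exchanged. It yields the
Lipschitz bound without using symmetry of the Hessian, and the contraction estimate needs it in this
stronger form. -/
theorem sq_norm_gradient_sub_le (hf : HessianBounds f m M) (hm : 0 ≤ m) (hM : 0 < M)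
    (x y : E d) :
    ‖gradient f x - gradient f y‖ ^ 2 ≤
      M * inner ℝ (gradient f x - gradient f y) (x - y) := by
  have h1 := hf.half_sq_norm_gradient_sub_le hm hM x y
  have h2 := hf.half_sq_norm_gradient_sub_le hm hM y x
  rw [norm_sub_rev] at h1
  have h3 : ‖gradient f x - gradient f y‖ ^ 2 / (2 * M) * (2 * M) =
    ‖gradient f x - gradient f y‖ ^ 2 := by field_simp
  have h4 : inner ℝ (gradient f x - gradient f y) (x - y) =
      - inner ℝ (gradient f x) (y - x) - inner ℝ (gradient f y) (x - y) := by
    rw [inner_sub_left, ← neg_sub x y, inner_neg_right]; ring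
  rw [h4]
  nlinarith

theorem norm_gradient_sub_le (hf : HessianBounds f m M) (hm : 0 ≤ m) (hM : 0 < M)
    (x y : E d) : ‖gradient f x - gradient f y‖ ≤ M * ‖x - y‖ := by
  have h1 := hf.sq_norm_gradient_sub_le hm hM x y
  have h2 := real_inner_le_norm (gradient f x - gradient f y) (x - y)
  by_contra! h
  have h0 : 0 ≤ M * ‖x - y‖ := by positivity
  nlinarith [mul_le_mul_of_nonneg_left h2 hM.le]

theorem le_upper (hf : HessianBounds f m M) (hd : 0 < d) : m ≤ M := by
  have h1 := hf.lower 0 (EuclideanSpace.single ⟨0, hd⟩ 1)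
  have h2 := hf.upper 0 (EuclideanSpace.single ⟨0, hd⟩ 1)
  simp only [PiLp.norm_single, norm_one, one_pow, mul_one] at h1 h2
  exact h1.trans h2

end HessianBounds

theorem gradient_eq_zero_of_forall_le {d : ℕ} {f : E d → ℝ} {x₀ : E d} (h : ∀ y, f x₀ ≤ f y) :
    gradient f x₀ = 0 := by
  have : IsLocalMin f x₀ := Filter.Eventually.of_forall h
  rw [gradient, this.fderiv_eq_zero, map_zero]

/-! ### Hamiltonian dynamics over a short time -/

section Dynamics

variable {d : ℕ} {f : E d → ℝ} {m M h : ℝ}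

/-- Picard–Lindelöf in the coordinates (q, p/√M), where the vector field is √M-Lipschitz for the
maximum norm. As √M h ≤ 1/2, one application covers all of [0, h]. -/
theorem exists_isHMCPath (hf : HessianBounds f m M) (hm : 0 ≤ m) (hM : 0 < M) (hh : 0 < h)
    (hMh : M * h ^ 2 ≤ 1 / 4) (x v : E d) : ∃ q p, IsHMCPath f h x v q p := by
  have hs : 0 < √M := Real.sqrt_pos.2 hM
  have hsq : √M * √M = M := Real.mul_self_sqrt hM.le
  have hsh : √M * h ≤ 1 / 2 := by
    refine abs_le_of_sq_le_sq' ?_ (by norm_num) |>.2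
    rw [mul_pow, Real.sq_sqrt hM.le]; linarith
  let F : E d × E d → E d × E d := fun z => (√M • z.2, -((1 / √M) • gradient f z.1))
  have hF : ∀ y z : E d × E d, ‖F y - F z‖ ≤ √M * ‖y - z‖ := fun y z => by
    have h1 : ‖(y - z).1‖ ≤ ‖y - z‖ := norm_fst_le _
    have h2 : ‖(y - z).2‖ ≤ ‖y - z‖ := norm_snd_le _
    rw [Prod.norm_def]
    refine max_le ?_ ?_
    · have : (F y - F z).1 = √M • (y - z).2 := by simp [F, smul_sub]
      rw [this, norm_smul, Real.norm_of_nonneg hs.le]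
      gcongr
    · have : (F y - F z).2 = -((1 / √M) • (gradient f y.1 - gradient f z.1)) := by
        simp only [F, Prod.snd_sub, smul_sub]; abel
      rw [this, norm_neg, norm_smul, Real.norm_of_nonneg (by positivity)]
      have h3 := hf.norm_gradient_sub_le hm hM y.1 z.1
      calc 1 / √M * ‖gradient f y.1 - gradient f z.1‖ ≤ 1 / √M * (M * ‖y - z‖) := by
            gcongr; exact h3.trans (by gcongr; exact h1)
        _ = √M * ‖y - z‖ := by rw [← mul_assoc]; nth_rw 2 [← hsq]; field_simp
  let z₀ : E d × E d := (x, (1 / √M) • v)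
  -- The radius a is chosen to be self-consistent: the speed on the ball is at most B = ‖F z₀‖ + √M
  -- a, and √M h ≤ 1/2 gives B h ≤ a/2 + a/2.
  let a : NNReal := ⟨2 * h * ‖F z₀‖, by positivity⟩
  let B : NNReal := ⟨‖F z₀‖ + √M * a, by positivity⟩
  have hPL : IsPicardLindelof (fun _ => F) (⟨0, by simp [hh.le]⟩ : Set.Icc (0 : ℝ) h) z₀ a 0 B
      (Real.toNNReal √M) := by
    refine IsPicardLindelof.of_time_independent (fun z hz => ?_) ?_ ?_
    · have h1 : ‖z - z₀‖ ≤ a := by simpa [dist_eq_norm] using hz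
      change ‖F z‖ ≤ ‖F z₀‖ + √M * a
      have h2 := norm_sub_norm_le (F z) (F z₀)
      have h3 : √M * ‖z - z₀‖ ≤ √M * a := by gcongr
      linarith [hF z z₀]
    · refine LipschitzWith.lipschitzOnWith (LipschitzWith.of_dist_le_mul fun y z => ?_)
      rw [dist_eq_norm, dist_eq_norm, Real.coe_toNNReal _ hs.le]
      exact hF y z
    · have : (B : ℝ) = ‖F z₀‖ + √M * (2 * h * ‖F z₀‖) := rfl
      have h2 : (a : ℝ) = 2 * h * ‖F z₀‖ := rfl
      simp only [sub_zero, sub_self, NNReal.coe_zero, max_eq_left hh.le, this, h2]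
      have : √M * h * (2 * h * ‖F z₀‖) ≤ 1 / 2 * (2 * h * ‖F z₀‖) := by gcongr
      linarith
  obtain ⟨α, h0, hα⟩ := hPL.exists_eq_forall_mem_Icc_hasDerivWithinAt₀
  refine ⟨fun t => (α t).1, fun t => √M • (α t).2, ?_, ?_, fun t ht => ?_, fun t ht => ?_⟩
  · simp only at h0; simp [h0, z₀]
  · simp only at h0; simp [h0, z₀, smul_smul, hs.ne']
  · exact (hα t ht).fst
  · have h1 : HasDerivWithinAt (fun t => (α t).2) (F (α t)).2 (Set.Icc 0 h) t := (hα t ht).snd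
    refine (h1.const_smul √M).congr_deriv ?_
    simp [F, smul_smul, hs.ne']

/-! ### Speed bound, energy conservation, decrease of f and contraction along paths -/

namespace IsHMCPath

variable {x v : E d} {q p : ℝ → E d}

theorem continuousOn_velocity (hq : IsHMCPath f h x v q p) : ContinuousOn p (Set.Icc 0 h) :=
  fun t ht => (hq.deriv_velocity t ht).continuousWithinAt

theorem norm_position_sub_le (hq : IsHMCPath f h x v q p) {P : ℝ}
    (hP : ∀ t ∈ Set.Icc 0 h, ‖p t‖ ≤ P) {s t : ℝ} (hs : s ∈ Set.Icc 0 h) (ht : t ∈ Set.Icc 0 h)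
    (hst : s ≤ t) : ‖q t - q s‖ ≤ P * (t - s) := by
  have := (convex_Icc 0 h).norm_image_sub_le_of_norm_hasDerivWithin_le hq.deriv_position hP hs ht
  rwa [Real.norm_of_nonneg (sub_nonneg.2 hst)] at this

/-- The maximal speed P satisfies P ≤ ‖v‖ + h‖∇f(x)‖ + Mh²P, and Mh² ≤ 1/4 absorbs the last term. -/
theorem exists_velocity_bound (hq : IsHMCPath f h x v q p) (hf : HessianBounds f m M)
    (hm : 0 ≤ m) (hM : 0 < M) (hh : 0 < h) (hMh : M * h ^ 2 ≤ 1 / 4) :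
    ∃ P, 0 ≤ P ∧ (∀ t ∈ Set.Icc 0 h, ‖p t‖ ≤ P) ∧ P ≤ 4 / 3 * (‖v‖ + h * ‖gradient f x‖) := by
  obtain ⟨t₀, ht₀, hmax⟩ := isCompact_Icc.exists_isMaxOn (Set.nonempty_Icc.2 hh.le)
    hq.continuousOn_velocity.norm
  have hP : ∀ t ∈ Set.Icc 0 h, ‖p t‖ ≤ ‖p t₀‖ := fun t ht => hmax ht
  have h0 : (0 : ℝ) ∈ Set.Icc 0 h := ⟨le_rfl, hh.le⟩
  refine ⟨‖p t₀‖, norm_nonneg _, hP, ?_⟩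
  have hb : ∀ t ∈ Set.Icc 0 h, ‖-gradient f (q t)‖ ≤ ‖gradient f x‖ + M * (h * ‖p t₀‖) := by
    intro t ht
    rw [norm_neg]
    have h1 := hq.norm_position_sub_le hP h0 ht ht.1
    rw [hq.position_zero] at h1
    have h2 := hf.norm_gradient_sub_le hm hM (q t) x
    have h3 := norm_sub_norm_le (gradient f (q t)) (gradient f x)
    have h4 : ‖p t₀‖ * (t - 0) ≤ h * ‖p t₀‖ := by
      rw [mul_comm, sub_zero]; gcongr; exact ht.2
    have h5 : M * ‖q t - x‖ ≤ M * (h * ‖p t₀‖) := by gcongr; linarith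
    linarith
  have h1 := (convex_Icc 0 h).norm_image_sub_le_of_norm_hasDerivWithin_le hq.deriv_velocity hb
    h0 ht₀
  rw [hq.velocity_zero, sub_zero, Real.norm_of_nonneg ht₀.1] at h1
  have h2 := norm_sub_norm_le (p t₀) v
  have h3 : (‖gradient f x‖ + M * (h * ‖p t₀‖)) * t₀ ≤ (‖gradient f x‖ + M * (h * ‖p t₀‖)) * h := by
    gcongr; exact ht₀.2
  have h4 : M * h ^ 2 * ‖p t₀‖ ≤ 1 / 4 * ‖p t₀‖ := by gcongr
  nlinarith

theorem energy_eq (hq : IsHMCPath f h x v q p) (hf : HessianBounds f m M) (hh : 0 < h) :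
    f (q h) + ‖p h‖ ^ 2 / 2 = f x + ‖v‖ ^ 2 / 2 := by
  have hd : ∀ t ∈ Set.Icc 0 h, HasDerivWithinAt (fun t => f (q t) + ‖p t‖ ^ 2 / 2) 0
      (Set.Icc 0 h) t := fun t ht => by
    have h1 := (hf.differentiable (q t)).hasGradientAt.hasFDerivAt.comp_hasDerivWithinAt t
      (hq.deriv_position t ht)
    have h2 := (hq.deriv_velocity t ht).norm_sq.div_const 2
    refine (h1.add h2).congr_deriv ?_
    rw [InnerProductSpace.toDual_apply_apply, inner_neg_right, real_inner_comm]
    ring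
  have h1 := (convex_Icc 0 h).norm_image_sub_le_of_norm_hasDerivWithin_le hd (C := 0)
    (fun t _ => by simp) (x := 0) (y := h) ⟨le_rfl, hh.le⟩ ⟨hh.le, le_rfl⟩
  rw [zero_mul, norm_le_zero_iff, sub_eq_zero, hq.position_zero, hq.velocity_zero] at h1
  exact h1

/-- One step of Hamiltonian Monte Carlo decreases `f` in proportion to the squared gradient,
up to noise. -/
theorem gradient_sq_le (hq : IsHMCPath f h x v q p) (hf : HessianBounds f m M)
    (hm : 0 ≤ m) (hM : 0 < M) (hh : 0 < h) (hMh : M * h ^ 2 ≤ 1 / 4) {s : ℝ} (hs : 0 ≤ s)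
    {x' : E d} (hx' : ‖x' - q h‖ ≤ h * s / 32) :
    2 / 25 * (h * ‖gradient f x‖) ^ 2 ≤
      f x - f x' + h * inner ℝ v (gradient f x) + 4 * ‖v‖ ^ 2 + 4 * s ^ 2 := by
  obtain ⟨P, hP0, hP, hPV⟩ := hq.exists_velocity_bound hf hm hM hh hMh
  have h0 : (0 : ℝ) ∈ Set.Icc 0 h := ⟨le_rfl, hh.le⟩
  have hhm : h ∈ Set.Icc 0 h := ⟨hh.le, le_rfl⟩
  set g := gradient f x with hg
  have hgrad : ∀ t ∈ Set.Icc 0 h, ‖gradient f (q t) - g‖ ≤ M * (h * P) := fun t ht => by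
    refine (hf.norm_gradient_sub_le hm hM (q t) x).trans ?_
    gcongr
    have h1 := hq.norm_position_sub_le hP h0 ht ht.1
    rw [hq.position_zero] at h1
    have : P * (t - 0) ≤ h * P := by rw [mul_comm, sub_zero]; gcongr; exact ht.2
    linarith
  -- The deviation of the final velocity from the one produced by the frozen force g.
  set r := p h - (v - h • g) with hr
  have hrP : ‖r‖ ≤ P / 4 := by
    have hd : ∀ t ∈ Set.Icc 0 h, HasDerivWithinAt (fun t => p t + t • g) (-gradient f (q t) + g)
        (Set.Icc 0 h) t := fun t ht =>
      ((hq.deriv_velocity t ht).add ((hasDerivWithinAt_id t _).smul_const g)).congr_deriv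
        (by simp)
    have h1 := (convex_Icc 0 h).norm_image_sub_le_of_norm_hasDerivWithin_le hd (C := M * (h * P))
      (fun t ht => by rw [neg_add_eq_sub, norm_sub_rev]; exact hgrad t ht) h0 hhm
    have e : p h + h • g - (p 0 + (0 : ℝ) • g) = r := by
      rw [hr, hq.velocity_zero, zero_smul]; abel
    rw [e, sub_zero, Real.norm_of_nonneg hh.le] at h1
    have h2 : M * h ^ 2 * P ≤ 1 / 4 * P := by gcongr
    linarith
  set a := h * ‖g‖ with ha
  set b := ‖v‖ with hb
  have ha0 : 0 ≤ a := by positivity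
  have hb0 : 0 ≤ b := by positivity
  set w := v - h • g with hw
  have hw1 : ‖w‖ ≤ b + a := by
    refine (norm_sub_le _ _).trans ?_
    rw [norm_smul, Real.norm_of_nonneg hh.le]
  have hw2 : ‖w‖ ^ 2 = b ^ 2 - 2 * (h * inner ℝ v g) + a ^ 2 := by
    rw [hw, norm_sub_sq_real, inner_smul_right, norm_smul, Real.norm_of_nonneg hh.le]
  -- By energy conservation, a lower bound on ‖p h‖ is a lower bound on the decrease of f. The
  -- frozen force contributes a²/2, and the deviation r costs at most (a + b)²/3.
  have hp : ‖w‖ ^ 2 - 2 * (‖w‖ * ‖r‖) ≤ ‖p h‖ ^ 2 := by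
    have e : p h = w + r := by rw [hr]; abel
    rw [e, norm_add_sq_real]
    have := neg_le_of_abs_le (abs_real_inner_le_norm w r)
    nlinarith [sq_nonneg ‖r‖]
  have hwr : ‖w‖ * ‖r‖ ≤ (b + a) * ((b + a) / 3) := by
    gcongr; linarith
  have hen := hq.energy_eq hf hh
  have hup := hf.quadratic_upper (q h) x'
  have hgq : ‖gradient f (q h)‖ ≤ ‖g‖ + M * (h * P) := by
    have := norm_sub_norm_le (gradient f (q h)) g
    linarith [hgrad h hhm]
  have hin : inner ℝ (gradient f (q h)) (x' - q h) ≤ (a + (a + b) / 3) * (s / 32) := by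
    refine (real_inner_le_norm _ _).trans ?_
    calc ‖gradient f (q h)‖ * ‖x' - q h‖ ≤ (‖g‖ + M * (h * P)) * (h * s / 32) := by gcongr
      _ = (a + M * h ^ 2 * P) * (s / 32) := by rw [ha]; ring
      _ ≤ (a + 1 / 4 * P) * (s / 32) := by gcongr
      _ ≤ _ := by gcongr; linarith
  have hq2 : M / 2 * ‖x' - q h‖ ^ 2 ≤ s ^ 2 / 8192 := by
    calc M / 2 * ‖x' - q h‖ ^ 2 ≤ M / 2 * (h * s / 32) ^ 2 := by gcongr
      _ = M * h ^ 2 * (s ^ 2 / 2048) := by ring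
      _ ≤ 1 / 4 * (s ^ 2 / 2048) := by gcongr
      _ = _ := by ring
  -- Of the coefficient 1/2 - 1/3 = 1/6 of a², 2/25 is kept; the rest pays for the mixed terms in a,
  -- b and s.
  nlinarith [sq_nonneg (a - 5 * b), sq_nonneg (a - 3 * s), sq_nonneg (b - s), sq_nonneg s,
    sq_nonneg b]

/-- Two solutions of the Hamiltonian dynamics with the same initial velocity approach each
other. -/
theorem norm_sub_le_contraction (hq : IsHMCPath f h x v q p) {y : E d} {q' p' : ℝ → E d}
    (hq' : IsHMCPath f h y v q' p') (hf : HessianBounds f m M)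
    (hm : 0 < m) (hM : 0 < M) (hmM : m ≤ M) (hh : 0 < h) (hMh : M * h ^ 2 ≤ 1 / 4)
    (hMh3 : M ^ 3 * h ^ 4 ≤ m / 16) :
    ‖q h - q' h‖ ≤ (1 - m * h ^ 2 / 8) * ‖x - y‖ := by
  have h0 : (0 : ℝ) ∈ Set.Icc 0 h := ⟨le_rfl, hh.le⟩
  have hhm : h ∈ Set.Icc 0 h := ⟨hh.le, le_rfl⟩
  have hmh : m * h ^ 2 ≤ 1 / 4 := le_trans (by gcongr) hMh
  set e : ℝ → E d := fun t => q t - q' t with he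
  set w : ℝ → E d := fun t => p t - p' t with hw
  set g : ℝ → E d := fun t => gradient f (q t) - gradient f (q' t) with hg
  have hde : ∀ t ∈ Set.Icc 0 h, HasDerivWithinAt e (w t) (Set.Icc 0 h) t := fun t ht =>
    (hq.deriv_position t ht).sub (hq'.deriv_position t ht)
  have hdw : ∀ t ∈ Set.Icc 0 h, HasDerivWithinAt w (-g t) (Set.Icc 0 h) t := fun t ht =>
    ((hq.deriv_velocity t ht).sub (hq'.deriv_velocity t ht)).congr_deriv (by simp [hg]; abel)
  have he0 : e 0 = x - y := by simp [he, hq.position_zero, hq'.position_zero]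
  have hw0 : w 0 = 0 := by simp [hw, hq.velocity_zero, hq'.velocity_zero]
  have hec : ContinuousOn e (Set.Icc 0 h) := fun t ht => (hde t ht).continuousWithinAt
  obtain ⟨t₀, ht₀, hmax⟩ := isCompact_Icc.exists_isMaxOn (Set.nonempty_Icc.2 hh.le) hec.norm
  set S := ‖e t₀‖ with hS
  have hSe : ∀ t ∈ Set.Icc 0 h, ‖e t‖ ≤ S := fun t ht => hmax ht
  have hgS : ∀ t ∈ Set.Icc 0 h, ‖-g t‖ ≤ M * S := fun t ht => by
    rw [norm_neg]
    exact (hf.norm_gradient_sub_le hm.le hM _ _).trans (by gcongr; exact hSe t ht)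
  have hwS : ∀ t ∈ Set.Icc 0 h, ‖w t‖ ≤ M * S * t := fun t ht => by
    have := (convex_Icc 0 h).norm_image_sub_le_of_norm_hasDerivWithin_le hdw hgS h0 ht
    rwa [hw0, sub_zero, sub_zero, Real.norm_of_nonneg ht.1] at this
  have heS : ∀ t ∈ Set.Icc 0 h, ‖e t - e 0‖ ≤ S / 4 := fun t ht => by
    have := (convex_Icc 0 h).norm_image_sub_le_of_norm_hasDerivWithin_le hde (C := M * S * h)
      (fun s hs => (hwS s hs).trans (by gcongr; exact hs.2)) h0 ht
    rw [sub_zero, Real.norm_of_nonneg ht.1] at this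
    calc _ ≤ M * S * h * t := this
      _ ≤ M * S * h * h := by gcongr; exact ht.2
      _ = M * h ^ 2 * S := by ring
      _ ≤ 1 / 4 * S := by gcongr
      _ = S / 4 := by ring
  set D := ‖x - y‖ with hD
  -- The maximal distance satisfies S ≤ D + S/4; conversely, every e t stays within D/3 of e 0.
  have hSD : S ≤ 4 / 3 * D := by
    have h1 := norm_sub_norm_le (e t₀) (e 0)
    have h2 := heS t₀ ht₀
    rw [he0] at h1 h2
    linarith
  have heD : ∀ t ∈ Set.Icc 0 h, 2 / 3 * D ≤ ‖e t‖ := fun t ht => by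
    have h1 := norm_sub_norm_le (e 0) (e t)
    have h2 := heS t ht
    rw [norm_sub_rev, he0] at h2
    rw [he0] at h1
    linarith
  have hD0 : 0 ≤ D := norm_nonneg _
  have hS0 : 0 ≤ S := norm_nonneg _
  -- The position at time h predicted from time t by free motion. Its endpoints are e 0, since w 0 =
  -- 0, and e h; the terms in w cancel in its derivative.
  set ψ : ℝ → E d := fun t => e t + (h - t) • w t with hψ
  have hdψ : ∀ t ∈ Set.Icc 0 h, HasDerivWithinAt ψ (-((h - t) • g t)) (Set.Icc 0 h) t :=
    fun t ht => by
    have h1 : HasDerivWithinAt (fun t : ℝ => h - t) (-1) (Set.Icc 0 h) t :=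
      (hasDerivWithinAt_id t _).const_sub h
    refine ((hde t ht).add (h1.smul (hdw t ht))).congr_deriv ?_
    simp
  have hkey : ∀ t ∈ Set.Icc 0 h, m / 4 * D ^ 2 ≤ inner ℝ (ψ t) (g t) := fun t ht => by
    set Γ := inner ℝ (e t) (g t) with hΓ
    have h1 : m * ‖e t‖ ^ 2 ≤ Γ := by
      rw [hΓ, real_inner_comm]; exact hf.inner_gradient_sub_ge _ _
    have h2 : ‖g t‖ ^ 2 ≤ M * Γ := by
      rw [hΓ, real_inner_comm]; exact hf.sq_norm_gradient_sub_le hm.le hM _ _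
    have h3 : ‖(h - t) • w t‖ ≤ M * h ^ 2 * S / 4 := by
      rw [norm_smul, Real.norm_of_nonneg (sub_nonneg.2 ht.2)]
      calc (h - t) * ‖w t‖ ≤ (h - t) * (M * S * t) := by
            have := sub_nonneg.2 ht.2
            gcongr; exact hwS t ht
        _ = M * S * ((h - t) * t) := by ring
        _ ≤ M * S * (h ^ 2 / 4) := by gcongr; nlinarith [sq_nonneg (h - 2 * t)]
        _ = _ := by ring
    set c := ‖(h - t) • w t‖ with hc
    have hc0 : 0 ≤ c := norm_nonneg _
    have h4 : -(c * ‖g t‖) ≤ inner ℝ ((h - t) • w t) (g t) :=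
      neg_le_of_abs_le (abs_real_inner_le_norm _ _)
    -- Young's inequality, weighted so that cocoercivity ‖g‖² ≤ MΓ turns the gradient part into Γ/8.
    have h5 : c * ‖g t‖ ≤ Γ / 8 + 2 * M * c ^ 2 := by
      have h6 : 0 ≤ (‖g t‖ - 4 * M * c) ^ 2 := sq_nonneg _
      have h7 : 8 * M * (c * ‖g t‖) ≤ 8 * M * (Γ / 8 + 2 * M * c ^ 2) := by nlinarith
      exact le_of_mul_le_mul_left h7 (by positivity)
    -- The condition M³h⁴ ≤ m/16 is what makes the drift term small compared with m D².
    have h8 : 2 * M * c ^ 2 ≤ m * D ^ 2 / 72 := by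
      calc 2 * M * c ^ 2 ≤ 2 * M * (M * h ^ 2 * (4 / 3 * D) / 4) ^ 2 := by
            gcongr; exact h3.trans (by gcongr)
        _ = 2 / 9 * (M ^ 3 * h ^ 4) * D ^ 2 := by ring
        _ ≤ 2 / 9 * (m / 16) * D ^ 2 := by gcongr
        _ = _ := by ring
    have h9 : m * (2 / 3 * D) ^ 2 ≤ m * ‖e t‖ ^ 2 := by
      have := heD t ht
      gcongr
    have h10 : inner ℝ (ψ t) (g t) = Γ + inner ℝ ((h - t) • w t) (g t) := by
      rw [hψ, inner_add_left]
    have h11 : 0 ≤ m * D ^ 2 := by positivity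
    rw [h10]
    -- The coefficient of m D² is (7/8)(4/9) - 1/72 = 3/8, more than the required 1/4.
    nlinarith
  have hanti : AntitoneOn (fun t => ‖ψ t‖ ^ 2 - m / 4 * D ^ 2 * (h - t) ^ 2) (Set.Icc 0 h) := by
    have hd : ∀ t ∈ Set.Icc 0 h, HasDerivWithinAt
        (fun t => ‖ψ t‖ ^ 2 - m / 4 * D ^ 2 * (h - t) ^ 2)
        (-(2 * (h - t) * (inner ℝ (ψ t) (g t) - m / 4 * D ^ 2))) (Set.Icc 0 h) t := fun t ht => by
      have h1 : HasDerivWithinAt (fun t : ℝ => (h - t) ^ 2) (2 * (h - t) * -1) (Set.Icc 0 h) t := by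
        have := ((hasDerivWithinAt_id t (Set.Icc 0 h)).const_sub h).pow 2
        exact this.congr_deriv (by simp)
      refine ((hdψ t ht).norm_sq.sub (h1.const_mul (m / 4 * D ^ 2))).congr_deriv ?_
      rw [inner_neg_right, inner_smul_right]
      ring
    refine antitoneOn_of_hasDerivWithinAt_nonpos (convex_Icc 0 h)
      (fun t ht => (hd t ht).continuousWithinAt)
      (fun t ht => (hd t (interior_subset ht)).mono interior_subset) fun t ht => ?_
    have ht' := interior_subset ht
    have h1 := hkey t ht'
    have h2 : 0 ≤ 2 * (h - t) * (inner ℝ (ψ t) (g t) - m / 4 * D ^ 2) :=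
      mul_nonneg (by linarith [ht'.2]) (by linarith)
    linarith
  have hfin := hanti h0 hhm hh.le
  have e1 : ψ h = q h - q' h := by simp [hψ, he]
  have e2 : ψ 0 = x - y := by simp [hψ, hw0, he0]
  simp only [e1, e2, sub_self, sub_zero] at hfin
  -- The square contracts by 1 - mh²/4, which is at most (1 - mh²/8)².
  refine abs_le_of_sq_le_sq' ?_ (mul_nonneg (by linarith) hD0) |>.2
  have : 0 ≤ (m * h ^ 2) ^ 2 * D ^ 2 := by positivity
  linarith

end IsHMCPath

/-! ### The position Verlet integrator -/

/-- One step of length `δ` of the position Verlet integrator for `q'' = -G q`. -/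
def verletStep (G : E d → E d) (δ : ℝ) (z : E d × E d) : E d × E d :=
  (z.1 + (δ / 2) • z.2 + (δ / 2) • (z.2 - δ • G (z.1 + (δ / 2) • z.2)),
    z.2 - δ • G (z.1 + (δ / 2) • z.2))

/-- Over one step the integrator uses a constant force a. Both errors are governed by the distance A
of the true force from a, which the Lipschitz bound of the gradient controls. -/
theorem IsHMCPath.verletStep_error {x v : E d} {q p : ℝ → E d} (hq : IsHMCPath f h x v q p)
    (hf : HessianBounds f m M) (hm : 0 ≤ m) (hM : 0 < M) {P : ℝ}
    (hP : ∀ t ∈ Set.Icc 0 h, ‖p t‖ ≤ P) {t₀ δ : ℝ} (ht₀ : 0 ≤ t₀) (hδ : 0 ≤ δ) (hδh : t₀ + δ ≤ h)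
    (z : E d × E d) :
    ‖q (t₀ + δ) - (verletStep (gradient f) δ z).1‖ ≤
      ‖q t₀ - z.1‖ + δ * ‖p t₀ - z.2‖ +
        δ ^ 2 * (M * (3 / 2 * δ * P + ‖q t₀ - z.1‖ + δ * ‖p t₀ - z.2‖)) ∧
    ‖p (t₀ + δ) - (verletStep (gradient f) δ z).2‖ ≤
      ‖p t₀ - z.2‖ + δ * (M * (3 / 2 * δ * P + ‖q t₀ - z.1‖ + δ * ‖p t₀ - z.2‖)) := by
  set e := ‖q t₀ - z.1‖ with he
  set w := ‖p t₀ - z.2‖ with hw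
  set A := M * (3 / 2 * δ * P + e + δ * w) with hA
  set y := z.1 + (δ / 2) • z.2 with hy
  set a := gradient f y with ha
  have hsub : Set.Icc t₀ (t₀ + δ) ⊆ Set.Icc 0 h := Set.Icc_subset_Icc ht₀ hδh
  have hl : t₀ ∈ Set.Icc t₀ (t₀ + δ) := ⟨le_rfl, by linarith⟩
  have hr : t₀ + δ ∈ Set.Icc t₀ (t₀ + δ) := ⟨by linarith, le_rfl⟩
  have he0 : 0 ≤ e := norm_nonneg _
  have hw0 : 0 ≤ w := norm_nonneg _
  have hP0 : 0 ≤ P := (norm_nonneg _).trans (hP t₀ (hsub hl))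
  have hA0 : 0 ≤ A := by positivity
  have hz2 : ‖z.2‖ ≤ P + w := by
    have h1 := norm_sub_norm_le z.2 (p t₀)
    rw [norm_sub_rev] at h1
    linarith [hP t₀ (hsub hl)]
  -- The 3/2 consists of δP for the motion of q within the step and δP/2 for the half drift that
  -- leads to the evaluation point y.
  have hforce : ∀ s ∈ Set.Icc t₀ (t₀ + δ), ‖-gradient f (q s) + a‖ ≤ A := fun s hs => by
    rw [neg_add_eq_sub, norm_sub_rev]
    refine (hf.norm_gradient_sub_le hm hM _ _).trans ?_
    rw [hA]
    gcongr
    have h1 := hq.norm_position_sub_le hP (hsub hl) (hsub hs) hs.1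
    have h2 : q s - y = (q s - q t₀) + (q t₀ - z.1) - (δ / 2) • z.2 := by rw [hy]; abel
    have h3 : ‖(δ / 2) • z.2‖ ≤ δ / 2 * (P + w) := by
      rw [norm_smul, Real.norm_of_nonneg (by linarith)]; gcongr
    have h4 := norm_sub_le ((q s - q t₀) + (q t₀ - z.1)) ((δ / 2) • z.2)
    have h5 := norm_add_le (q s - q t₀) (q t₀ - z.1)
    have h6 : P * (s - t₀) ≤ P * δ := by gcongr; linarith [hs.2]
    rw [h2]
    nlinarith [mul_nonneg hδ hw0]
  have hdr : ∀ s ∈ Set.Icc t₀ (t₀ + δ), HasDerivWithinAt (fun s => p s + (s - t₀) • a)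
      (-gradient f (q s) + a) (Set.Icc t₀ (t₀ + δ)) s := fun s hs =>
    (((hq.deriv_velocity s (hsub hs)).mono hsub).add
      (((hasDerivWithinAt_id s _).sub_const t₀).smul_const a)).congr_deriv (by simp)
  have hrA : ∀ s ∈ Set.Icc t₀ (t₀ + δ), ‖p s + (s - t₀) • a - p t₀‖ ≤ A * δ := fun s hs => by
    have h1 := (convex_Icc _ _).norm_image_sub_le_of_norm_hasDerivWithin_le hdr hforce hl hs
    rw [sub_self, zero_smul, add_zero, Real.norm_of_nonneg (by linarith [hs.1])] at h1
    refine h1.trans ?_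
    gcongr
    linarith [hs.2]
  constructor
  · have hdz : ∀ s ∈ Set.Icc t₀ (t₀ + δ), HasDerivWithinAt
        (fun s => q s - (s - t₀) • z.2 + ((s - t₀) ^ 2 / 2) • a)
        (p s - z.2 + (s - t₀) • a) (Set.Icc t₀ (t₀ + δ)) s := fun s hs => by
      have h1 := (hasDerivWithinAt_id s (Set.Icc t₀ (t₀ + δ))).sub_const t₀
      have h2 := ((h1.pow 2).div_const 2).smul_const a
      refine ((((hq.deriv_position s (hsub hs)).mono hsub).sub (h1.smul_const z.2)).add
        h2).congr_deriv ?_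
      simp
    have h1 := (convex_Icc _ _).norm_image_sub_le_of_norm_hasDerivWithin_le hdz
      (C := A * δ + w) (fun s hs => by
        have h2 : p s - z.2 + (s - t₀) • a = (p s + (s - t₀) • a - p t₀) + (p t₀ - z.2) := by abel
        rw [h2]
        exact (norm_add_le _ _).trans (add_le_add (hrA s hs) le_rfl)) hl hr
    rw [add_sub_cancel_left, Real.norm_of_nonneg hδ] at h1
    have h2 : q (t₀ + δ) - (verletStep (gradient f) δ z).1 =
        (q (t₀ + δ) - δ • z.2 + (δ ^ 2 / 2) • a -
          (q t₀ - (t₀ - t₀) • z.2 + ((t₀ - t₀) ^ 2 / 2) • a)) + (q t₀ - z.1) := by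
      simp only [verletStep, ← hy, ← ha]
      module
    rw [h2]
    refine (norm_add_le _ _).trans ?_
    linarith
  · have h2 : p (t₀ + δ) - (verletStep (gradient f) δ z).2 =
        (p (t₀ + δ) + (t₀ + δ - t₀) • a - p t₀) + (p t₀ - z.2) := by
      simp only [verletStep, ← hy, ← ha]
      module
    rw [h2]
    refine (norm_add_le _ _).trans ?_
    linarith [hrA _ hr]

/-- With weight h on the velocity error, one step multiplies the total error by at most 1 + 2/n and
adds at most 3hδ²MP, to which a discrete Gronwall argument applies. The order 1/n is all that a
Lipschitz gradient is used for. -/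
theorem IsHMCPath.verlet_error {x v : E d} {q p : ℝ → E d} (hq : IsHMCPath f h x v q p)
    (hf : HessianBounds f m M) (hm : 0 ≤ m) (hM : 0 < M) (hh : 0 < h) (hMh : M * h ^ 2 ≤ 1 / 4)
    {n : ℕ} (hn : 0 < n) :
    ‖q h - ((verletStep (gradient f) (h / n))^[n] (x, v)).1‖ +
      h * ‖p h - ((verletStep (gradient f) (h / n))^[n] (x, v)).2‖ ≤
        32 * h ^ 3 * M * (‖v‖ + h * ‖gradient f x‖) / n := by
  obtain ⟨P, hP0, hP, hPV⟩ := hq.exists_velocity_bound hf hm hM hh hMh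
  have hn' : (0 : ℝ) < n := by exact_mod_cast hn
  have hn1 : (1 : ℝ) ≤ n := by exact_mod_cast hn
  set δ := h / n with hδ
  have hδ0 : 0 < δ := by positivity
  have hδn : δ * n = h := by rw [hδ]; field_simp
  have hδh : δ ≤ h := by rw [hδ]; exact div_le_self hh.le hn1
  set z : ℕ → E d × E d := fun k => (verletStep (gradient f) δ)^[k] (x, v) with hz
  set err : ℕ → ℝ := fun k => ‖q (k * δ) - (z k).1‖ + h * ‖p (k * δ) - (z k).2‖ with herr
  have herr0 : ∀ k, 0 ≤ err k := fun k => by positivity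
  have hstep : ∀ k < n, err (k + 1) ≤ (1 + 2 / n) * err k + 3 * h * δ ^ 2 * M * P := by
    intro k hk
    have hk' : (k : ℝ) + 1 ≤ n := by exact_mod_cast hk
    have hle : k * δ + δ ≤ h := by nlinarith
    obtain ⟨h1, h2⟩ := hq.verletStep_error hf hm hM hP (by positivity) hδ0.le hle (z k)
    have hz1 : z (k + 1) = verletStep (gradient f) δ (z k) := Function.iterate_succ_apply' _ _ _
    have hk1 : ((k + 1 : ℕ) : ℝ) * δ = k * δ + δ := by push_cast; ring
    simp only [herr, hk1, hz1]
    set e := ‖q (k * δ) - (z k).1‖ with he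
    set w := ‖p (k * δ) - (z k).2‖ with hw
    have he0 : 0 ≤ e := norm_nonneg _
    have hw0 : 0 ≤ w := norm_nonneg _
    set A := M * (3 / 2 * δ * P + e + δ * w) with hA
    have hA0 : 0 ≤ A := by positivity
    have hA1 : A ≤ M * (3 / 2 * δ * P + (e + h * w)) := by
      rw [hA, add_assoc]; gcongr
    have h3 : δ ^ 2 * A ≤ h * δ * A := by rw [pow_two]; gcongr
    have h4 : 2 * (h * δ * A) ≤ 2 * (h * δ * (M * (3 / 2 * δ * P + (e + h * w)))) := by gcongr
    have h5 : 2 * h * δ * M * (e + h * w) ≤ 1 / 2 * (e + h * w) / n := by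
      have : 2 * h * δ * M * (e + h * w) = 2 * (M * h ^ 2) * (e + h * w) / n := by
        rw [hδ]; ring
      rw [this]; gcongr; linarith
    have h6 : δ * w ≤ (e + h * w) / n := by
      have : δ * w = h * w / n := by rw [hδ]; ring
      rw [this]; gcongr; linarith
    have h7 : 0 ≤ (e + h * w) / n := by positivity
    have h8 : (1 + 2 / (n : ℝ)) * (e + h * w) = e + h * w + 2 * ((e + h * w) / n) := by ring
    rw [h8]
    have h9 := mul_le_mul_of_nonneg_left h2 hh.le
    have h10 : 1 / 2 * (e + h * w) / n = 1 / 2 * ((e + h * w) / n) := by ring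
    linarith
  have hbound : ∀ k ≤ n, err k ≤ k * (1 + 2 / (n : ℝ)) ^ k * (3 * h * δ ^ 2 * M * P) := by
    intro k
    induction k with
    | zero => intro _; simp [herr, hz, hq.position_zero, hq.velocity_zero]
    | succ k ih =>
      intro hk
      have h1 := hstep k (by omega)
      have h2 := ih (by omega)
      have h3 : (1 : ℝ) ≤ (1 + 2 / (n : ℝ)) ^ (k + 1) :=
        one_le_pow₀ (by have : (0 : ℝ) ≤ 2 / n := by positivity
                        linarith)
      have h4 : 0 ≤ 3 * h * δ ^ 2 * M * P := by positivity
      have h5 : (1 + 2 / (n : ℝ)) * err k ≤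
          (1 + 2 / (n : ℝ)) * (k * (1 + 2 / (n : ℝ)) ^ k * (3 * h * δ ^ 2 * M * P)) := by gcongr
      have h6 := mul_le_mul_of_nonneg_right h3 h4
      push_cast
      rw [pow_succ (1 + 2 / (n : ℝ))] at h6 ⊢
      linarith
  have hfin := hbound n le_rfl
  -- The growth factor is at most e² < 8; with the speed bound, 8 · 3 · 4/3 = 32 is the final
  -- constant.
  have hexp : (1 + 2 / (n : ℝ)) ^ n ≤ 8 := by
    have h1 : (1 + 2 / (n : ℝ)) ^ n ≤ Real.exp (2 / n) ^ n := by
      gcongr; rw [add_comm]; exact Real.add_one_le_exp _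
    have h2 : Real.exp (2 / n) ^ n = Real.exp 1 ^ 2 := by
      rw [← Real.exp_nat_mul, ← Real.exp_nat_mul]; congr 1; field_simp; norm_num
    rw [h2] at h1
    have := Real.exp_one_lt_d9
    have h0 := Real.exp_pos 1
    nlinarith
  have hlast : err n = ‖q h - (z n).1‖ + h * ‖p h - (z n).2‖ := by
    simp only [herr, mul_comm (n : ℝ) δ, hδn]
  rw [hlast] at hfin
  refine hfin.trans ?_
  calc n * (1 + 2 / (n : ℝ)) ^ n * (3 * h * δ ^ 2 * M * P)
      ≤ n * 8 * (3 * h * δ ^ 2 * M * (4 / 3 * (‖v‖ + h * ‖gradient f x‖))) := by gcongr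
    _ = _ := by rw [hδ]; field_simp; ring

end Dynamics

/-! ### Gibbs measures -/

theorem integrable_exp_neg_mul_norm_sub_sq {d : ℕ} {b : ℝ} (hb : 0 < b) (x₀ : E d) :
    Integrable (fun x : E d => Real.exp (-b * ‖x - x₀‖ ^ 2)) := by
  have h1 : Integrable (fun x : E d => Real.exp (-b * ‖x‖ ^ 2)) := by
    refine Integrable.of_integral_ne_zero ?_
    rw [GaussianFourier.integral_rexp_neg_mul_sq_norm hb]
    positivity
  exact h1.comp_sub_right x₀

/-- Proved by comparing characteristic functions. It exhibits position and velocity jointly as a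
measure with density exp(-energy). -/
theorem stdGaussian_eq_gibbs (d : ℕ) : stdGaussian (E d) = gibbs fun v : E d => ‖v‖ ^ 2 / 2 := by
  have hint : Integrable (fun v : E d => Real.exp (-(‖v‖ ^ 2 / 2))) := by
    refine (integrable_exp_neg_mul_norm_sub_sq (b := 1 / 2) (by norm_num) (0 : E d)).congr
      (ae_of_all _ fun v => ?_)
    simp only [sub_zero]
    ring_nf
  have : IsProbabilityMeasure (gibbs fun v : E d => ‖v‖ ^ 2 / 2) :=
    isProbabilityMeasure_tilted hint
  have hZ : ((∫ v : E d, Real.exp (-(‖v‖ ^ 2 / 2)) : ℝ) : ℂ) =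
      (Real.pi / (1 / 2 : ℂ)) ^ (Module.finrank ℝ (E d) / 2 : ℂ) := by
    rw [← GaussianFourier.integral_cexp_neg_mul_sq_norm (V := E d) (by norm_num),
      ← integral_complex_ofReal]
    congr 1 with v
    push_cast
    congr 1
    ring
  have hZ0 : ((∫ v : E d, Real.exp (-(‖v‖ ^ 2 / 2)) : ℝ) : ℂ) ≠ 0 := by
    exact_mod_cast (integral_exp_pos hint).ne'
  refine Measure.ext_of_charFun ?_
  ext t
  rw [charFun_stdGaussian, charFun_apply, gibbs, integral_tilted]
  have key := GaussianFourier.integral_cexp_neg_mul_sq_norm_add (V := E d) (b := 1 / 2)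
    (by norm_num) Complex.I t
  have : ∀ v : E d, (Real.exp (-(‖v‖ ^ 2 / 2)) / ∫ v : E d, Real.exp (-(‖v‖ ^ 2 / 2))) •
      Complex.exp (inner ℝ v t * Complex.I) =
      ((∫ v : E d, Real.exp (-(‖v‖ ^ 2 / 2)) : ℝ) : ℂ)⁻¹ *
        Complex.exp (-(1 / 2) * ‖v‖ ^ 2 + Complex.I * inner ℝ t v) := fun v => by
    rw [Complex.real_smul, Complex.exp_add, real_inner_comm]
    push_cast
    rw [div_eq_inv_mul, mul_comm Complex.I, mul_assoc]
    congr 4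
    ring
  simp_rw [this]
  rw [integral_const_mul, key, ← hZ, inv_mul_cancel_left₀ hZ0]
  congr 1
  simp
  ring

/-- A measure-preserving approximation of a map that preserves the density shows that the map
preserves the weighted measure. -/
theorem map_withDensity_eq_of_tendsto {α : Type*} [TopologicalSpace α] [MeasurableSpace α]
    [BorelSpace α] [HasOuterApproxClosed α] {μ : Measure α} {Φ : ℕ → α → α} {Ψ : α → α}
    {w : α → ℝ≥0∞} (hΦ : ∀ᶠ n in Filter.atTop, MeasurePreserving (Φ n) μ μ) (hΨ : Measurable Ψ)
    (hlim : ∀ z, Filter.Tendsto (fun n => Φ n z) Filter.atTop (nhds (Ψ z))) (hw : Continuous w)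
    (hwtop : ∀ z, w z ≠ ⊤) (hwΨ : ∀ z, w (Ψ z) = w z) [IsFiniteMeasure (μ.withDensity w)] :
    (μ.withDensity w).map Ψ = μ.withDensity w := by
  obtain ⟨N, hN⟩ := Filter.eventually_atTop.1 hΦ
  set Φ' : ℕ → α → α := fun n => Φ (n + N) with hΦ'
  have hmp : ∀ n, MeasurePreserving (Φ' n) μ μ := fun n => hN _ (by omega)
  have hlim' : ∀ z, Filter.Tendsto (fun n => Φ' n z) Filter.atTop (nhds (Ψ z)) := fun z =>
    (hlim z).comp (Filter.tendsto_add_atTop_nat N)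
  -- Fatou's lemma along the approximating maps, after replacing w z by w (Ψ z); it gives one
  -- inequality for every test function.
  have hle : ∀ φ : BoundedContinuousFunction α NNReal,
      ∫⁻ z, φ z ∂(μ.withDensity w).map Ψ ≤ ∫⁻ z, φ z ∂(μ.withDensity w) := fun φ => by
    have hφ : Measurable fun z => (φ z : ℝ≥0∞) := by
      have := φ.continuous.measurable
      fun_prop
    have hcont : Continuous fun z => w z * (φ z : ℝ≥0∞) := by
      rw [continuous_iff_continuousAt]
      exact fun z => ENNReal.Tendsto.mul hw.continuousAt (Or.inr ENNReal.coe_ne_top)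
        (ENNReal.continuous_coe.comp φ.continuous).continuousAt (Or.inr (hwtop z))
    have h1 : ∫⁻ z, φ (Ψ z) ∂(μ.withDensity w) = ∫⁻ z, w z * φ (Ψ z) ∂μ :=
      lintegral_withDensity_eq_lintegral_mul _ hw.measurable (hφ.comp hΨ)
    have h2 : ∫⁻ z, φ z ∂(μ.withDensity w) = ∫⁻ z, w z * φ z ∂μ :=
      lintegral_withDensity_eq_lintegral_mul _ hw.measurable hφ
    rw [lintegral_map hφ hΨ, h1, h2]
    calc ∫⁻ z, w z * φ (Ψ z) ∂μ
        = ∫⁻ z, Filter.liminf (fun n => w (Φ' n z) * φ (Φ' n z)) Filter.atTop ∂μ := by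
          refine lintegral_congr fun z => ?_
          rw [← hwΨ z]
          exact ((hcont.tendsto (Ψ z)).comp (hlim' z)).liminf_eq.symm
      _ ≤ Filter.liminf (fun n => ∫⁻ z, w (Φ' n z) * φ (Φ' n z) ∂μ) Filter.atTop :=
          lintegral_liminf_le fun n => hcont.measurable.comp (hmp n).measurable
      _ = ∫⁻ z, w z * φ z ∂μ := by
          have : ∀ n, ∫⁻ z, w (Φ' n z) * φ (Φ' n z) ∂μ = ∫⁻ z, w z * φ z ∂μ := fun n =>
            (hmp n).lintegral_comp hcont.measurable
          simp_rw [this]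
          exact Filter.liminf_const _
  have : IsFiniteMeasure ((μ.withDensity w).map Ψ) := inferInstance
  refine ext_of_forall_lintegral_eq_of_IsFiniteMeasure fun φ => le_antisymm (hle φ) ?_
  -- The same inequality for K - φ, together with equality of the total masses, gives the reverse
  -- inequality for φ.
  set K : NNReal := nndist 0 φ with hK
  have hφK : ∀ z, φ z ≤ K := fun z => φ.apply_le_nndist_zero z
  let φ' : BoundedContinuousFunction α NNReal := BoundedContinuousFunction.const α K - φ
  have hsum : ∀ ν : Measure α, ∫⁻ z, φ z ∂ν + ∫⁻ z, φ' z ∂ν = K * ν Set.univ := fun ν => by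
    rw [← lintegral_add_left (by have := φ.continuous.measurable; fun_prop), ← lintegral_const]
    refine lintegral_congr fun z => ?_
    rw [← ENNReal.coe_add]
    congr 1
    exact add_tsub_cancel_of_le (hφK z)
  have hmass : (μ.withDensity w).map Ψ Set.univ = μ.withDensity w Set.univ := by
    rw [Measure.map_apply hΨ MeasurableSet.univ, Set.preimage_univ]
  have h1 := hsum ((μ.withDensity w).map Ψ)
  rw [hmass, ← hsum (μ.withDensity w)] at h1
  have hfin : ∫⁻ z, φ' z ∂(μ.withDensity w) ≠ ⊤ := by
    refine ne_top_of_le_ne_top ?_ (le_add_self.trans_eq (hsum (μ.withDensity w)))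
    exact ENNReal.mul_ne_top ENNReal.coe_ne_top (measure_ne_top _ _)
  have h2 : ∫⁻ z, φ z ∂(μ.withDensity w) + ∫⁻ z, φ' z ∂(μ.withDensity w) ≤
      ∫⁻ z, φ z ∂(μ.withDensity w).map Ψ + ∫⁻ z, φ' z ∂(μ.withDensity w) := by
    rw [← h1]; exact add_le_add le_rfl (hle φ')
  exact (ENNReal.add_le_add_iff_right hfin).1 h2

/-- Drift, kick, drift: each is a shear that translates one coordinate by a function of the other.
Measurability of G suffices. -/
theorem measurePreserving_verletStep {d : ℕ} {G : E d → E d} (hG : Measurable G) (δ : ℝ) :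
    MeasurePreserving (verletStep G δ) (volume.prod volume) (volume.prod volume) := by
  have hkick : MeasurePreserving (fun z : E d × E d => (z.1, z.2 - δ • G z.1))
      (volume.prod volume) (volume.prod volume) :=
    MeasurePreserving.skew_product (MeasurePreserving.id volume)
      (g := fun q p => p - δ • G q)
      (measurable_snd.sub ((hG.comp measurable_fst).const_smul δ))
      (ae_of_all _ fun q => (measurePreserving_sub_right volume (δ • G q)).map_eq)
  have hdrift' : MeasurePreserving (fun z : E d × E d => (z.1, z.2 + (δ / 2) • z.1))
      (volume.prod volume) (volume.prod volume) :=
    MeasurePreserving.skew_product (MeasurePreserving.id volume)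
      (g := fun p q => q + (δ / 2) • p)
      (measurable_snd.add (measurable_fst.const_smul (δ / 2)))
      (ae_of_all _ fun q => (measurePreserving_add_right volume ((δ / 2) • q)).map_eq)
  have hdrift : MeasurePreserving (fun z : E d × E d => (z.1 + (δ / 2) • z.2, z.2))
      (volume.prod volume) (volume.prod volume) :=
    (Measure.measurePreserving_swap.comp hdrift').comp Measure.measurePreserving_swap
  exact (hdrift.comp hkick).comp hdrift

section

variable {d : ℕ} {f : E d → ℝ} {m M h : ℝ}

/-! ### Normalization and second moment of the Gibbs measure -/

namespace HessianBounds

theorem continuous (hf : HessianBounds f m M) : Continuous f := hf.differentiable.continuous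

theorem continuous_gradient (hf : HessianBounds f m M) : Continuous (gradient f) :=
  hf.differentiable_gradient.continuous

theorem quadratic_growth (hf : HessianBounds f m M) {x₀ : E d} (hx₀ : ∀ y, f x₀ ≤ f y) (y : E d) :
    f x₀ + m / 2 * ‖y - x₀‖ ^ 2 ≤ f y := by
  simpa [gradient_eq_zero_of_forall_le hx₀] using hf.quadratic_lower x₀ y

theorem integrable_exp_neg (hf : HessianBounds f m M) (hm : 0 < m) {x₀ : E d}
    (hx₀ : ∀ y, f x₀ ≤ f y) : Integrable fun x => Real.exp (-f x) := by
  refine ((integrable_exp_neg_mul_norm_sub_sq (b := m / 2) (by positivity) x₀).const_mul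
    (Real.exp (-f x₀))).mono' (by have := hf.continuous; fun_prop) (ae_of_all _ fun y => ?_)
  rw [Real.norm_of_nonneg (Real.exp_pos _).le, ← Real.exp_add]
  refine Real.exp_le_exp.2 ?_
  linarith [hf.quadratic_growth hx₀ y]

theorem isProbabilityMeasure_gibbs (hf : HessianBounds f m M) (hm : 0 < m) {x₀ : E d}
    (hx₀ : ∀ y, f x₀ ≤ f y) : IsProbabilityMeasure (gibbs f) :=
  isProbabilityMeasure_tilted (hf.integrable_exp_neg hm hx₀)

/-- Strong convexity between the midpoint and x₀ + u gives 1/8, and strong monotonicity between x₀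
and the midpoint gives 1/4. It serves to compare the Gibbs density with its dilation by two. -/
theorem growth_midpoint (hf : HessianBounds f m M) {x₀ : E d}
    (hx₀ : ∀ y, f x₀ ≤ f y) (u : E d) :
    f (x₀ + (1 / 2 : ℝ) • u) + 3 / 8 * m * ‖u‖ ^ 2 ≤ f (x₀ + u) := by
  have h1 := hf.quadratic_lower (x₀ + (1 / 2 : ℝ) • u) (x₀ + u)
  have h2 := hf.inner_gradient_sub_ge (x₀ + (1 / 2 : ℝ) • u) x₀
  have e1 : x₀ + u - (x₀ + (1 / 2 : ℝ) • u) = (1 / 2 : ℝ) • u := by module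
  rw [e1, norm_smul, Real.norm_of_nonneg (by norm_num)] at h1
  rw [gradient_eq_zero_of_forall_le hx₀, sub_zero, add_sub_cancel_left, norm_smul,
    Real.norm_of_nonneg (by norm_num)] at h2
  linarith

/-- The second moment of the Gibbs measure around the minimizer. -/
theorem second_moment_gibbs (hf : HessianBounds f m M) (hm : 0 < m) {x₀ : E d}
    (hx₀ : ∀ y, f x₀ ≤ f y) :
    Integrable (fun y => ‖y - x₀‖ ^ 2) (gibbs f) ∧
      ∫ y, ‖y - x₀‖ ^ 2 ∂gibbs f ≤ 2 * d / m := by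
  have hc := hf.continuous
  have hZi := hf.integrable_exp_neg hm hx₀
  set Z := ∫ x, Real.exp (-f x) with hZ
  have hZ0 : 0 < Z := integral_exp_pos hZi
  set w : E d → ℝ := fun u => Real.exp (-f (x₀ + u)) with hw
  have hwi : Integrable w := by simpa [hw, add_comm] using hZi.comp_add_right x₀
  have hwZ : ∫ u, w u = Z := by
    simpa [hw, add_comm] using integral_add_right_eq_self (fun x => Real.exp (-f x)) x₀
  have hwc : Continuous w := by fun_prop
  have hhalf : Integrable fun u => w ((1 / 2 : ℝ) • u) := hwi.comp_smul (by norm_num)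
  have hhalfZ : ∫ u, w ((1 / 2 : ℝ) • u) = 2 ^ d * Z := by
    rw [Measure.integral_comp_smul, hwZ, finrank_euclideanSpace_fin, smul_eq_mul]
    simp
  set X : E d → ℝ := fun u => 3 / 8 * m * ‖u‖ ^ 2 with hX
  have hX0 : ∀ u, 0 ≤ X u := fun u => by positivity
  have hle : ∀ u, Real.exp (X u) * w u ≤ w ((1 / 2 : ℝ) • u) := fun u => by
    simp only [hw, hX]
    rw [← Real.exp_add]
    exact Real.exp_le_exp.2 (by linarith [hf.growth_midpoint hx₀ u])
  have hXw : Integrable fun u => X u * w u := by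
    refine hhalf.mono' (by fun_prop) (ae_of_all _ fun u => ?_)
    have hw0 : 0 < w u := Real.exp_pos _
    rw [Real.norm_of_nonneg (mul_nonneg (hX0 u) hw0.le)]
    refine le_trans ?_ (hle u)
    gcongr
    linarith [Real.add_one_le_exp (X u)]
  -- Under w/Z the mean of exp X is at most 2^d, so Jensen bounds the mean of X by d log 2.
  -- Concretely, exp is bounded below by its tangent at d log 2, which avoids integration by parts.
  have hXd : ∫ u, X u * w u ≤ d * Real.log 2 * Z := by
    have hpt : ∀ u, (2 : ℝ) ^ d * (X u * w u) + 2 ^ d * (1 - d * Real.log 2) * w u ≤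
        w ((1 / 2 : ℝ) • u) := fun u => by
      refine le_trans ?_ (hle u)
      have h1 : (2 : ℝ) ^ d = Real.exp (d * Real.log 2) := by
        rw [Real.exp_nat_mul, Real.exp_log (by norm_num)]
      have h2 : Real.exp (X u) = Real.exp (d * Real.log 2) * Real.exp (X u - d * Real.log 2) := by
        rw [← Real.exp_add]; congr 1; ring
      have h3 := Real.add_one_le_exp (X u - d * Real.log 2)
      have hw0 : 0 < w u := Real.exp_pos _
      have h4 : (2 : ℝ) ^ d * ((X u - d * Real.log 2 + 1) * w u) ≤
        (2 : ℝ) ^ d * (Real.exp (X u - d * Real.log 2) * w u) := by gcongr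
      rw [h2, ← h1]
      linarith
    have h1 := integral_mono ((hXw.const_mul _).add (hwi.const_mul _)) hhalf hpt
    rw [integral_add' (hXw.const_mul _) (hwi.const_mul _), integral_const_mul, integral_const_mul,
      hwZ, hhalfZ] at h1
    have h2 : (2 : ℝ) ^ d * (∫ u, X u * w u) ≤ 2 ^ d * (d * Real.log 2 * Z) := by linarith
    exact le_of_mul_le_mul_left h2 (by positivity)
  have hXw' : Integrable fun y => Real.exp (-f y) * ‖y - x₀‖ ^ 2 := by
    have h1 := (hXw.comp_sub_right x₀).const_mul (8 / 3 / m)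
    refine h1.congr (ae_of_all _ fun y => ?_)
    simp only [hX, hw, add_sub_cancel]
    field_simp
  refine ⟨(integrable_tilted_iff hZi _).2 (by simpa using hXw'), ?_⟩
  rw [gibbs, integral_tilted]
  have h1 : ∀ y, (Real.exp (-f y) / ∫ x, Real.exp (-f x)) • ‖y - x₀‖ ^ 2 =
      8 / 3 / m / Z * ((fun u => X u * w u) (y - x₀)) := fun y => by
    simp only [hX, hw, add_sub_cancel, smul_eq_mul, ← hZ]
    field_simp
  simp_rw [h1]
  rw [integral_const_mul, integral_sub_right_eq_self (fun u => X u * w u) x₀]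
  -- The constant 2 comes from (8/3) log 2 < 2.
  have hlog := Real.log_two_lt_d9
  calc 8 / 3 / m / Z * ∫ u, X u * w u ≤ 8 / 3 / m / Z * (d * Real.log 2 * Z) := by gcongr
    _ = d / m * (8 / 3 * Real.log 2) := by field_simp
    _ ≤ d / m * 2 := by gcongr; linarith
    _ = _ := by ring

end HessianBounds

/-- Position and velocity at time `h` of the Hamiltonian dynamics started at `z`. -/
def hmcMap (f : E d → ℝ) (h : ℝ) (z : E d × E d) : E d × E d :=
  Classical.epsilon fun w => ∃ q p, IsHMCPath f h z.1 z.2 q p ∧ (q h, p h) = w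

/-- Existence of a path makes the choice in `hmcMap` meaningful. Uniqueness is never invoked, since
every estimate holds for an arbitrary path. -/
theorem hmcMap_spec (hf : HessianBounds f m M) (hm : 0 ≤ m) (hM : 0 < M) (hh : 0 < h)
    (hMh : M * h ^ 2 ≤ 1 / 4) (z : E d × E d) :
    ∃ q p, IsHMCPath f h z.1 z.2 q p ∧ (q h, p h) = hmcMap f h z := by
  obtain ⟨q, p, hq⟩ := exists_isHMCPath hf hm hM hh hMh z.1 z.2
  exact Classical.epsilon_spec
    (p := fun w => ∃ q p, IsHMCPath f h z.1 z.2 q p ∧ (q h, p h) = w) ⟨_, q, p, hq, rfl⟩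

theorem measurable_verletStep {G : E d → E d} (hG : Measurable G) (δ : ℝ) :
    Measurable (verletStep G δ) := (measurePreserving_verletStep hG δ).measurable

/-- As a pointwise limit of explicit maps, `hmcMap` inherits measurability and, through the
volume-preserving approximations, invariance. -/
theorem tendsto_verlet (hf : HessianBounds f m M) (hm : 0 ≤ m) (hM : 0 < M) (hh : 0 < h)
    (hMh : M * h ^ 2 ≤ 1 / 4) (z : E d × E d) :
    Filter.Tendsto (fun n : ℕ => (verletStep (gradient f) (h / n))^[n] z) Filter.atTop
      (nhds (hmcMap f h z)) := by
  obtain ⟨q, p, hq, he⟩ := hmcMap_spec hf hm hM hh hMh z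
  set B := 32 * h ^ 3 * M * (‖z.2‖ + h * ‖gradient f z.1‖) with hB
  have hlim := tendsto_const_div_atTop_nhds_zero_nat B
  have hbd : ∀ᶠ n : ℕ in Filter.atTop,
      ‖q h - ((verletStep (gradient f) (h / n))^[n] z).1‖ +
      h * ‖p h - ((verletStep (gradient f) (h / n))^[n] z).2‖ ≤ B / n := by
    filter_upwards [Filter.eventually_gt_atTop 0] with n hn
    exact hq.verlet_error hf hm hM hh hMh hn
  rw [← he]
  refine Filter.Tendsto.prodMk_nhds ?_ ?_
  · rw [tendsto_iff_norm_sub_tendsto_zero]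
    refine squeeze_zero' (Filter.Eventually.of_forall fun _ => norm_nonneg _) ?_ hlim
    filter_upwards [hbd] with n hn
    rw [norm_sub_rev]
    refine le_trans ?_ hn
    exact le_add_of_nonneg_right (by positivity)
  · rw [tendsto_iff_norm_sub_tendsto_zero]
    have hlim' : Filter.Tendsto (fun n : ℕ => B / n / h) Filter.atTop (nhds 0) := by
      simpa using hlim.div_const h
    refine squeeze_zero' (Filter.Eventually.of_forall fun _ => norm_nonneg _) ?_ hlim'
    filter_upwards [hbd] with n hn
    rw [norm_sub_rev, le_div_iff₀ hh, mul_comm]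
    refine le_trans ?_ hn
    exact le_add_of_nonneg_left (by positivity)

theorem measurable_hmcMap (hf : HessianBounds f m M) (hm : 0 ≤ m) (hM : 0 < M) (hh : 0 < h)
    (hMh : M * h ^ 2 ≤ 1 / 4) : Measurable (hmcMap f h) :=
  measurable_of_tendsto_metrizable
    (fun n => (measurable_verletStep hf.continuous_gradient.measurable _).iterate n)
    (tendsto_pi_nhds.2 fun z => tendsto_verlet hf hm hM hh hMh z)

/-- The Hamiltonian dynamics preserve the Gibbs measure on phase space. -/
theorem measurePreserving_hmcMap (hf : HessianBounds f m M) (hm : 0 < m) (hM : 0 < M)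
    (hh : 0 < h) (hMh : M * h ^ 2 ≤ 1 / 4) {x₀ : E d} (hx₀ : ∀ y, f x₀ ≤ f y) :
    MeasurePreserving (hmcMap f h) ((gibbs f).prod (stdGaussian (E d)))
      ((gibbs f).prod (stdGaussian (E d))) := by
  have hmeas := measurable_hmcMap hf hm.le hM hh hMh
  refine ⟨hmeas, ?_⟩
  have := hf.isProbabilityMeasure_gibbs hm hx₀
  have hc := hf.continuous
  set Z := ∫ x, Real.exp (-f x) with hZ
  set Z' := ∫ v : E d, Real.exp (-(‖v‖ ^ 2 / 2)) with hZ'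
  set w : E d × E d → ℝ≥0∞ := fun z => ENNReal.ofReal (Real.exp (-f z.1) / Z) *
    ENNReal.ofReal (Real.exp (-(‖z.2‖ ^ 2 / 2)) / Z') with hw
  have hdens : (gibbs f).prod (stdGaussian (E d)) = (volume.prod volume).withDensity w := by
    rw [stdGaussian_eq_gibbs]
    simp only [gibbs, Measure.tilted]
    rw [prod_withDensity (by fun_prop) (by fun_prop)]
  -- The weight depends on z only through the energy, hence is constant along paths.
  have hw' : ∀ z, w z =
      ENNReal.ofReal (Real.exp (-(f z.1 + ‖z.2‖ ^ 2 / 2)) / (Z * Z')) := fun z => by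
    have hZ0 : 0 ≤ Z := integral_nonneg fun _ => (Real.exp_pos _).le
    simp only [hw]
    rw [← ENNReal.ofReal_mul (div_nonneg (Real.exp_pos _).le hZ0), div_mul_div_comm,
      ← Real.exp_add, neg_add]
  have hfin : IsFiniteMeasure ((volume.prod volume).withDensity w) := by
    rw [← hdens]; infer_instance
  rw [hdens]
  refine map_withDensity_eq_of_tendsto (Φ := fun n : ℕ => (verletStep (gradient f) (h / n))^[n])
    (Filter.Eventually.of_forall fun n =>
      (measurePreserving_verletStep hf.continuous_gradient.measurable _).iterate n) hmeas
    (fun z => tendsto_verlet hf hm.le hM hh hMh z) ?_ (fun z => ?_) fun z => ?_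
  · have : w = fun z => ENNReal.ofReal (Real.exp (-(f z.1 + ‖z.2‖ ^ 2 / 2)) / (Z * Z')) :=
      funext hw'
    rw [this]
    exact ENNReal.continuous_ofReal.comp (by fun_prop)
  · rw [hw']; exact ENNReal.ofReal_ne_top
  · obtain ⟨q, p, hq, he⟩ := hmcMap_spec hf hm.le hM hh hMh z
    rw [hw', hw', ← he, hq.energy_eq hf hh]

end

/-! ### Reasoning about programs -/

section Programs

variable {d : ℕ} {G : E d → E d} {ω : ℕ → ℝ}

/-- The program `c`, started in `s`, halts in a configuration that satisfies `P`. -/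
def Halts (G : E d → E d) (ω : ℕ → ℝ) (c : Cmd) (s : State) (P : State → Prop) : Prop :=
  ∃ s', Run G ω c s s' ∧ P s'

theorem Halts.mono {c : Cmd} {s : State} {P Q : State → Prop} (h : Halts G ω c s P)
    (hPQ : ∀ s', P s' → Q s') : Halts G ω c s Q :=
  let ⟨s', h1, h2⟩ := h
  ⟨s', h1, hPQ s' h2⟩

variable {s : State} {P : State → Prop}

/-- The rules for instructions are equivalences, so rewriting with them turns straight-line code
into its weakest precondition. -/
theorem halts_seq {c₁ c₂ : Cmd} :
    Halts G ω (.seq c₁ c₂) s P ↔ Halts G ω c₁ s fun s' => Halts G ω c₂ s' P := by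
  constructor
  · rintro ⟨s', h, hP⟩
    cases h with
    | seq h₁ h₂ => exact ⟨_, h₁, _, h₂, hP⟩
  · rintro ⟨s₁, h₁, s₂, h₂, hP⟩
    exact ⟨s₂, .seq h₁ h₂, hP⟩

theorem halts_setIdx {i c : ℕ} : Halts G ω (.setIdx i c) s P ↔ P (s.writeIdx i c) :=
  ⟨fun ⟨_, h, hP⟩ => by cases h; exact hP, fun h => ⟨_, .setIdx _ _ _, h⟩⟩

theorem halts_addIdx {i j k : ℕ} :
    Halts G ω (.addIdx i j k) s P ↔ P (s.writeIdx i (s.idx j + s.idx k)) :=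
  ⟨fun ⟨_, h, hP⟩ => by cases h; exact hP, fun h => ⟨_, .addIdx _ _ _ _, h⟩⟩

theorem halts_const {r : ℕ} {c : ℚ} : Halts G ω (.const r c) s P ↔ P (s.writeReg r (c : ℝ)) :=
  ⟨fun ⟨_, h, hP⟩ => by cases h; exact hP, fun h => ⟨_, .const _ _ _, h⟩⟩

theorem halts_ofIdx {r i : ℕ} :
    Halts G ω (.ofIdx r i) s P ↔ P (s.writeReg r (s.idx i : ℝ)) :=
  ⟨fun ⟨_, h, hP⟩ => by cases h; exact hP, fun h => ⟨_, .ofIdx _ _ _, h⟩⟩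

theorem halts_add {r t u : ℕ} :
    Halts G ω (.add r t u) s P ↔ P (s.writeReg r (s.reg t + s.reg u)) :=
  ⟨fun ⟨_, h, hP⟩ => by cases h; exact hP, fun h => ⟨_, .add _ _ _ _, h⟩⟩

theorem halts_sub {r t u : ℕ} :
    Halts G ω (.sub r t u) s P ↔ P (s.writeReg r (s.reg t - s.reg u)) :=
  ⟨fun ⟨_, h, hP⟩ => by cases h; exact hP, fun h => ⟨_, .sub _ _ _ _, h⟩⟩

theorem halts_mul {r t u : ℕ} :
    Halts G ω (.mul r t u) s P ↔ P (s.writeReg r (s.reg t * s.reg u)) :=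
  ⟨fun ⟨_, h, hP⟩ => by cases h; exact hP, fun h => ⟨_, .mul _ _ _ _, h⟩⟩

theorem halts_div {r t u : ℕ} :
    Halts G ω (.div r t u) s P ↔ P (s.writeReg r (s.reg t / s.reg u)) :=
  ⟨fun ⟨_, h, hP⟩ => by cases h; exact hP, fun h => ⟨_, .div _ _ _ _, h⟩⟩

theorem halts_sqrt {r t : ℕ} : Halts G ω (.sqrt r t) s P ↔ P (s.writeReg r √(s.reg t)) :=
  ⟨fun ⟨_, h, hP⟩ => by cases h; exact hP, fun h => ⟨_, .sqrt _ _ _, h⟩⟩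

theorem halts_load {r i : ℕ} : Halts G ω (.load r i) s P ↔ P (s.writeReg r (s.mem (s.idx i))) :=
  ⟨fun ⟨_, h, hP⟩ => by cases h; exact hP, fun h => ⟨_, .load _ _ _, h⟩⟩

theorem halts_store {i r : ℕ} :
    Halts G ω (.store i r) s P ↔ P (s.writeMem (s.idx i) (s.reg r)) :=
  ⟨fun ⟨_, h, hP⟩ => by cases h; exact hP, fun h => ⟨_, .store _ _ _, h⟩⟩

theorem halts_gauss {r : ℕ} : Halts G ω (.gauss r) s P ↔ P (s.draw ω r) :=
  ⟨fun ⟨_, h, hP⟩ => by cases h; exact hP, fun h => ⟨_, .gauss _ _, h⟩⟩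

theorem halts_grad {i j : ℕ} :
    Halts G ω (.grad i j) s P ↔ P (s.query G (s.idx i) (s.idx j)) :=
  ⟨fun ⟨_, h, hP⟩ => by cases h; exact hP, fun h => ⟨_, .grad _ _ _, h⟩⟩

/-- The loop rule, for a loop whose body is executed `n` times. -/
theorem halts_while {b : Test} {c : Cmd} (I : ℕ → State → Prop) {n : ℕ} (h₀ : I 0 s)
    (hstep : ∀ i < n, ∀ s, I i s → b.Holds s ∧ Halts G ω c (s.tick 1) (I (i + 1)))
    (hexit : ∀ s, I n s → ¬ b.Holds s) (hP : ∀ s, I n s → P (s.tick 1)) :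
    Halts G ω (.while b c) s P := by
  -- Induction on the number k of passes that remain.
  have key : ∀ k ≤ n, ∀ s, I (n - k) s → Halts G ω (.while b c) s P := by
    intro k
    induction k with
    | zero => exact fun _ s hs => ⟨_, .while_false (hexit s hs), hP s hs⟩
    | succ k ih =>
      intro hk s hs
      obtain ⟨hb, s₁, hr, hs₁⟩ := hstep (n - (k + 1)) (by omega) s hs
      rw [show n - (k + 1) + 1 = n - k by omega] at hs₁
      obtain ⟨s₂, hr₂, hP₂⟩ := ih (by omega) s₁ hs₁
      exact ⟨s₂, .while_true hb hr hr₂, hP₂⟩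
  exact key n le_rfl s (by simpa using h₀)

theorem vec_query_self (s : State) (dst src : ℕ) :
    (s.query G dst src).vec d dst = G (s.vec d src) := by
  ext i
  simp [State.vec, State.query]

theorem vec_query_of_disjoint (s : State) {dst src a : ℕ} (h : a + d ≤ dst ∨ dst + d ≤ a) :
    (s.query G dst src).vec d a = s.vec d a := by
  ext i
  have := i.2
  simp only [State.vec, State.query]
  rw [dif_neg (by omega)]

/-! ### Vector operations

The dimension is kept in index register `0`, the number `1` in index register `5`. -/

/-- `mem[a + i] := mem[a + i] + r * mem[b + i]` for `i < d`. -/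
def axpy (a b r : ℕ) : Cmd :=
  .seq (.setIdx 3 0) (.while (.idxLt 3 0)
    (.seq (.addIdx 4 a 3) (.seq (.addIdx 9 b 3) (.seq (.load 6 4) (.seq (.load 7 9)
      (.seq (.mul 7 7 r) (.seq (.add 6 6 7) (.seq (.store 4 6) (.addIdx 3 3 5)))))))))

/-- Disjointness of the blocks keeps the source intact during the loop. A pass costs one test and
eight instructions; the additional 2 is the initialization and the exit test. -/
theorem halts_axpy {a b r : ℕ} (ha : a ≠ 3 ∧ a ≠ 4 ∧ a ≠ 9) (hb : b ≠ 3 ∧ b ≠ 4 ∧ b ≠ 9)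
    (hr : r ≠ 6 ∧ r ≠ 7) (h0 : s.idx 0 = d) (h5 : s.idx 5 = 1)
    (hab : s.idx a + d ≤ s.idx b ∨ s.idx b + d ≤ s.idx a) :
    Halts G ω (axpy a b r) s fun s' =>
      (∀ j, j ≠ 3 → j ≠ 4 → j ≠ 9 → s'.idx j = s.idx j) ∧
      (∀ j, j ≠ 6 → j ≠ 7 → s'.reg j = s.reg j) ∧
      s'.vec d (s.idx a) = s.vec d (s.idx a) + s.reg r • s.vec d (s.idx b) ∧
      (∀ k, (k + d ≤ s.idx a ∨ s.idx a + d ≤ k) → s'.vec d k = s.vec d k) ∧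
      s'.drawn = s.drawn ∧ s'.time = s.time + 9 * d + 2 ∧ s'.queries = s.queries := by
  rw [axpy, halts_seq, halts_setIdx]
  set A := s.idx a with hA
  set B := s.idx b with hB
  refine halts_while (n := d) (fun i s' =>
      (∀ j, j ≠ 3 → j ≠ 4 → j ≠ 9 → s'.idx j = s.idx j) ∧ s'.idx 3 = i ∧
      (∀ j, j ≠ 6 → j ≠ 7 → s'.reg j = s.reg j) ∧
      (∀ k, s'.mem k = if A ≤ k ∧ k < A + i then s.mem k + s.reg r * s.mem (B + (k - A))
        else s.mem k) ∧
      s'.drawn = s.drawn ∧ s'.time = s.time + 9 * i + 1 ∧ s'.queries = s.queries)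
    ?_ ?_ ?_ ?_
  · refine ⟨fun j hj _ _ => by simp [State.writeIdx, hj], by simp [State.writeIdx],
      fun j _ _ => rfl, fun k => ?_, rfl, rfl, rfl⟩
    rw [if_neg (by omega)]; rfl
  · rintro i hi s' ⟨hidx, h3, hreg, hmem, hdr, ht, hq⟩
    refine ⟨by simp [Test.Holds, h3, hidx 0, h0, hi], ?_⟩
    have e1 := hidx a ha.1 ha.2.1 ha.2.2
    have e2 := hidx b hb.1 hb.2.1 hb.2.2
    have e3 := hreg r hr.1 hr.2
    have e5 := (hidx 5 (by simp) (by simp) (by simp)).trans h5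
    simp only [halts_seq, halts_addIdx, halts_load, halts_mul, halts_add, halts_store]
    simp only [State.writeIdx, State.writeReg, State.writeMem, State.tick, Function.update_apply]
    simp only [hb, hr, e1, e2, e3, e5, h3, ← hA, ← hB, ite_false, ite_true]
    have m1 : s'.mem (A + i) = s.mem (A + i) := by rw [hmem, if_neg (by omega)]
    have m2 : s'.mem (B + i) = s.mem (B + i) := by rw [hmem, if_neg (by omega)]
    refine ⟨fun j hj3 hj4 hj9 => ?_, by simp, fun j hj6 hj7 => ?_, fun k => ?_, hdr, ?_, hq⟩
    · simp [hj3, hj4, hj9, hidx]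
    · simp [hj6, hj7, hreg]
    · by_cases hk : k = A + i
      · subst hk; simp [m1, m2, mul_comm]
      · simp only [hmem]
        have : (A ≤ k ∧ k < A + i) ↔ (A ≤ k ∧ k < A + (i + 1)) := by omega
        simp [hk, this]
    · omega
  · rintro s' ⟨hidx, h3, -⟩
    simp [Test.Holds, h3, hidx 0, h0]
  · rintro s' ⟨hidx, h3, hreg, hmem, hdr, ht, hq⟩
    refine ⟨hidx, hreg, ?_, fun k hk => ?_, hdr, by simp [State.tick]; omega, hq⟩
    · ext i
      have := i.2
      simp [State.vec, State.tick, hmem]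
    · ext i
      have := i.2
      simp only [State.vec, State.tick, hmem]
      rw [if_neg (by omega)]

/-- Fill the block at the address in index register `0` with fresh Gaussians. -/
def drawVelocity : Cmd :=
  .seq (.setIdx 3 0) (.while (.idxLt 3 0)
    (.seq (.addIdx 4 0 3) (.seq (.gauss 6) (.seq (.store 4 6) (.addIdx 3 3 5)))))

theorem halts_drawVelocity (h0 : s.idx 0 = d) (h5 : s.idx 5 = 1) :
    Halts G ω drawVelocity s fun s' =>
      (∀ j, j ≠ 3 → j ≠ 4 → s'.idx j = s.idx j) ∧
      (∀ j, j ≠ 6 → s'.reg j = s.reg j) ∧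
      s'.vec d d = (WithLp.toLp 2 fun i : Fin d => ω (s.drawn + i)) ∧
      s'.vec d 0 = s.vec d 0 ∧
      s'.drawn = s.drawn + d ∧ s'.time = s.time + 5 * d + 2 ∧ s'.queries = s.queries := by
  rw [drawVelocity, halts_seq, halts_setIdx]
  refine halts_while (n := d) (fun i s' =>
      (∀ j, j ≠ 3 → j ≠ 4 → s'.idx j = s.idx j) ∧ s'.idx 3 = i ∧
      (∀ j, j ≠ 6 → s'.reg j = s.reg j) ∧
      (∀ k, s'.mem k = if d ≤ k ∧ k < d + i then ω (s.drawn + (k - d)) else s.mem k) ∧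
      s'.drawn = s.drawn + i ∧ s'.time = s.time + 5 * i + 1 ∧ s'.queries = s.queries)
    ?_ ?_ ?_ ?_
  · refine ⟨fun j hj _ => by simp [State.writeIdx, hj], by simp [State.writeIdx],
      fun j _ => rfl, fun k => ?_, rfl, rfl, rfl⟩
    rw [if_neg (by omega)]; rfl
  · rintro i hi s' ⟨hidx, h3, hreg, hmem, hdr, ht, hq⟩
    have e0 := (hidx 0 (by simp) (by simp)).trans h0
    have e5 := (hidx 5 (by simp) (by simp)).trans h5
    refine ⟨by simp [Test.Holds, h3, e0, hi], ?_⟩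
    simp only [halts_seq, halts_addIdx, halts_gauss, halts_store]
    simp only [State.writeIdx, State.draw, State.writeMem, State.tick, Function.update_apply]
    refine ⟨fun j hj3 hj4 => ?_, by simp [h3, e5], fun j hj6 => ?_, fun k => ?_, by omega, ?_, hq⟩
    · simp [hj3, hj4, hidx]
    · simp [hj6, hreg]
    · by_cases hk : k = d + i
      · subst hk; simp [e0, h3, hdr]
      · have : (d ≤ k ∧ k < d + i) ↔ (d ≤ k ∧ k < d + (i + 1)) := by omega
        simp [hk, hmem, this, e0, h3]
    · omega
  · rintro s' ⟨hidx, h3, -⟩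
    simp [Test.Holds, h3, hidx 0, h0]
  · rintro s' ⟨hidx, h3, hreg, hmem, hdr, ht, hq⟩
    refine ⟨hidx, hreg, ?_, ?_, hdr, by simp [State.tick]; omega, hq⟩
    · ext i
      have := i.2
      simp [State.vec, State.tick, hmem]
    · ext i
      have := i.2
      simp only [State.vec, State.tick, hmem]
      rw [if_neg (by omega)]

/-- Real register `5 := ∑ i < d, mem[d + i]² + (reg[3] * mem[2 d + i])²`. -/
def weightedNormSq : Cmd :=
  .seq (.const 5 0) (.seq (.setIdx 3 0) (.while (.idxLt 3 0)
    (.seq (.addIdx 4 0 3) (.seq (.load 6 4) (.seq (.mul 6 6 6) (.seq (.add 5 5 6)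
      (.seq (.addIdx 4 2 3) (.seq (.load 6 4) (.seq (.mul 6 3 6) (.seq (.mul 6 6 6)
        (.seq (.add 5 5 6) (.addIdx 3 3 5))))))))))))

theorem halts_weightedNormSq (h0 : s.idx 0 = d) (h2 : s.idx 2 = 2 * d) (h5 : s.idx 5 = 1) :
    Halts G ω weightedNormSq s fun s' =>
      (∀ j, j ≠ 3 → j ≠ 4 → s'.idx j = s.idx j) ∧
      (∀ j, j ≠ 5 → j ≠ 6 → s'.reg j = s.reg j) ∧
      s'.reg 5 = ‖s.vec d d‖ ^ 2 + s.reg 3 ^ 2 * ‖s.vec d (2 * d)‖ ^ 2 ∧ s'.mem = s.mem ∧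
      s'.drawn = s.drawn ∧ s'.time = s.time + 11 * d + 3 ∧ s'.queries = s.queries := by
  rw [weightedNormSq, halts_seq, halts_const, halts_seq, halts_setIdx]
  refine halts_while (n := d) (fun i s' =>
      (∀ j, j ≠ 3 → j ≠ 4 → s'.idx j = s.idx j) ∧ s'.idx 3 = i ∧
      (∀ j, j ≠ 5 → j ≠ 6 → s'.reg j = s.reg j) ∧
      s'.reg 5 = ∑ k ∈ Finset.range i, (s.mem (d + k) ^ 2 + (s.reg 3 * s.mem (2 * d + k)) ^ 2) ∧
      s'.mem = s.mem ∧
      s'.drawn = s.drawn ∧ s'.time = s.time + 11 * i + 2 ∧ s'.queries = s.queries)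
    ?_ ?_ ?_ ?_
  · refine ⟨fun j hj _ => by simp [State.writeIdx, State.writeReg, hj],
      by simp [State.writeIdx], fun j hj _ => by simp [State.writeIdx, State.writeReg, hj],
      by simp [State.writeIdx, State.writeReg], rfl, rfl, rfl, rfl⟩
  · rintro i hi s' ⟨hidx, h3, hreg, hsum, hmem, hdr, ht, hq⟩
    have e0 := (hidx 0 (by simp) (by simp)).trans h0
    have e2 := (hidx 2 (by simp) (by simp)).trans h2
    have e5 := (hidx 5 (by simp) (by simp)).trans h5
    have r3 := hreg 3 (by simp) (by simp)
    refine ⟨by simp [Test.Holds, h3, e0, hi], ?_⟩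
    simp only [halts_seq, halts_addIdx, halts_load, halts_mul, halts_add]
    simp only [State.writeIdx, State.writeReg, State.tick, Function.update_apply]
    refine ⟨fun j hj3 hj4 => ?_, by simp [h3, e5], fun j hj5 hj6 => ?_, ?_, hmem, hdr, ?_, hq⟩
    · simp [hj3, hj4, hidx]
    · simp [hj5, hj6, hreg]
    · rw [Finset.sum_range_succ, ← hsum]
      simp [e0, e2, h3, r3, hmem]
      ring
    · omega
  · rintro s' ⟨hidx, h3, -⟩
    simp [Test.Holds, h3, hidx 0, h0]
  · rintro s' ⟨hidx, h3, hreg, hsum, hmem, hdr, ht, hq⟩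
    refine ⟨hidx, hreg, ?_, hmem, hdr, by simp [State.tick]; omega, hq⟩
    simp only [State.tick, hsum, EuclideanSpace.real_norm_sq_eq, State.vec, Finset.mul_sum,
      ← Finset.sum_add_distrib, ← mul_pow]
    exact (Fin.sum_univ_eq_sum_range
      (fun k => s.mem (d + k) ^ 2 + (s.reg 3 * s.mem (2 * d + k)) ^ 2) d).symm

/-- Index register `7 := max 1 ⌈reg[5]⌉`. -/
def ceilIdx : Cmd :=
  .seq (.setIdx 7 1) (.seq (.ofIdx 6 7) (.while (.realLt 6 5)
    (.seq (.addIdx 7 7 5) (.ofIdx 6 7))))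

/-- Without a rounding instruction the ceiling is found by counting. The time is linear in the
result, which the equally many Verlet steps dominate. -/
theorem halts_ceilIdx (h5 : s.idx 5 = 1) :
    Halts G ω ceilIdx s fun s' =>
      (∀ j, j ≠ 7 → s'.idx j = s.idx j) ∧
      (∀ j, j ≠ 6 → s'.reg j = s.reg j) ∧
      s'.idx 7 = max 1 ⌈s.reg 5⌉₊ ∧ s'.mem = s.mem ∧
      s'.drawn = s.drawn ∧ s'.time = s.time + 3 * max 1 ⌈s.reg 5⌉₊ ∧
      s'.queries = s.queries := by
  rw [ceilIdx, halts_seq, halts_setIdx, halts_seq, halts_ofIdx]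
  set n := max 1 ⌈s.reg 5⌉₊ with hn
  have hn1 : 1 ≤ n := le_max_left _ _
  -- The counter starts at 1, so n - 1 passes reach n.
  refine halts_while (n := n - 1) (fun i s' =>
      (∀ j, j ≠ 7 → s'.idx j = s.idx j) ∧ s'.idx 7 = i + 1 ∧
      (∀ j, j ≠ 6 → s'.reg j = s.reg j) ∧ s'.reg 6 = (i + 1 : ℕ) ∧
      s'.mem = s.mem ∧
      s'.drawn = s.drawn ∧ s'.time = s.time + 3 * i + 2 ∧ s'.queries = s.queries)
    ?_ ?_ ?_ ?_
  · refine ⟨fun j hj => by simp [State.writeIdx, State.writeReg, hj],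
      by simp [State.writeIdx, State.writeReg],
      fun j hj => by simp [State.writeIdx, State.writeReg, hj],
      by simp [State.writeIdx, State.writeReg], rfl, rfl, rfl, rfl⟩
  · rintro i hi s' ⟨hidx, h7, hreg, h6, hmem, hdr, ht, hq⟩
    have e5 := (hidx 5 (by simp)).trans h5
    refine ⟨?_, ?_⟩
    · have : i + 1 < ⌈s.reg 5⌉₊ := by omega
      simp only [Test.Holds, h6, hreg 5 (by simp)]
      exact Nat.lt_ceil.1 this
    simp only [halts_seq, halts_addIdx, halts_ofIdx]
    simp only [State.writeIdx, State.writeReg, State.tick, Function.update_apply]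
    refine ⟨fun j hj => ?_, by simp [h7, e5], fun j hj => ?_, by simp [h7, e5], hmem, hdr, ?_, hq⟩
    · simp [hj, hidx]
    · simp [hj, hreg]
    · omega
  · rintro s' ⟨hidx, h7, hreg, h6, -⟩
    simp only [Test.Holds, h6, hreg 5 (by simp)]
    rw [Nat.sub_add_cancel hn1, not_lt]
    exact Nat.ceil_le.1 (le_max_right _ _)
  · rintro s' ⟨hidx, h7, hreg, h6, hmem, hdr, ht, hq⟩
    refine ⟨hidx, hreg, by simp only [State.tick, h7]; omega, hmem, hdr,
      by simp only [State.tick]; omega, hq⟩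

end Programs

/-! ### The algorithm -/

section Algorithm

variable {d : ℕ} {G : E d → E d} {ω : ℕ → ℝ} {s : State}

/-- The number of integration steps for the point `x` and the velocity `v`. -/
def numSteps (G : E d → E d) (h c : ℝ) (x v : E d) : ℕ :=
  max 1 ⌈√(‖v‖ ^ 2 + h ^ 2 * ‖G x‖ ^ 2) * c⌉₊

/-- The approximation that the algorithm computes to the endpoint of the dynamics. -/
def nextPoint (G : E d → E d) (h c : ℝ) (x v : E d) : E d :=
  ((verletStep G (h / numSteps G h c x v))^[numSteps G h c x v] (x, v)).1

/-- Repeat the Verlet step: index register `7` holds the number of steps, the real registers `8`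
and `9` hold `δ / 2` and `-δ`. -/
def verletLoop : Cmd :=
  .seq (.setIdx 8 0) (.while (.idxLt 8 7)
    (.seq (axpy 6 0 8) (.seq (.grad 2 6) (.seq (axpy 0 2 9) (.seq (axpy 6 0 8) (.addIdx 8 8 5))))))

/-- The registers that the iterations rely on. -/
structure Ready (d : ℕ) (h c : ℝ) (s : State) : Prop where
  idx_zero : s.idx 0 = d
  idx_two : s.idx 2 = 2 * d
  idx_five : s.idx 5 = 1
  idx_six : s.idx 6 = 0
  reg_three : s.reg 3 = h
  reg_four : s.reg 4 = c

theorem Ready.of_agree {h c : ℝ} {s' : State} (hs : Ready d h c s)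
    (hi : ∀ j ∈ ({0, 2, 5, 6} : Set ℕ), s'.idx j = s.idx j)
    (hr : ∀ j ∈ ({3, 4} : Set ℕ), s'.reg j = s.reg j) : Ready d h c s' :=
  ⟨by rw [hi _ (by simp), hs.1], by rw [hi _ (by simp), hs.2], by rw [hi _ (by simp), hs.3],
    by rw [hi _ (by simp), hs.4], by rw [hr _ (by simp), hs.5], by rw [hr _ (by simp), hs.6]⟩

/-- The blocks at 0, d and 2d hold position, velocity and gradient; index register 0 serves both as
the dimension and as the address of the velocity. One pass costs 3(9d + 2) + d for the vector work
and 2 for the counter and the test. -/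
theorem halts_verletLoop {h c δ : ℝ} (hs : Ready d h c s) (h8 : s.reg 8 = δ / 2)
    (h9 : s.reg 9 = -δ) :
    Halts G ω verletLoop s fun s' => Ready d h c s' ∧
      s'.vec d 0 = ((verletStep G δ)^[s.idx 7] (s.vec d 0, s.vec d d)).1 ∧
      s'.drawn = s.drawn ∧ s'.time = s.time + s.idx 7 * (28 * d + 8) + 2 ∧
      s'.queries = s.queries + s.idx 7 := by
  rw [verletLoop, halts_seq, halts_setIdx]
  refine halts_while (n := s.idx 7) (fun i s' => Ready d h c s' ∧ s'.idx 7 = s.idx 7 ∧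
      s'.idx 8 = i ∧ s'.reg 8 = δ / 2 ∧ s'.reg 9 = -δ ∧
      (s'.vec d 0, s'.vec d d) = (verletStep G δ)^[i] (s.vec d 0, s.vec d d) ∧
      s'.drawn = s.drawn ∧ s'.time = s.time + i * (28 * d + 8) + 1 ∧
      s'.queries = s.queries + i) ?_ ?_ ?_ ?_
  · refine ⟨hs.of_agree ?_ ?_, by simp [State.writeIdx], by simp [State.writeIdx], h8, h9, rfl,
      rfl, by simp [State.writeIdx], rfl⟩
    · rintro j (rfl | rfl | rfl | rfl) <;> simp [State.writeIdx]
    · exact fun j _ => rfl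
  · rintro i hi s₀ ⟨hr, h7, hi8, hr8, hr9, hv, hdr, ht, hq⟩
    refine ⟨by simp [Test.Holds, hi8, h7, hi], ?_⟩
    rw [halts_seq]
    refine (halts_axpy (s := s₀.tick 1) (by simp) (by simp) (by simp) hr.idx_zero hr.idx_five
      (by simp [State.tick, hr.idx_zero, hr.idx_six])).mono ?_
    rintro s₁ ⟨i₁, r₁, v₁, w₁, dr₁, t₁, q₁⟩
    have R₁ : Ready d h c s₁ := hr.of_agree
      (by rintro j (rfl | rfl | rfl | rfl) <;> exact i₁ _ (by simp) (by simp) (by simp))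
      (by rintro j (rfl | rfl) <;> exact r₁ _ (by simp) (by simp))
    rw [halts_seq, halts_grad, halts_seq]
    set s₂ := s₁.query G (s₁.idx 2) (s₁.idx 6) with hs₂
    have R₂ : Ready d h c s₂ := R₁.of_agree (fun _ _ => rfl) (fun _ _ => rfl)
    refine (halts_axpy (s := s₂) (by simp) (by simp) (by simp) R₂.idx_zero R₂.idx_five
      (by rw [R₂.idx_zero, R₂.idx_two]; omega)).mono ?_
    rintro s₃ ⟨i₃, r₃, v₃, w₃, dr₃, t₃, q₃⟩
    have R₃ : Ready d h c s₃ := R₂.of_agree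
      (by rintro j (rfl | rfl | rfl | rfl) <;> exact i₃ _ (by simp) (by simp) (by simp))
      (by rintro j (rfl | rfl) <;> exact r₃ _ (by simp) (by simp))
    rw [halts_seq]
    refine (halts_axpy (s := s₃) (by simp) (by simp) (by simp) R₃.idx_zero R₃.idx_five
      (by rw [R₃.idx_zero, R₃.idx_six]; omega)).mono ?_
    rintro s₄ ⟨i₄, r₄, v₄, w₄, dr₄, t₄, q₄⟩
    have R₄ : Ready d h c s₄ := R₃.of_agree
      (by rintro j (rfl | rfl | rfl | rfl) <;> exact i₄ _ (by simp) (by simp) (by simp))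
      (by rintro j (rfl | rfl) <;> exact r₄ _ (by simp) (by simp))
    rw [halts_addIdx]
    have hidx : ∀ j ∈ ({7, 8} : Set ℕ), s₄.idx j = s₀.idx j := by
      rintro j (rfl | rfl) <;>
      exact (i₄ _ (by simp) (by simp) (by simp)).trans ((i₃ _ (by simp) (by simp) (by simp)).trans
        (i₁ _ (by simp) (by simp) (by simp)))
    have hreg1 : ∀ j ∈ ({8, 9} : Set ℕ), s₁.reg j = s₀.reg j := by
      rintro j (rfl | rfl) <;> exact r₁ _ (by simp) (by simp)
    have hreg3 : ∀ j ∈ ({8, 9} : Set ℕ), s₃.reg j = s₀.reg j := by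
      rintro j (rfl | rfl) <;> exact (r₃ _ (by simp) (by simp)).trans (hreg1 _ (by simp))
    have hreg4 : ∀ j ∈ ({8, 9} : Set ℕ), s₄.reg j = s₀.reg j := by
      rintro j (rfl | rfl) <;> exact (r₄ _ (by simp) (by simp)).trans (hreg3 _ (by simp))
    have t0 : ∀ k, (s₀.tick 1).vec d k = s₀.vec d k := fun _ => rfl
    have e06 : (s₀.tick 1).idx 6 = 0 := hr.idx_six
    have e00 : (s₀.tick 1).idx 0 = d := hr.idx_zero
    have e08 : (s₀.tick 1).reg 8 = δ / 2 := hr8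
    have e28 : s₂.reg 9 = -δ := (hreg1 9 (by simp)).trans hr9
    have e38 : s₃.reg 8 = δ / 2 := (hreg3 8 (by simp)).trans hr8
    simp only [e06, e00, e08, t0] at v₁ w₁
    have w₁' := w₁ d (Or.inr (by omega))
    have v₂ : s₂.vec d (2 * d) = G (s₁.vec d 0) := by
      rw [hs₂, R₁.idx_two, R₁.idx_six]; exact vec_query_self _ _ _
    have x₂ : s₂.vec d 0 = s₁.vec d 0 := by
      rw [hs₂, R₁.idx_two]; exact vec_query_of_disjoint _ (by omega)
    have p₂ : s₂.vec d d = s₁.vec d d := by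
      rw [hs₂, R₁.idx_two]; exact vec_query_of_disjoint _ (by omega)
    simp only [R₂.idx_zero, R₂.idx_two, e28, v₂, p₂] at v₃ w₃
    have w₃' := w₃ 0 (Or.inl (by omega))
    simp only [R₃.idx_zero, R₃.idx_six, e38] at v₄ w₄
    have w₄' := w₄ d (Or.inr (by omega))
    have eq3 : s₃.vec d d = s₀.vec d d - δ • G (s₀.vec d 0 + (δ / 2) • s₀.vec d d) := by
      rw [v₃, v₁, w₁', neg_smul, sub_eq_add_neg]
    have eqx : s₃.vec d 0 = s₀.vec d 0 + (δ / 2) • s₀.vec d d := by rw [w₃', x₂, v₁]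
    refine ⟨R₄.of_agree ?_ (fun _ _ => rfl), ?_, ?_, ?_, ?_, ?_, ?_, ?_, ?_⟩
    · rintro j (rfl | rfl | rfl | rfl) <;> simp [State.writeIdx]
    · simp [State.writeIdx, hidx, h7]
    · simp [State.writeIdx, hidx, hi8, R₄.idx_five]
    · simp [State.writeIdx, hreg4, hr8]
    · simp [State.writeIdx, hreg4, hr9]
    · rw [Function.iterate_succ_apply', ← hv]
      change (s₄.vec d 0, s₄.vec d d) = _
      rw [v₄, w₄', eqx, eq3, verletStep]
    · change s₄.drawn = _
      rw [dr₄, dr₃]; exact dr₁.trans hdr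
    · change s₄.time + 1 = _
      have : s₂.time = s₁.time + d := rfl
      have : (s₀.tick 1).time = s₀.time + 1 := rfl
      rw [add_mul]
      omega
    · change s₄.queries = _
      have : s₂.queries = s₁.queries + 1 := rfl
      have : (s₀.tick 1).queries = s₀.queries := rfl
      omega
  · rintro s' ⟨-, h7, hi8, -⟩
    simp [Test.Holds, hi8, h7]
  · rintro s' ⟨hr, h7, hi8, hr8, hr9, hv, hdr, ht, hq⟩
    refine ⟨hr.of_agree (fun _ _ => rfl) (fun _ _ => rfl), ?_, hdr, ?_, hq⟩
    · rw [← hv]; rfl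
    · simp only [State.tick]; omega

/-- One iteration of Hamiltonian Monte Carlo. -/
def iteration : Cmd :=
  .seq drawVelocity (.seq (.grad 2 6) (.seq weightedNormSq (.seq (.sqrt 5 5) (.seq (.mul 5 5 4)
    (.seq ceilIdx (.seq (.ofIdx 6 7) (.seq (.div 9 3 6) (.seq (.const 6 2) (.seq (.div 8 9 6)
      (.seq (.const 6 0) (.seq (.sub 9 6 9) verletLoop)))))))))))

theorem halts_iteration {h c : ℝ} (hs : Ready d h c s) (hd : 0 < d) :
    Halts G ω iteration s fun s' => Ready d h c s' ∧
      s'.vec d 0 = nextPoint G h c (s.vec d 0) (WithLp.toLp 2 fun i : Fin d => ω (s.drawn + i)) ∧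
      s'.drawn = s.drawn + d ∧
      s'.time ≤ s.time + 100 * d * numSteps G h c (s.vec d 0)
        (WithLp.toLp 2 fun i : Fin d => ω (s.drawn + i)) ∧
      s'.queries = s.queries + numSteps G h c (s.vec d 0)
        (WithLp.toLp 2 fun i : Fin d => ω (s.drawn + i)) + 1 := by
  set v : E d := WithLp.toLp 2 fun i : Fin d => ω (s.drawn + i) with hv
  rw [iteration, halts_seq]
  refine (halts_drawVelocity hs.idx_zero hs.idx_five).mono ?_
  rintro s₁ ⟨i₁, r₁, v₁, x₁, dr₁, t₁, q₁⟩
  have R₁ : Ready d h c s₁ := hs.of_agree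
    (by rintro j (rfl | rfl | rfl | rfl) <;> exact i₁ _ (by simp) (by simp))
    (by rintro j (rfl | rfl) <;> exact r₁ _ (by simp))
  rw [halts_seq, halts_grad, halts_seq]
  set s₂ := s₁.query G (s₁.idx 2) (s₁.idx 6) with hs₂
  have R₂ : Ready d h c s₂ := R₁.of_agree (fun _ _ => rfl) (fun _ _ => rfl)
  have g₂ : s₂.vec d (2 * d) = G (s.vec d 0) := by
    rw [hs₂, R₁.idx_two, R₁.idx_six, ← x₁]; exact vec_query_self _ _ _
  have x₂ : s₂.vec d 0 = s.vec d 0 := by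
    rw [hs₂, R₁.idx_two, ← x₁]; exact vec_query_of_disjoint _ (by omega)
  have p₂ : s₂.vec d d = v := by
    rw [hs₂, R₁.idx_two]; exact (vec_query_of_disjoint _ (by omega)).trans v₁
  refine (halts_weightedNormSq R₂.idx_zero R₂.idx_two R₂.idx_five).mono ?_
  rintro s₃ ⟨i₃, r₃, n₃, m₃, dr₃, t₃, q₃⟩
  rw [p₂, g₂, R₂.reg_three] at n₃
  have R₃ : Ready d h c s₃ := R₂.of_agree
    (by rintro j (rfl | rfl | rfl | rfl) <;> exact i₃ _ (by simp) (by simp))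
    (by rintro j (rfl | rfl) <;> exact r₃ _ (by simp) (by simp))
  rw [halts_seq, halts_sqrt, halts_seq, halts_mul, halts_seq]
  set s₄ := ((s₃.writeReg 5 √(s₃.reg 5)).writeReg 5
    ((s₃.writeReg 5 √(s₃.reg 5)).reg 5 * (s₃.writeReg 5 √(s₃.reg 5)).reg 4)) with hs₄
  have R₄ : Ready d h c s₄ := R₃.of_agree (fun _ _ => rfl)
    (by rintro j (rfl | rfl) <;> simp [hs₄, State.writeReg])
  have n₄ : s₄.reg 5 = √(‖v‖ ^ 2 + h ^ 2 * ‖G (s.vec d 0)‖ ^ 2) * c := by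
    simp [hs₄, State.writeReg, n₃, R₃.reg_four]
  refine (halts_ceilIdx R₄.idx_five).mono ?_
  rintro s₅ ⟨i₅, r₅, n₅, m₅, dr₅, t₅, q₅⟩
  have R₅ : Ready d h c s₅ := R₄.of_agree
    (by rintro j (rfl | rfl | rfl | rfl) <;> exact i₅ _ (by simp))
    (by rintro j (rfl | rfl) <;> exact r₅ _ (by simp))
  rw [n₄] at n₅ t₅
  set n := numSteps G h c (s.vec d 0) v with hn
  have n₅' : s₅.idx 7 = n := n₅
  have t₅' : s₅.time = s₄.time + 3 * n := t₅
  have m₅' : s₅.mem = s₂.mem := m₅.trans m₃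
  have hvec : ∀ t : State, t.mem = s₂.mem → ∀ a, t.vec d a = s₂.vec d a := fun t ht a => by
    simp only [State.vec, ht]
  -- What the final loop needs from its initial state, so that the six scalar instructions before it
  -- can be discharged by simplification.
  have key : ∀ t : State, t.idx = s₅.idx → t.reg 3 = h → t.reg 4 = c → t.reg 8 = h / n / 2 →
      t.reg 9 = -(h / n) → t.mem = s₂.mem → t.drawn = s₅.drawn → t.time = s₅.time + 6 →
      t.queries = s₅.queries → Halts G ω verletLoop t fun s' => Ready d h c s' ∧
      s'.vec d 0 = nextPoint G h c (s.vec d 0) v ∧ s'.drawn = s.drawn + d ∧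
      s'.time ≤ s.time + 100 * d * n ∧ s'.queries = s.queries + n + 1 := by
    intro t hi h3 h4 h8 h9 hm hdr ht hq
    have Rt : Ready d h c t :=
      ⟨by rw [hi, R₅.1], by rw [hi, R₅.2], by rw [hi, R₅.3], by rw [hi, R₅.4], h3, h4⟩
    refine (halts_verletLoop Rt h8 h9).mono ?_
    rintro s₆ ⟨R₆, x₆, dr₆, t₆, q₆⟩
    rw [hi, n₅'] at x₆ t₆ q₆
    refine ⟨R₆, ?_, ?_, ?_, ?_⟩
    · rw [x₆, hvec t hm, hvec t hm, x₂, p₂]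
      rfl
    · rw [dr₆, hdr, dr₅]
      change s₃.drawn = _
      rw [dr₃]
      exact dr₁
    · rw [t₆, ht]
      have e2 : s₂.time = s₁.time + d := rfl
      have e4 : s₄.time = s₃.time + 1 + 1 := rfl
      have hn1 : 1 ≤ n := le_max_left _ _
      have : d ≤ d * n := Nat.le_mul_of_pos_right _ hn1
      have : n ≤ d * n := Nat.le_mul_of_pos_left _ hd
      have e6 : n * (28 * d + 8) = 28 * (d * n) + 8 * n := by ring
      have e7 : 100 * d * n = 100 * (d * n) := by ring
      rw [e6, e7]
      omega
    · rw [q₆, hq, q₅]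
      have e2 : s₂.queries = s₁.queries + 1 := rfl
      have e4 : s₄.queries = s₃.queries := rfl
      omega
  rw [halts_seq, halts_ofIdx, halts_seq, halts_div, halts_seq, halts_const, halts_seq, halts_div,
    halts_seq, halts_const, halts_seq, halts_sub]
  simp only [State.writeReg, Function.update_apply]
  exact key _ rfl (by simp [R₅.reg_three]) (by simp [R₅.reg_four])
    (by simp [R₅.reg_three, n₅']) (by simp [R₅.reg_three, n₅']) m₅' rfl rfl rfl

/-- Compute the constants and the number of iterations. -/
def preparation : Cmd :=
  .seq (.setIdx 5 1) (.seq (.addIdx 2 0 0)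
    (.seq (.sqrt 5 0) (.seq (.sqrt 6 5) (.seq (.sqrt 7 1) (.seq (.sqrt 8 7) (.seq (.mul 7 7 8)
    (.seq (.const 9 2) (.seq (.mul 7 9 7) (.seq (.div 3 6 7)
    (.seq (.const 9 1024) (.seq (.mul 9 9 3) (.seq (.mul 9 9 1) (.seq (.mul 5 5 2)
    (.seq (.div 4 9 5)
    (.seq (.mul 6 3 3) (.seq (.mul 6 0 6) (.seq (.const 7 8) (.seq (.div 6 6 7) (.seq (.const 7 1)
    (.seq (.sub 6 7 6)
    (.seq (.ofIdx 7 0) (.seq (.sqrt 7 7) (.seq (.const 8 4) (.seq (.mul 7 8 7)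
    (.while (.realLt 2 7) (.seq (.mul 7 7 6) (.addIdx 1 1 5)))))))))))))))))))))))))))

/-- The step size, as the algorithm computes it. -/
def stepSize (m M : ℝ) : ℝ := √√m / (2 * (√M * √√M))

/-- The factor that determines the number of integration steps. -/
def stepFactor (m M ε : ℝ) : ℝ := 1024 * stepSize m M * M / (√m * ε)

/-- The contraction factor of an iteration. -/
def contraction (m M : ℝ) : ℝ := 1 - m * (stepSize m M * stepSize m M) / 8

/-- No logarithm is available, so N is found by multiplying 4√d by the contraction factor until the
product is at most ε; the hypotheses describe N as the first such exponent. -/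
theorem halts_preparation {m M ε : ℝ} {x₀ : E d} {N : ℕ}
    (hN : ∀ k < N, ε < 4 * √d * contraction m M ^ k) (hN' : 4 * √d * contraction m M ^ N ≤ ε) :
    Halts G ω preparation (input m M ε x₀) fun s =>
      Ready d (stepSize m M) (stepFactor m M ε) s ∧ s.idx 1 = N ∧ s.vec d 0 = x₀ ∧
      s.drawn = 0 ∧ s.time = 26 + 3 * N ∧ s.queries = 0 := by
  simp only [preparation, halts_seq, halts_setIdx, halts_addIdx, halts_const, halts_ofIdx,
    halts_sub, halts_mul, halts_div, halts_sqrt]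
  refine halts_while (n := N) (fun i s => Ready d (stepSize m M) (stepFactor m M ε) s ∧
      s.idx 1 = i ∧ s.reg 2 = ε ∧ s.reg 6 = contraction m M ∧
      s.reg 7 = 4 * √d * contraction m M ^ i ∧ s.vec d 0 = x₀ ∧
      s.drawn = 0 ∧ s.time = 25 + 3 * i ∧ s.queries = 0) ?_ ?_ ?_ ?_
  · simp only [State.writeIdx, State.writeReg, Function.update_apply]
    refine ⟨⟨by simp [input], by simp [input]; ring, by simp, by simp [input],
      by simp [input, stepSize], by simp [input, stepFactor, stepSize]⟩, by simp [input],
      by simp [input], by simp [input, contraction, stepSize], by simp [input], ?_, rfl, rfl, rfl⟩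
    ext i
    simp [State.vec, input]
  · rintro i hi s ⟨hR, h1, h2, h6, h7, hx, hdr, ht, hq⟩
    refine ⟨by simp only [Test.Holds, h2, h7]; exact hN i hi, ?_⟩
    simp only [halts_seq, halts_addIdx, halts_mul]
    simp only [State.writeIdx, State.writeReg, State.tick, Function.update_apply]
    refine ⟨hR.of_agree ?_ ?_, by simp [h1, hR.idx_five], by simp [h2], by simp [h6],
      by simp [h6, h7, pow_succ]; ring, hx, hdr, by omega, hq⟩
    · rintro j (rfl | rfl | rfl | rfl) <;> simp
    · rintro j (rfl | rfl) <;> simp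
  · rintro s ⟨hR, h1, h2, h6, h7, -⟩
    simp only [Test.Holds, h2, h7, not_lt]
    exact hN'
  · rintro s ⟨hR, h1, h2, h6, h7, hx, hdr, ht, hq⟩
    exact ⟨hR.of_agree (fun _ _ => rfl) (fun _ _ => rfl), h1, hx, hdr,
      by simp only [State.tick]; omega, hq⟩

/-- Hamiltonian Monte Carlo with the position Verlet integrator. -/
def hmcAlgorithm : Algorithm := ⟨preparation, iteration⟩

/-- The points that the algorithm visits. -/
def chain (G : E d → E d) (h c : ℝ) (x₀ : E d) (ω : ℕ → ℝ) : ℕ → E d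
  | 0 => x₀
  | k + 1 => nextPoint G h c (chain G h c x₀ ω k) (WithLp.toLp 2 fun i : Fin d => ω (k * d + i))

/-- The number of integration steps in iteration `k`. -/
def chainSteps (G : E d → E d) (h c : ℝ) (x₀ : E d) (ω : ℕ → ℝ) (k : ℕ) : ℕ :=
  numSteps G h c (chain G h c x₀ ω k) (WithLp.toLp 2 fun i : Fin d => ω (k * d + i))

theorem exists_execution {m M ε : ℝ} {x₀ : E d} {N : ℕ} (hd : 0 < d) (G : E d → E d) (ω : ℕ → ℝ)
    (hN : ∀ k < N, ε < 4 * √d * contraction m M ^ k) (hN' : 4 * √d * contraction m M ^ N ≤ ε) :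
    ∃ S : ℕ → State, hmcAlgorithm.Executes G ω (input m M ε x₀) N S ∧
      ∀ k, (S k).vec d 0 = chain G (stepSize m M) (stepFactor m M ε) x₀ ω k ∧
        (S k).drawn = k * d ∧
        (S k).time ≤ 26 + 3 * N + 100 * d *
          ∑ j ∈ Finset.range k, chainSteps G (stepSize m M) (stepFactor m M ε) x₀ ω j ∧
        (S k).queries =
          ∑ j ∈ Finset.range k, (chainSteps G (stepSize m M) (stepFactor m M ε) x₀ ω j + 1) := by
  set h := stepSize m M
  set c := stepFactor m M ε
  obtain ⟨s₀, hr₀, R₀, i₀, x₀', d₀, t₀, q₀⟩ := halts_preparation (G := G) (ω := ω) (x₀ := x₀) hN hN'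
  -- On ready configurations the iteration always halts and preserves readiness, so it can be
  -- iterated as a function, even beyond N.
  have hstep : ∀ s : {s // Ready d h c s}, ∃ s' : {s // Ready d h c s},
      Run G ω iteration s.1 s'.1 ∧
      s'.1.vec d 0 = nextPoint G h c (s.1.vec d 0)
        (WithLp.toLp 2 fun i : Fin d => ω (s.1.drawn + i)) ∧
      s'.1.drawn = s.1.drawn + d ∧
      s'.1.time ≤ s.1.time + 100 * d * numSteps G h c (s.1.vec d 0)
        (WithLp.toLp 2 fun i : Fin d => ω (s.1.drawn + i)) ∧
      s'.1.queries = s.1.queries + numSteps G h c (s.1.vec d 0)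
        (WithLp.toLp 2 fun i : Fin d => ω (s.1.drawn + i)) + 1 := fun s =>
    let ⟨s', hr, R, hs'⟩ := halts_iteration (G := G) (ω := ω) s.2 hd
    ⟨⟨s', R⟩, hr, hs'⟩
  choose next hnext using hstep
  let S : ℕ → {s // Ready d h c s} := fun k => next^[k] ⟨s₀, R₀⟩
  have hS : ∀ k, S (k + 1) = next (S k) := fun k => Function.iterate_succ_apply' _ _ _
  refine ⟨fun k => (S k).1, ⟨hr₀, i₀, fun k _ => ?_⟩, fun k => ?_⟩
  · simp only [hS]; exact (hnext (S k)).1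
  · induction k with
    | zero => exact ⟨x₀', by simpa [S] using d₀, by simp [S, t₀], by simpa [S] using q₀⟩
    | succ k ih =>
      obtain ⟨hx, hdr, ht, hq⟩ := ih
      obtain ⟨-, hx', hdr', ht', hq'⟩ := hnext (S k)
      simp only [hS]
      rw [hx, hdr] at hx' ht' hq'
      refine ⟨hx', by rw [hdr', hdr]; ring, ?_, ?_⟩
      · rw [Finset.sum_range_succ, mul_add]
        exact ht'.trans (by rw [← add_assoc]; exact Nat.add_le_add_right ht _)
      · rw [Finset.sum_range_succ, hq', hq]
        rfl

end Algorithm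

/-! ### The random tape -/

instance : IsProbabilityMeasure tapeLaw := by unfold tapeLaw; infer_instance

/-- The velocity drawn in iteration `k`. -/
def velocity (d k : ℕ) (ω : ℕ → ℝ) : E d := WithLp.toLp 2 fun i : Fin d => ω (k * d + i)

@[fun_prop]
theorem measurable_velocity (d k : ℕ) : Measurable (velocity d k) := by
  unfold velocity
  exact (WithLp.measurable_toLp 2 _).comp (by fun_prop)

theorem map_eval_tapeLaw (j : ℕ) : tapeLaw.map (fun ω => ω j) = gaussianReal 0 1 :=
  Measure.infinitePi_map_eval _ j

theorem map_velocity_tapeLaw (d k : ℕ) : tapeLaw.map (velocity d k) = stdGaussian (E d) := by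
  have hinj : Function.Injective fun i : Fin d => k * d + (i : ℕ) := fun i j hij => by
    ext; simpa using hij
  have h1 : tapeLaw.map (fun ω (i : Fin d) => ω (k * d + i)) =
      Measure.pi fun _ : Fin d => gaussianReal 0 1 := by
    rw [← Measure.infinitePi_eq_pi]
    exact Measure.map_infinitePi_infinitePi_of_inj hinj
  rw [← map_pi_eq_stdGaussian, ← h1, Measure.map_map (WithLp.measurable_toLp 2 _) (by fun_prop)]
  rfl

/-- A function of the first `n` entries of the tape is independent of the following ones. -/
theorem indepFun_velocity {d k : ℕ} {β : Type*} [MeasurableSpace β] {F : (ℕ → ℝ) → β}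
    (hF : Measurable F) (hdep : ∀ ω ω' : ℕ → ℝ, (∀ i < k * d, ω i = ω' i) → F ω = F ω') :
    IndepFun F (velocity d k) tapeLaw := by
  have hind : iIndepFun (fun (i : ℕ) (ω : ℕ → ℝ) => ω i) tapeLaw :=
    iIndepFun_infinitePi (X := fun _ x => x) fun _ => measurable_id
  have h1 := hind.indepFun_finset (Finset.range (k * d)) (Finset.Ico (k * d) (k * d + d))
    (by
      rw [Finset.disjoint_left]
      intro i hi hi'
      simp only [Finset.mem_range, Finset.mem_Ico] at hi hi'
      omega) fun i => measurable_pi_apply i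
  -- Extension of the first k * d entries by zero; by `hdep`, F does not notice the change.
  let e : (Finset.range (k * d) → ℝ) → ℕ → ℝ := fun u i =>
    if hi : i ∈ Finset.range (k * d) then u ⟨i, hi⟩ else 0
  have he : Measurable e := measurable_pi_iff.2 fun i => by
    by_cases hi : i ∈ Finset.range (k * d)
    · simp only [e, hi, dite_true]; exact measurable_pi_apply _
    · simp only [e, hi, dite_false]; exact measurable_const
  let g : (Finset.Ico (k * d) (k * d + d) → ℝ) → E d := fun u =>
    WithLp.toLp 2 fun i : Fin d => u ⟨k * d + i, by simp⟩
  have hg : Measurable g := (WithLp.measurable_toLp 2 _).comp (by fun_prop)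
  have h2 := h1.comp (hF.comp he) hg
  refine h2.congr (ae_of_all _ fun ω => ?_) (ae_of_all _ fun ω => rfl)
  refine hdep _ _ fun i hi => ?_
  simp [e, hi]

theorem integrable_eval_tapeLaw (j : ℕ) : Integrable (fun ω : ℕ → ℝ => ω j) tapeLaw := by
  have h : Integrable id (tapeLaw.map fun ω : ℕ → ℝ => ω j) := by
    rw [map_eval_tapeLaw]; exact (memLp_id_gaussianReal 1).integrable le_rfl
  exact h.comp_measurable (measurable_pi_apply j)

theorem integral_eval_tapeLaw (j : ℕ) : ∫ ω, ω j ∂tapeLaw = 0 := by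
  have h : ∫ x, x ∂(tapeLaw.map fun ω : ℕ → ℝ => ω j) = ∫ ω, ω j ∂tapeLaw :=
    integral_map (measurable_pi_apply j).aemeasurable aestronglyMeasurable_id
  rw [← h, map_eval_tapeLaw, integral_id_gaussianReal]

theorem integrable_eval_sq_tapeLaw (j : ℕ) :
    Integrable (fun ω : ℕ → ℝ => ω j ^ 2) tapeLaw := by
  have h : Integrable (fun x => x ^ 2) (tapeLaw.map fun ω : ℕ → ℝ => ω j) := by
    rw [map_eval_tapeLaw]; exact (memLp_id_gaussianReal 2).integrable_sq
  exact h.comp_measurable (measurable_pi_apply j)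

theorem integral_eval_sq_tapeLaw (j : ℕ) : ∫ ω, ω j ^ 2 ∂tapeLaw = 1 := by
  have h : ∫ x, x ^ 2 ∂(tapeLaw.map fun ω : ℕ → ℝ => ω j) = ∫ ω, ω j ^ 2 ∂tapeLaw :=
    integral_map (measurable_pi_apply j).aemeasurable (by fun_prop)
  rw [← h, map_eval_tapeLaw, ← variance_of_integral_eq_zero aemeasurable_id'
    integral_id_gaussianReal, variance_fun_id_gaussianReal, NNReal.coe_one]

theorem integrable_norm_velocity_sq (d k : ℕ) :
    Integrable (fun ω => ‖velocity d k ω‖ ^ 2) tapeLaw := by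
  simp only [EuclideanSpace.real_norm_sq_eq, velocity]
  exact integrable_finsetSum _ fun i _ => integrable_eval_sq_tapeLaw _

theorem integral_norm_velocity_sq (d k : ℕ) : ∫ ω, ‖velocity d k ω‖ ^ 2 ∂tapeLaw = d := by
  simp only [EuclideanSpace.real_norm_sq_eq, velocity]
  rw [integral_finsetSum _ fun i _ => integrable_eval_sq_tapeLaw _]
  simp [integral_eval_sq_tapeLaw]

theorem integrable_norm_velocity (d k : ℕ) :
    Integrable (fun ω => ‖velocity d k ω‖) tapeLaw := by
  refine ((integrable_norm_velocity_sq d k).add (integrable_const 1)).mono'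
    (by fun_prop) (ae_of_all _ fun ω => ?_)
  simp only [norm_norm, Pi.add_apply]
  nlinarith [sq_nonneg (‖velocity d k ω‖ - 1)]

/-- A vector that is determined by the past is uncorrelated with the fresh velocity. -/
theorem integral_inner_velocity {d k : ℕ} {F : (ℕ → ℝ) → E d}
    (hF : Integrable F tapeLaw) (hFm : Measurable F)
    (hdep : ∀ ω ω' : ℕ → ℝ, (∀ i < k * d, ω i = ω' i) → F ω = F ω') :
    Integrable (fun ω => inner ℝ (velocity d k ω) (F ω)) tapeLaw ∧
      ∫ ω, inner ℝ (velocity d k ω) (F ω) ∂tapeLaw = 0 := by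
  have hind := indepFun_velocity hFm hdep
  have hi : ∀ i : Fin d, IndepFun (fun ω => F ω i) (fun ω => ω (k * d + i)) tapeLaw := fun i =>
    hind.comp (φ := fun x : E d => x i) (ψ := fun x : E d => x i) (by fun_prop) (by fun_prop)
  have hFi : ∀ i : Fin d, Integrable (fun ω => F ω i) tapeLaw := fun i =>
    hF.mono (by fun_prop) (ae_of_all _ fun ω => PiLp.norm_apply_le (F ω) i)
  have hmul : ∀ i : Fin d, Integrable (fun ω => F ω i * ω (k * d + i)) tapeLaw := fun i =>
    (hi i).integrable_mul (hFi i) (integrable_eval_tapeLaw _)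
  have hinner : ∀ ω, inner ℝ (velocity d k ω) (F ω) = ∑ i : Fin d, F ω i * ω (k * d + i) :=
    fun ω => by simp [PiLp.inner_apply, velocity]
  simp only [hinner]
  refine ⟨integrable_finsetSum _ fun i _ => hmul i, ?_⟩
  rw [integral_finsetSum _ fun i _ => hmul i]
  refine Finset.sum_eq_zero fun i _ => ?_
  rw [(hi i).integral_fun_mul_eq_mul_integral (hFi i).1 (integrable_eval_tapeLaw _).1,
    integral_eval_tapeLaw, mul_zero]

/-! ### The Markov chains -/

/-- The assumptions on the function and on the parameters of the algorithm. -/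
structure Admissible {d : ℕ} (f : E d → ℝ) (m M ε h c : ℝ) (x₀ : E d) : Prop where
  bounds : HessianBounds f m M
  m_pos : 0 < m
  m_le : m ≤ M
  h_pos : 0 < h
  h_le : M * h ^ 2 ≤ 1 / 4
  h_le' : M ^ 3 * h ^ 4 ≤ m / 16
  eps_pos : 0 < ε
  eps_le : ε ≤ √d
  minimizer : ∀ y, f x₀ ≤ f y
  factor : c = 1024 * h * M / (√m * ε)

namespace Admissible

variable {d : ℕ} {f : E d → ℝ} {m M ε h c : ℝ} {x₀ : E d}

theorem M_pos (H : Admissible f m M ε h c x₀) : 0 < M := H.m_pos.trans_le H.m_le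

theorem c_pos (H : Admissible f m M ε h c x₀) : 0 < c := by
  have := H.m_pos; have := H.M_pos; have := H.h_pos; have := H.eps_pos
  rw [H.factor]; positivity

theorem accuracy_eq (H : Admissible f m M ε h c x₀) : accuracy m ε h = √m * h ^ 2 * ε / 16 := by
  have h1 : 0 < √m := Real.sqrt_pos.2 H.m_pos
  have h2 : √m * √m = m := Real.mul_self_sqrt H.m_pos.le
  rw [accuracy, div_eq_iff (by positivity)]
  linear_combination -(h ^ 2 * ε / 8) * h2

/-- The integration error is small enough for `gradient_sq_le` with s = √d; this is where ε ≤ √d is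
used. -/
theorem accuracy_le (H : Admissible f m M ε h c x₀) : accuracy m ε h ≤ h * √d / 32 := by
  have hh := H.h_pos
  have h1 : √m * h ≤ 1 / 2 := by
    refine abs_le_of_sq_le_sq' ?_ (by norm_num) |>.2
    rw [mul_pow, Real.sq_sqrt H.m_pos.le]
    have : m * h ^ 2 ≤ M * h ^ 2 := by have := H.m_le; gcongr
    linarith [H.h_le]
  rw [H.accuracy_eq]
  calc √m * h ^ 2 * ε / 16 = (√m * h) * (h * ε) / 16 := by ring
    _ ≤ 1 / 2 * (h * √d) / 16 := by have := H.eps_pos; have := H.eps_le; gcongr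
    _ = _ := by ring

/-- The number of steps is at least √W c, and ‖v‖ + h‖∇f(x)‖ ≤ 2√W, so the Verlet error is at most
64h³M/c. The constant 1024 in c makes this equal to the prescribed accuracy √m h²ε/16. -/
theorem nextPoint_error (H : Admissible f m M ε h c x₀) {x v : E d} {q p : ℝ → E d}
    (hq : IsHMCPath f h x v q p) :
    ‖nextPoint (gradient f) h c x v - q h‖ ≤ accuracy m ε h := by
  have hc := H.c_pos
  have hh := H.h_pos
  have hM := H.M_pos
  have hm := Real.sqrt_pos.2 H.m_pos
  have hε := H.eps_pos
  set n := numSteps (gradient f) h c x v with hn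
  have hn1 : 0 < n := lt_of_lt_of_le one_pos (le_max_left _ _)
  have hn0 : (0 : ℝ) < n := by exact_mod_cast hn1
  have herr := hq.verlet_error H.bounds H.m_pos.le hM hh H.h_le hn1
  set W := ‖v‖ ^ 2 + h ^ 2 * ‖gradient f x‖ ^ 2 with hW
  have hWn : √W * c ≤ n := by
    have h1 : (⌈√W * c⌉₊ : ℝ) ≤ n := by exact_mod_cast le_max_right _ _
    exact (Nat.le_ceil _).trans h1
  have hV : ‖v‖ + h * ‖gradient f x‖ ≤ 2 * √W := by
    have h1 : ‖v‖ ≤ √W :=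
      Real.le_sqrt_of_sq_le (by rw [hW]; nlinarith [sq_nonneg (h * ‖gradient f x‖)])
    have h2 : h * ‖gradient f x‖ ≤ √W :=
      Real.le_sqrt_of_sq_le (by rw [hW, mul_pow]; nlinarith [sq_nonneg ‖v‖])
    linarith
  have h0 : ‖nextPoint (gradient f) h c x v - q h‖ ≤
      32 * h ^ 3 * M * (‖v‖ + h * ‖gradient f x‖) / n := by
    rw [norm_sub_rev]
    refine le_trans ?_ herr
    exact le_add_of_nonneg_right (by positivity)
  refine h0.trans ?_
  rw [H.accuracy_eq, div_le_iff₀ hn0]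
  have h3 : √m * h ^ 2 * ε / 16 * (√W * c) ≤ √m * h ^ 2 * ε / 16 * n := by gcongr
  refine le_trans ?_ h3
  have h4 : √m * h ^ 2 * ε / 16 * (√W * c) = 32 * h ^ 3 * M * (2 * √W) := by
    rw [H.factor]; field_simp; ring
  rw [h4]
  gcongr

theorem exists_path (H : Admissible f m M ε h c x₀) (x v : E d) :
    ∃ q p, IsHMCPath f h x v q p :=
  exists_isHMCPath H.bounds H.m_pos.le H.M_pos H.h_pos H.h_le x v

theorem contraction_step (H : Admissible f m M ε h c x₀) (x y v : E d) :
    ‖nextPoint (gradient f) h c x v - (hmcMap f h (y, v)).1‖ ≤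
      (1 - m * h ^ 2 / 8) * ‖x - y‖ + accuracy m ε h := by
  obtain ⟨q, p, hq⟩ := H.exists_path x v
  obtain ⟨q', p', hq', he⟩ := hmcMap_spec H.bounds H.m_pos.le H.M_pos H.h_pos H.h_le (y, v)
  have h1 := H.nextPoint_error hq
  have h2 := hq.norm_sub_le_contraction hq' H.bounds H.m_pos H.M_pos H.m_le H.h_pos H.h_le H.h_le'
  rw [← he]
  have h3 := norm_add_le (nextPoint (gradient f) h c x v - q h) (q h - q' h)
  rw [sub_add_sub_cancel] at h3
  linarith

theorem measurable_numSteps (H : Admissible f m M ε h c x₀) :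
    Measurable fun z : E d × E d => numSteps (gradient f) h c z.1 z.2 := by
  have hg := H.bounds.continuous_gradient
  have hW : Measurable fun z : E d × E d =>
      √(‖z.2‖ ^ 2 + h ^ 2 * ‖gradient f z.1‖ ^ 2) * c :=
    Continuous.measurable (by fun_prop)
  exact measurable_const.max (Nat.measurable_ceil.comp hW)

/-- The number of steps depends on the point, so the preimage is split over its countably many
values. -/
theorem measurable_nextPoint (H : Admissible f m M ε h c x₀) :
    Measurable fun z : E d × E d => nextPoint (gradient f) h c z.1 z.2 := by
  have h1 : ∀ n : ℕ, Measurable fun z : E d × E d =>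
      ((verletStep (gradient f) (h / n))^[n] z).1 := fun n =>
    measurable_fst.comp
      ((measurable_verletStep H.bounds.continuous_gradient.measurable _).iterate n)
  intro s hs
  have h2 : (fun z : E d × E d => nextPoint (gradient f) h c z.1 z.2) ⁻¹' s =
      ⋃ n : ℕ, {z | numSteps (gradient f) h c z.1 z.2 = n} ∩
        (fun z => ((verletStep (gradient f) (h / n))^[n] z).1) ⁻¹' s := by
    ext z
    simp only [Set.mem_preimage, nextPoint, Set.mem_iUnion, Set.mem_inter_iff, Set.mem_ofPred_eq,
      exists_eq_left', Prod.mk.eta]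
  rw [h2]
  exact MeasurableSet.iUnion fun n =>
    (H.measurable_numSteps (measurableSet_singleton n)).inter (h1 n hs)

theorem measurable_chain (H : Admissible f m M ε h c x₀) (k : ℕ) :
    Measurable fun ω => chain (gradient f) h c x₀ ω k := by
  induction k with
  | zero => exact measurable_const
  | succ k ih =>
    have h1 : (fun ω => chain (gradient f) h c x₀ ω (k + 1)) =
        (fun z : E d × E d => nextPoint (gradient f) h c z.1 z.2) ∘
          fun ω => (chain (gradient f) h c x₀ ω k, velocity d k ω) := rfl
    rw [h1]
    exact H.measurable_nextPoint.comp (ih.prodMk (measurable_velocity d k))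

end Admissible

/-! ### Adaptedness to the tape, stationarity of the exact chain and the coupling -/

theorem velocity_congr {d k : ℕ} {ω ω' : ℕ → ℝ} (hω : ∀ i < (k + 1) * d, ω i = ω' i) :
    velocity d k ω = velocity d k ω' := by
  ext i
  refine hω _ ?_
  have := i.2
  rw [add_mul]
  omega

theorem chain_congr {d : ℕ} {G : E d → E d} {h c : ℝ} {x₀ : E d} (k : ℕ) {ω ω' : ℕ → ℝ}
    (hω : ∀ i < k * d, ω i = ω' i) : chain G h c x₀ ω k = chain G h c x₀ ω' k := by
  induction k with
  | zero => rfl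
  | succ k ih =>
    have h1 := velocity_congr hω
    have h2 := ih fun i hi => hω i (by rw [add_mul]; omega)
    simp only [velocity] at h1
    simp only [chain, h1, h2]

/-- The chain of the exact dynamics, driven by the same velocities. -/
def exactChain {d : ℕ} (f : E d → ℝ) (h : ℝ) (y : E d) (ω : ℕ → ℝ) : ℕ → E d
  | 0 => y
  | k + 1 => (hmcMap f h (exactChain f h y ω k, velocity d k ω)).1

theorem exactChain_congr {d : ℕ} {f : E d → ℝ} {h : ℝ} {y : E d} (k : ℕ) {ω ω' : ℕ → ℝ}
    (hω : ∀ i < k * d, ω i = ω' i) : exactChain f h y ω k = exactChain f h y ω' k := by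
  induction k with
  | zero => rfl
  | succ k ih =>
    simp only [exactChain, velocity_congr hω, ih fun i hi => hω i (by rw [add_mul]; omega)]

namespace Admissible

variable {d : ℕ} {f : E d → ℝ} {m M ε h c : ℝ} {x₀ : E d}

theorem measurable_exactChain (H : Admissible f m M ε h c x₀) (k : ℕ) :
    Measurable fun z : E d × (ℕ → ℝ) => exactChain f h z.1 z.2 k := by
  induction k with
  | zero => exact measurable_fst
  | succ k ih =>
    exact measurable_fst.comp
      ((measurable_hmcMap H.bounds H.m_pos.le H.M_pos H.h_pos H.h_le).comp
        (ih.prodMk ((measurable_velocity d k).comp measurable_snd)))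

/-- Started from the Gibbs measure, the exact chain is stationary. -/
theorem map_exactChain (H : Admissible f m M ε h c x₀) (k : ℕ) :
    ((gibbs f).prod tapeLaw).map (fun z => exactChain f h z.1 z.2 k) = gibbs f := by
  have := H.bounds.isProbabilityMeasure_gibbs H.m_pos H.minimizer
  induction k with
  | zero => exact Measure.fst_prod
  | succ k ih =>
    have hY := H.measurable_exactChain k
    have hV : Measurable fun z : E d × (ℕ → ℝ) => velocity d k z.2 :=
      (measurable_velocity d k).comp measurable_snd
    -- For each fixed starting point the current position depends on the past of the tape and is
    -- independent of the fresh velocity. Integrating over the starting point gives the product law.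
    have hjoint : ((gibbs f).prod tapeLaw).map
        (fun z => (exactChain f h z.1 z.2 k, velocity d k z.2)) =
        (gibbs f).prod (stdGaussian (E d)) := by
      symm
      refine Measure.prod_eq fun s t hs ht => ?_
      rw [Measure.map_apply (hY.prodMk hV) (hs.prod ht),
        Measure.prod_apply ((hY.prodMk hV) (hs.prod ht))]
      have h1 : ∀ y : E d, tapeLaw (Prod.mk y ⁻¹'
          ((fun z : E d × (ℕ → ℝ) => (exactChain f h z.1 z.2 k, velocity d k z.2)) ⁻¹' s ×ˢ t)) =
          tapeLaw (Prod.mk y ⁻¹' ((fun z : E d × (ℕ → ℝ) => exactChain f h z.1 z.2 k) ⁻¹' s)) *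
            stdGaussian (E d) t := fun y => by
        have hYy : Measurable fun ω => exactChain f h y ω k := hY.comp measurable_prodMk_left
        have hind := indepFun_velocity (d := d) (k := k) hYy
          fun ω ω' hω => exactChain_congr k hω
        rw [← map_velocity_tapeLaw d k, Measure.map_apply (measurable_velocity d k) ht]
        exact hind.measure_inter_preimage_eq_mul s t hs ht
      simp_rw [h1]
      rw [lintegral_mul_const _ (measurable_measure_prodMk_left (hY hs)),
        ← Measure.prod_apply (hY hs), ← Measure.map_apply hY hs, ih]
    have hΦ := measurePreserving_hmcMap H.bounds H.m_pos H.M_pos H.h_pos H.h_le H.minimizer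
    have h2 : (fun z : E d × (ℕ → ℝ) => exactChain f h z.1 z.2 (k + 1)) =
        Prod.fst ∘ hmcMap f h ∘ fun z => (exactChain f h z.1 z.2 k, velocity d k z.2) := rfl
    rw [h2, ← Measure.map_map measurable_fst (hΦ.measurable.comp (hY.prodMk hV)),
      ← Measure.map_map hΦ.measurable (hY.prodMk hV), hjoint, hΦ.map_eq]
    exact Measure.fst_prod

/-- With θ = mh²/8 the error per step is θ · ε/(2√m), so the distance obeys r ↦ (1 - θ) r + θ ·
ε/(2√m), whose fixed point is ε/(2√m). -/
theorem norm_chain_sub_exactChain_le (H : Admissible f m M ε h c x₀) (y : E d) (ω : ℕ → ℝ)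
    (k : ℕ) : ‖chain (gradient f) h c x₀ ω k - exactChain f h y ω k‖ ≤
      (1 - m * h ^ 2 / 8) ^ k * ‖x₀ - y‖ + ε / (2 * √m) := by
  have hm := Real.sqrt_pos.2 H.m_pos
  have hθ : m * h ^ 2 / 8 ≤ 1 := by
    have : m * h ^ 2 ≤ M * h ^ 2 := by have := H.m_le; gcongr
    linarith [H.h_le]
  have hθ0 : 0 ≤ m * h ^ 2 / 8 := by have := H.m_pos; positivity
  have he : 0 ≤ ε / (2 * √m) := by have := H.eps_pos; positivity
  have key : ‖chain (gradient f) h c x₀ ω k - exactChain f h y ω k‖ ≤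
      (1 - m * h ^ 2 / 8) ^ k * ‖x₀ - y‖ +
        (1 - (1 - m * h ^ 2 / 8) ^ k) * (ε / (2 * √m)) := by
    induction k with
    | zero => simp [chain, exactChain]
    | succ k ih =>
      have h1 := H.contraction_step (chain (gradient f) h c x₀ ω k) (exactChain f h y ω k)
        (velocity d k ω)
      have h2 := mul_le_mul_of_nonneg_left ih (sub_nonneg.2 hθ)
      refine h1.trans ?_
      rw [pow_succ (1 - m * h ^ 2 / 8)]
      have h3 : accuracy m ε h = m * h ^ 2 / 8 * (ε / (2 * √m)) := by rw [accuracy, mul_div_assoc]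
      rw [h3]
      linarith
  refine key.trans ?_
  have h4 : (0 : ℝ) ≤ (1 - m * h ^ 2 / 8) ^ k := pow_nonneg (sub_nonneg.2 hθ) k
  nlinarith

/-- The Wasserstein distance of the output to the Gibbs measure. -/
theorem W₂_chain_le (H : Admissible f m M ε h c x₀) (hd : 0 < d) {N : ℕ}
    (hN : 4 * √d * (1 - m * h ^ 2 / 8) ^ N ≤ ε) :
    W₂ (tapeLaw.map fun ω => chain (gradient f) h c x₀ ω N) (gibbs f) ≤
      ENNReal.ofReal (ε / √m) := by
  have := H.bounds.isProbabilityMeasure_gibbs H.m_pos H.minimizer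
  have hm := Real.sqrt_pos.2 H.m_pos
  have hmm := H.m_pos
  have hε := H.eps_pos
  have hd' : (0 : ℝ) < d := by exact_mod_cast hd
  have hθ : 0 ≤ 1 - m * h ^ 2 / 8 := by
    have : m * h ^ 2 ≤ M * h ^ 2 := by have := H.m_le; gcongr
    linarith [H.h_le]
  set ρ := (1 - m * h ^ 2 / 8) ^ N with hρ
  have hρ0 : 0 ≤ ρ := pow_nonneg hθ N
  have hX : Measurable fun z : E d × (ℕ → ℝ) => chain (gradient f) h c x₀ z.2 N :=
    (H.measurable_chain N).comp measurable_snd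
  have hY := H.measurable_exactChain N
  set γ := ((gibbs f).prod tapeLaw).map
    fun z => (chain (gradient f) h c x₀ z.2 N, exactChain f h z.1 z.2 N) with hγ
  have hmem : γ ∈ couplings (tapeLaw.map fun ω => chain (gradient f) h c x₀ ω N) (gibbs f) := by
    constructor
    · rw [hγ, Measure.map_map measurable_fst (hX.prodMk hY)]
      have h1 : (Prod.fst ∘ fun z : E d × (ℕ → ℝ) =>
          (chain (gradient f) h c x₀ z.2 N, exactChain f h z.1 z.2 N)) =
          (fun ω => chain (gradient f) h c x₀ ω N) ∘ Prod.snd := rfl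
      rw [h1, ← Measure.map_map (H.measurable_chain N) measurable_snd]
      congr 1
      exact Measure.snd_prod
    · rw [hγ, Measure.map_map measurable_snd (hX.prodMk hY)]
      exact H.map_exactChain N
  obtain ⟨hint, hmom⟩ := H.bounds.second_moment_gibbs H.m_pos H.minimizer
  -- The squared distance is bounded through (a + b)² ≤ 2a² + 2b².
  set B : E d → ℝ := fun y => 2 * ρ ^ 2 * ‖y - x₀‖ ^ 2 + ε ^ 2 / (2 * m) with hB
  have hBint : Integrable B (gibbs f) := (hint.const_mul _).add (integrable_const _)
  have hB0 : ∀ y, 0 ≤ B y := fun y => by positivity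
  have hBle : ∫ y, B y ∂gibbs f ≤ (ε / √m) ^ 2 := by
    rw [integral_add (hint.const_mul _) (integrable_const _), integral_const_mul, integral_const]
    simp only [probReal_univ, one_smul]
    -- The first part is at most (4√d ρ)²/(4m) ≤ ε²/(4m), which explains the 4√d in the stopping
    -- rule. In total, 3/4 of ε²/m is used.
    have h1 : 2 * ρ ^ 2 * ∫ y, ‖y - x₀‖ ^ 2 ∂gibbs f ≤ 2 * ρ ^ 2 * (2 * d / m) := by gcongr
    have h2 : (4 * √d * ρ) ^ 2 ≤ ε ^ 2 := by gcongr
    rw [mul_pow, mul_pow, Real.sq_sqrt hd'.le] at h2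
    have h3 : 2 * ρ ^ 2 * (2 * d / m) = 4 ^ 2 * d * ρ ^ 2 / (4 * m) := by field_simp; ring
    have h4 : 4 ^ 2 * d * ρ ^ 2 / (4 * m) ≤ ε ^ 2 / (4 * m) := by gcongr
    rw [div_pow, Real.sq_sqrt H.m_pos.le]
    have h5 : ε ^ 2 / m = ε ^ 2 / (4 * m) + ε ^ 2 / (2 * m) + ε ^ 2 / (4 * m) := by
      field_simp; ring
    have h6 : 0 ≤ ε ^ 2 / (4 * m) := by positivity
    linarith
  have hcost : ∫⁻ p, ‖p.1 - p.2‖ₑ ^ 2 ∂γ ≤ ENNReal.ofReal ((ε / √m) ^ 2) := by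
    have hmeas : Measurable fun p : E d × E d => ‖p.1 - p.2‖ₑ ^ 2 := by fun_prop
    rw [hγ, lintegral_map hmeas (hX.prodMk hY)]
    calc ∫⁻ z, ‖chain (gradient f) h c x₀ z.2 N - exactChain f h z.1 z.2 N‖ₑ ^ 2
          ∂(gibbs f).prod tapeLaw
        ≤ ∫⁻ z, ENNReal.ofReal (B z.1) ∂(gibbs f).prod tapeLaw := by
          refine lintegral_mono fun z => ?_
          rw [← ofReal_norm, ← ENNReal.ofReal_pow (norm_nonneg _)]
          refine ENNReal.ofReal_le_ofReal ?_
          have h1 := H.norm_chain_sub_exactChain_le z.1 z.2 N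
          rw [norm_sub_rev x₀] at h1
          refine (pow_le_pow_left₀ (norm_nonneg _) h1 2).trans ?_
          have h2 : ε ^ 2 / (2 * m) = 2 * (ε / (2 * √m)) ^ 2 := by
            rw [div_pow, mul_pow, Real.sq_sqrt H.m_pos.le]; field_simp
          simp only [hB, h2]
          nlinarith [sq_nonneg (ρ * ‖z.1 - x₀‖ - ε / (2 * √m))]
      _ = ∫⁻ y, ENNReal.ofReal (B y) ∂gibbs f := by
          have hBm : AEMeasurable (fun z : E d × (ℕ → ℝ) => ENNReal.ofReal (B z.1))
              ((gibbs f).prod tapeLaw) := by fun_prop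
          rw [lintegral_prod _ hBm]
          simp
      _ = ENNReal.ofReal (∫ y, B y ∂gibbs f) :=
          (ofReal_integral_eq_lintegral_ofReal hBint (ae_of_all _ hB0)).symm
      _ ≤ _ := ENNReal.ofReal_le_ofReal hBle
  have h1 : (⨅ γ ∈ couplings (tapeLaw.map fun ω => chain (gradient f) h c x₀ ω N) (gibbs f),
      ∫⁻ p, ‖p.1 - p.2‖ₑ ^ 2 ∂γ) ≤ ENNReal.ofReal ((ε / √m) ^ 2) :=
    (iInf₂_le γ hmem).trans hcost
  rw [W₂]
  refine (ENNReal.rpow_le_rpow h1 (by norm_num)).trans_eq ?_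
  rw [ENNReal.ofReal_rpow_of_nonneg (by positivity) (by norm_num), ← Real.sqrt_eq_rpow,
    Real.sqrt_sq (by positivity)]

/-! ### The expected cost -/

/-- Needed only to give ⟨v, ∇f(x)⟩ an expectation. The bound may grow with k. -/
theorem integrable_norm_chain_sub (H : Admissible f m M ε h c x₀) (k : ℕ) :
    Integrable (fun ω => ‖chain (gradient f) h c x₀ ω k - x₀‖) tapeLaw := by
  have hh := H.h_pos
  have hM := H.M_pos
  induction k with
  | zero => simp [chain]
  | succ k ih =>
    refine ((((ih.const_mul (1 + 4 / 3 * h ^ 2 * M)).add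
      ((integrable_norm_velocity d k).const_mul (4 / 3 * h))).add
      (integrable_const (accuracy m ε h)))).mono'
      ((H.measurable_chain (k + 1)).sub_const x₀).norm.aestronglyMeasurable
      (ae_of_all _ fun ω => ?_)
    rw [norm_norm]
    set x := chain (gradient f) h c x₀ ω k with hx
    set v := velocity d k ω with hv
    change ‖nextPoint (gradient f) h c x v - x₀‖ ≤
      (1 + 4 / 3 * h ^ 2 * M) * ‖x - x₀‖ + 4 / 3 * h * ‖v‖ + accuracy m ε h
    obtain ⟨q, p, hq⟩ := H.exists_path x v
    obtain ⟨P, hP0, hP, hPV⟩ := hq.exists_velocity_bound H.bounds H.m_pos.le hM hh H.h_le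
    have h1 := hq.norm_position_sub_le hP (s := 0) (t := h) ⟨le_rfl, hh.le⟩ ⟨hh.le, le_rfl⟩ hh.le
    rw [hq.position_zero, sub_zero] at h1
    have h2 := H.nextPoint_error hq
    have h3 := H.bounds.norm_gradient_sub_le H.m_pos.le hM x x₀
    rw [gradient_eq_zero_of_forall_le H.minimizer, sub_zero] at h3
    have h4 : nextPoint (gradient f) h c x v - x₀ =
      (nextPoint (gradient f) h c x v - q h) + (q h - x) + (x - x₀) := by abel
    have h5 := norm_add₃_le (a := nextPoint (gradient f) h c x v - q h) (b := q h - x)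
      (c := x - x₀)
    rw [← h4] at h5
    have h6 : P * h ≤ 4 / 3 * (‖v‖ + h * (M * ‖x - x₀‖)) * h := by
      gcongr; refine hPV.trans ?_; gcongr
    linarith

/-- The expected number of integration steps. -/
theorem lintegral_sum_chainSteps_le (H : Admissible f m M ε h c x₀) (hd : 0 < d) (N : ℕ) :
    ∫⁻ ω, ((∑ j ∈ Finset.range N, chainSteps (gradient f) h c x₀ ω j : ℕ) : ℝ≥0∞) ∂tapeLaw ≤
      ENNReal.ofReal (N * (1 + 51 * c * √d)) := by
  have hc := H.c_pos
  have hd' : (0 : ℝ) < √d := Real.sqrt_pos.2 (by exact_mod_cast hd)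
  have hdd : √d ^ 2 = d := Real.sq_sqrt (by positivity)
  set g : (ℕ → ℝ) → ℕ → E d := fun ω j => gradient f (chain (gradient f) h c x₀ ω j) with hg
  have hgm : ∀ j, Measurable fun ω => g ω j := fun j =>
    H.bounds.continuous_gradient.measurable.comp (H.measurable_chain j)
  have hgi : ∀ j, Integrable (fun ω => g ω j) tapeLaw := fun j => by
    refine ((H.integrable_norm_chain_sub j).const_mul M).mono' (hgm j).aestronglyMeasurable
      (ae_of_all _ fun ω => ?_)
    have h3 := H.bounds.norm_gradient_sub_le H.m_pos.le H.M_pos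
      (chain (gradient f) h c x₀ ω j) x₀
    rwa [gradient_eq_zero_of_forall_le H.minimizer, sub_zero] at h3
  have hin : ∀ j, Integrable (fun ω => inner ℝ (velocity d j ω) (g ω j)) tapeLaw ∧
      ∫ ω, inner ℝ (velocity d j ω) (g ω j) ∂tapeLaw = 0 := fun j =>
    integral_inner_velocity (hgi j) (hgm j) fun ω ω' hω => by
      simp only [hg, chain_congr j hω]
  -- The bound for the number of steps without its telescoping part. Its mean is explicit because
  -- the inner product has mean zero.
  set T : (ℕ → ℝ) → ℕ → ℝ := fun ω j => 1 + c / (2 * √d) *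
    (51 * ‖velocity d j ω‖ ^ 2 + 25 / 2 * h * inner ℝ (velocity d j ω) (g ω j) + 51 * d) with hT
  have hTi : ∀ j, Integrable (fun ω => T ω j) tapeLaw := fun j =>
    (integrable_const _).add (((((integrable_norm_velocity_sq d j).const_mul _).add
      ((hin j).1.const_mul _)).add (integrable_const _)).const_mul _)
  have hTe : ∀ j, ∫ ω, T ω j ∂tapeLaw = 1 + 51 * c * √d := fun j => by
    have i1 := (integrable_norm_velocity_sq d j).const_mul 51
    have i2 := (hin j).1.const_mul (25 / 2 * h)
    have i3 : Integrable (fun _ : ℕ → ℝ => 51 * (d : ℝ)) tapeLaw := integrable_const _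
    have i4 : Integrable (fun ω : ℕ → ℝ => c / (2 * √d) * (51 * ‖velocity d j ω‖ ^ 2 +
        25 / 2 * h * inner ℝ (velocity d j ω) (g ω j) + 51 * d)) tapeLaw :=
      ((i1.add i2).add i3).const_mul _
    have i5 : Integrable (fun ω : ℕ → ℝ => 51 * ‖velocity d j ω‖ ^ 2 +
        25 / 2 * h * inner ℝ (velocity d j ω) (g ω j)) tapeLaw := i1.add i2
    simp only [hT]
    rw [integral_add (integrable_const _) i4, integral_const_mul,
      integral_add i5 i3, integral_add i1 i2, integral_const_mul, integral_const_mul,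
      integral_norm_velocity_sq, (hin j).2]
    simp only [integral_const, probReal_univ, one_smul]
    congr 1
    rw [div_mul_eq_mul_div, div_eq_iff (by positivity)]
    linear_combination (-102 * c) * hdd
  have hpt : ∀ ω, ((∑ j ∈ Finset.range N, chainSteps (gradient f) h c x₀ ω j : ℕ) : ℝ) ≤
      ∑ j ∈ Finset.range N, T ω j := fun ω => by
    have hstep : ∀ j, (chainSteps (gradient f) h c x₀ ω j : ℝ) ≤ T ω j +
        c / (2 * √d) * (25 / 2) * (f (chain (gradient f) h c x₀ ω j) -
          f (chain (gradient f) h c x₀ ω (j + 1))) := fun j => by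
      set x := chain (gradient f) h c x₀ ω j with hx
      set v := velocity d j ω with hv
      set W := ‖v‖ ^ 2 + h ^ 2 * ‖gradient f x‖ ^ 2 with hW
      have hW0 : 0 ≤ W := by positivity
      have h1 : (chainSteps (gradient f) h c x₀ ω j : ℝ) ≤ 1 + √W * c := by
        change ((max 1 ⌈√W * c⌉₊ : ℕ) : ℝ) ≤ 1 + √W * c
        rw [Nat.cast_max, max_le_iff]
        refine ⟨by push_cast; linarith [mul_nonneg (Real.sqrt_nonneg W) hc.le], ?_⟩
        have := (Nat.ceil_lt_add_one (mul_nonneg (Real.sqrt_nonneg W) hc.le)).le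
        linarith
      -- The inequality 2√W√d ≤ W + d makes the cost linear in W, the quantity that the decrease of
      -- f controls.
      have h2 : √W ≤ 1 / (2 * √d) * (W + d) := by
        have h3 : √W ^ 2 = W := Real.sq_sqrt hW0
        rw [one_div, ← div_eq_inv_mul, le_div_iff₀ (by positivity)]
        nlinarith [sq_nonneg (√W - √d)]
      obtain ⟨q, p, hq⟩ := H.exists_path x v
      have h4 := hq.gradient_sq_le H.bounds H.m_pos.le H.M_pos H.h_pos H.h_le hd'.le
        ((H.nextPoint_error hq).trans H.accuracy_le)
      have h5 : nextPoint (gradient f) h c x v = chain (gradient f) h c x₀ ω (j + 1) := rfl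
      rw [h5, hdd] at h4
      -- From `gradient_sq_le` multiplied by 25/2: 4 · 25/2 = 50, plus the 1 already present in W +
      -- d.
      have h6 : W + d ≤ 51 * ‖v‖ ^ 2 + 25 / 2 * h * inner ℝ v (gradient f x) + 51 * d +
          25 / 2 * (f x - f (chain (gradient f) h c x₀ ω (j + 1))) := by
        rw [hW]; linarith
      calc (chainSteps (gradient f) h c x₀ ω j : ℝ) ≤ 1 + √W * c := h1
        _ ≤ 1 + 1 / (2 * √d) * (51 * ‖v‖ ^ 2 + 25 / 2 * h * inner ℝ v (gradient f x) + 51 * d +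
          25 / 2 * (f x - f (chain (gradient f) h c x₀ ω (j + 1)))) * c := by
            gcongr; refine h2.trans ?_; gcongr
        _ = _ := by simp only [hT, hg, ← hx, ← hv]; ring
    push_cast
    refine (Finset.sum_le_sum fun j _ => hstep j).trans ?_
    rw [Finset.sum_add_distrib, ← Finset.mul_sum, Finset.sum_range_sub']
    -- The telescoping is done for each ω before taking expectations, so integrability of f along
    -- the chain is not required.
    have h7 : f (chain (gradient f) h c x₀ ω 0) - f (chain (gradient f) h c x₀ ω N) ≤ 0 :=
      sub_nonpos.2 (H.minimizer _)
    have h8 : 0 ≤ c / (2 * √d) * (25 / 2) := by positivity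
    linarith [mul_nonpos_of_nonneg_of_nonpos h8 h7]
  have hsum : Integrable (fun ω => ∑ j ∈ Finset.range N, T ω j) tapeLaw :=
    integrable_finsetSum _ fun j _ => hTi j
  calc _ ≤ ∫⁻ ω, ENNReal.ofReal (∑ j ∈ Finset.range N, T ω j) ∂tapeLaw := by
        refine lintegral_mono fun ω => ?_
        rw [← ENNReal.ofReal_natCast]
        exact ENNReal.ofReal_le_ofReal (hpt ω)
    _ = ENNReal.ofReal (∫ ω, ∑ j ∈ Finset.range N, T ω j ∂tapeLaw) :=
        (ofReal_integral_eq_lintegral_ofReal hsum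
          (ae_of_all _ fun ω => (Nat.cast_nonneg _).trans (hpt ω))).symm
    _ = _ := by
        rw [integral_finsetSum _ fun j _ => hTi j]
        simp only [hTe, Finset.sum_const, Finset.card_range, nsmul_eq_mul]

end Admissible

/-! ### The parameters of the algorithm -/

section Parameters

variable {m M : ℝ}

theorem sqrt_sqrt_eq_rpow {x : ℝ} (hx : 0 ≤ x) : √√x = x ^ (1 / 4 : ℝ) := by
  rw [Real.sqrt_eq_rpow, Real.sqrt_eq_rpow, ← Real.rpow_mul hx]
  norm_num

theorem stepSize_eq (hm : 0 < m) (hM : 0 < M) :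
    stepSize m M = m ^ (1 / 4 : ℝ) / (2 * M ^ (3 / 4 : ℝ)) := by
  rw [stepSize, sqrt_sqrt_eq_rpow hm.le, sqrt_sqrt_eq_rpow hM.le, Real.sqrt_eq_rpow,
    ← Real.rpow_add hM]
  norm_num

theorem stepSize_pos (hm : 0 < m) (hM : 0 < M) : 0 < stepSize m M := by
  unfold stepSize; positivity

theorem stepSize_sq (hM : 0 < M) :
    stepSize m M ^ 2 = √m / (4 * (M * √M)) := by
  have h1 : √√m ^ 2 = √m := Real.sq_sqrt (Real.sqrt_nonneg _)
  have h2 : √√M ^ 2 = √M := Real.sq_sqrt (Real.sqrt_nonneg _)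
  have h3 : √M ^ 2 = M := Real.sq_sqrt hM.le
  rw [stepSize, div_pow, mul_pow, mul_pow, h1, h2, h3]
  norm_num

theorem rpow_three_halves {x : ℝ} (hx : 0 < x) : x ^ (3 / 2 : ℝ) = x * √x := by
  rw [Real.sqrt_eq_rpow, ← Real.rpow_one_add' hx.le (by norm_num)]
  norm_num

theorem rate_eq (hm : 0 < m) (hM : 0 < M) :
    m * stepSize m M ^ 2 / 8 = 1 / (32 * (M / m) ^ (3 / 2 : ℝ)) := by
  have h1 : 0 < √m := Real.sqrt_pos.2 hm
  have h2 : 0 < √M := Real.sqrt_pos.2 hM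
  rw [stepSize_sq hM, rpow_three_halves (div_pos hM hm), Real.sqrt_div hM.le]
  field_simp
  norm_num

theorem stepFactor_eq {ε : ℝ} (hm : 0 < m) (hM : 0 < M) (hε : 0 < ε) :
    stepFactor m M ε = 512 * ((M / m) ^ (1 / 4 : ℝ) / ε) := by
  have h1 : 0 < √√m := Real.sqrt_pos.2 (Real.sqrt_pos.2 hm)
  have h2 : 0 < √√M := Real.sqrt_pos.2 (Real.sqrt_pos.2 hM)
  have h3 : √m = √√m ^ 2 := (Real.sq_sqrt (Real.sqrt_nonneg _)).symm
  have h4 : √M = √√M ^ 2 := (Real.sq_sqrt (Real.sqrt_nonneg _)).symm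
  have h5 : M = √√M ^ 4 := by
    rw [show (4 : ℕ) = 2 * 2 by rfl, pow_mul, ← h4, Real.sq_sqrt hM.le]
  rw [Real.div_rpow hM.le hm.le, ← sqrt_sqrt_eq_rpow hM.le, ← sqrt_sqrt_eq_rpow hm.le, stepFactor,
    stepSize]
  generalize √√m = a at *
  generalize √√M = b at *
  rw [h3, h4, h5]
  field_simp
  norm_num

/-- For this step size M³h⁴ equals m/16 exactly, so the contraction condition is saturated; Mh² ≤
1/4 then only needs m ≤ M. -/
theorem admissible {d : ℕ} {f : E d → ℝ} {ε : ℝ} {x₀ : E d} (hf : HessianBounds f m M)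
    (hm : 0 < m) (hmM : m ≤ M) (hε : 0 < ε) (hεd : ε ≤ √d) (hx₀ : ∀ y, f x₀ ≤ f y) :
    Admissible f m M ε (stepSize m M) (stepFactor m M ε) x₀ := by
  have hM := hm.trans_le hmM
  have h2 : 0 < √M := Real.sqrt_pos.2 hM
  refine ⟨hf, hm, hmM, stepSize_pos hm hM, ?_, ?_, hε, hεd, hx₀, rfl⟩
  · rw [stepSize_sq hM]
    have : √m ≤ √M := Real.sqrt_le_sqrt hmM
    have e : M * (√m / (4 * (M * √M))) = √m / (4 * √M) := by field_simp
    rw [e, div_le_div_iff₀ (by positivity) (by norm_num)]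
    linarith
  · have e : stepSize m M ^ 4 = m / (16 * M ^ 3) := by
      rw [show (4 : ℕ) = 2 * 2 by rfl, pow_mul, stepSize_sq hM, div_pow, Real.sq_sqrt hm.le,
        mul_pow, mul_pow, Real.sq_sqrt hM.le]
      norm_num
      ring
    rw [e]
    have : M ^ 3 * (m / (16 * M ^ 3)) = m / 16 := by field_simp
    exact this.le

/-- The number of iterations. -/
theorem exists_numIterations {d : ℕ} {ε : ℝ} (hm : 0 < m) (hmM : m ≤ M) (hε : 0 < ε)
    (hεd : ε < √d) :
    ∃ N : ℕ, 1 ≤ N ∧ (∀ k < N, ε < 4 * √d * contraction m M ^ k) ∧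
      4 * √d * contraction m M ^ N ≤ ε ∧
      (N : ℝ) ≤ 65 * (M / m) ^ (3 / 2 : ℝ) * (1 + Real.log (d / ε)) := by
  have hM := hm.trans_le hmM
  have hd0 : 0 < √d := hε.trans hεd
  have hd : (0 : ℝ) < d := Real.sqrt_pos.1 hd0
  have hd1 : (1 : ℝ) ≤ d := by
    have : 0 < d := by exact_mod_cast hd
    exact_mod_cast this
  set K := (M / m) ^ (3 / 2 : ℝ) with hK
  have hK1 : 1 ≤ K := Real.one_le_rpow ((one_le_div hm).2 hmM) (by norm_num)
  set θ := m * stepSize m M ^ 2 / 8 with hθ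
  have hθK : θ = 1 / (32 * K) := rate_eq hm hM
  have hθ0 : 0 < θ := by rw [hθK]; positivity
  have hθ1 : θ < 1 := by
    rw [hθK, div_lt_one (by positivity)]; linarith
  have hρ : contraction m M = 1 - θ := by rw [contraction, hθ, pow_two]
  have hex : ∃ N : ℕ, 4 * √d * contraction m M ^ N ≤ ε := by
    obtain ⟨N, hN⟩ := exists_pow_lt_of_lt_one (show 0 < ε / (4 * √d) by positivity)
      (show 1 - θ < 1 by linarith)
    refine ⟨N, ?_⟩
    rw [hρ]
    rw [lt_div_iff₀ (by positivity)] at hN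
    linarith
  classical
  set N := Nat.find hex with hNdef
  have hlt : ∀ k < N, ε < 4 * √d * contraction m M ^ k := fun k hk =>
    not_le.1 (Nat.find_min hex hk)
  have hN1 : 1 ≤ N := by
    by_contra! h0
    have := Nat.find_spec hex
    rw [← hNdef, Nat.lt_one_iff.1 h0, pow_zero] at this
    linarith
  refine ⟨N, hN1, hlt, Nat.find_spec hex, ?_⟩
  -- By minimality of N, the exponent N - 1 still fails the stopping test, which bounds θ(N - 1) by
  -- log(4d/ε).
  have h1 := hlt (N - 1) (by omega)
  have h2 : contraction m M ^ (N - 1) ≤ Real.exp (-(θ * (N - 1))) := by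
    have h3 : contraction m M ≤ Real.exp (-θ) := by
      rw [hρ]; linarith [Real.add_one_le_exp (-θ)]
    have h4 : 0 ≤ contraction m M := by rw [hρ]; linarith
    calc contraction m M ^ (N - 1) ≤ Real.exp (-θ) ^ (N - 1) := by gcongr
      _ = _ := by
        rw [← Real.exp_nat_mul, Nat.cast_sub hN1]; congr 1; push_cast; ring
  have hsd : √d ≤ d := by
    rw [Real.sqrt_le_left (by positivity)]
    nlinarith
  have hL0 : 0 ≤ Real.log (d / ε) := by
    refine Real.log_nonneg ((one_le_div hε).2 ?_)
    exact hεd.le.trans hsd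
  have h5 : θ * (N - 1) ≤ 2 + Real.log (d / ε) := by
    have h6 : ε < 4 * d * Real.exp (-(θ * (N - 1))) := by
      have h0 : 0 ≤ contraction m M ^ (N - 1) := pow_nonneg (by rw [hρ]; linarith) _
      refine h1.trans_le ?_
      gcongr
    have h7 : Real.exp (θ * (N - 1)) ≤ 4 * (d / ε) := by
      rw [Real.exp_neg, ← div_eq_mul_inv, lt_div_iff₀ (Real.exp_pos _)] at h6
      rw [← mul_div_assoc, le_div_iff₀ hε]
      linarith
    have h8 := (Real.le_log_iff_exp_le (by positivity)).2 h7
    rw [Real.log_mul (by norm_num) (by positivity)] at h8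
    have h9 : Real.log 4 ≤ 2 := by
      rw [show (4 : ℝ) = 2 ^ 2 by norm_num, Real.log_pow]
      have := Real.log_two_lt_d9
      push_cast
      linarith
    linarith
  rw [hθK, div_mul_eq_mul_div, one_mul, div_le_iff₀ (by positivity)] at h5
  -- With L = log(d/ε), N ≤ 1 + 32K(2 + L) ≤ 65K(1 + L), because K ≥ 1.
  nlinarith [mul_nonneg (sub_nonneg.2 hK1) hL0]

end Parameters

end HMC

end

/-! ### Assembly of the bounds -/

theorem mainTheorem2 :
    ∃ (A : HMC.Algorithm) (C : ℝ), 0 < C ∧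
      ∀ (d : ℕ) (m₂ M₂ ε : ℝ) (f : HMC.E d → ℝ) (x₀ : HMC.E d),
        0 < m₂ → 0 < ε → ε < Real.sqrt d →
        HMC.HessianBounds f m₂ M₂ → (∀ y, f x₀ ≤ f y) →
        ∃ (N : ℕ) (h : ℝ) (S : (ℕ → ℝ) → ℕ → HMC.State),
          -- the step size and the execution of the algorithm
          (0 < h ∧ h ≤ m₂ ^ (1 / 4 : ℝ) / (2 * M₂ ^ (3 / 4 : ℝ))) ∧
          (∀ ω, A.Executes (gradient f) ω (HMC.input m₂ M₂ ε x₀) N (S ω)) ∧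
          (∀ ω, HMC.IsHMC f m₂ ε h x₀ ω N (S ω)) ∧
          -- the number of iterations
          (N : ℝ) ≤ C * (M₂ / m₂) ^ (3 / 2 : ℝ) * (1 + Real.log (d / ε)) ∧
          -- the law of the output
          HMC.W₂ (HMC.tapeLaw.map fun ω => (S ω N).vec d 0) (HMC.gibbs f) ≤
            ENNReal.ofReal (ε / Real.sqrt m₂) ∧
          -- the expected number of gradient evaluations
          ∫⁻ ω, ((S ω N).queries : ENNReal) ∂HMC.tapeLaw ≤
            ENNReal.ofReal (N * (C * ((M₂ / m₂) ^ (1 / 4 : ℝ) * (d : ℝ) ^ (1 / 2 : ℝ) / ε *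
              (1 + Real.log (M₂ / m₂ * d / ε))))) ∧
          -- the expected time
          ∫⁻ ω, ((S ω N).time : ENNReal) ∂HMC.tapeLaw ≤
            ENNReal.ofReal (N * (C * ((M₂ / m₂) ^ (1 / 4 : ℝ) * (d : ℝ) ^ (3 / 2 : ℝ) / ε *
              (1 + Real.log (M₂ / m₂ * d / ε))))) := by
  refine ⟨HMC.hmcAlgorithm, 10 ^ 7, by norm_num, fun d m M ε f x₀ hm hε hεd hf hx₀ => ?_⟩
  have hsd0 : 0 < √d := hε.trans hεd
  have hd0 : (0 : ℝ) < d := Real.sqrt_pos.1 hsd0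
  have hd : 0 < d := by exact_mod_cast hd0
  have hd1 : (1 : ℝ) ≤ d := by exact_mod_cast hd
  -- Positivity of d, forced by 0 < ε < √d, is what allows the two Hessian bounds to be compared.
  have hmM : m ≤ M := hf.le_upper hd
  have hM := hm.trans_le hmM
  have H := HMC.admissible hf hm hmM hε hεd.le hx₀
  obtain ⟨N, hN1, hlt, hle, hN⟩ := HMC.exists_numIterations hm hmM hε hεd
  have hN1' : (1 : ℝ) ≤ N := by exact_mod_cast hN1
  choose S hexec hS using fun ω =>
    HMC.exists_execution (m := m) (M := M) (ε := ε) (x₀ := x₀) hd (gradient f) ω hlt hle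
  set h := HMC.stepSize m M with hh
  set c := HMC.stepFactor m M ε with hc
  have hsd : √d ≤ d := by
    rw [Real.sqrt_le_left (by positivity)]
    nlinarith
  have hκ : 1 ≤ M / m := (one_le_div hm).2 hmM
  have hL0 : 0 ≤ Real.log (M / m * d / ε) := by
    refine Real.log_nonneg ((one_le_div hε).2 (hεd.le.trans (hsd.trans ?_)))
    nlinarith
  have hL1 : 0 ≤ Real.log (d / ε) :=
    Real.log_nonneg ((one_le_div hε).2 (hεd.le.trans hsd))
  set Q := (M / m) ^ (1 / 4 : ℝ) * (d : ℝ) ^ (1 / 2 : ℝ) / ε with hQ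
  have hQ1 : 1 ≤ Q := by
    rw [hQ, ← Real.sqrt_eq_rpow, one_le_div hε]
    have h1 : 1 ≤ (M / m) ^ (1 / 4 : ℝ) := Real.one_le_rpow hκ (by norm_num)
    nlinarith
  have hcQ : c * √d = 512 * Q := by
    rw [hc, HMC.stepFactor_eq hm hM hε, hQ, ← Real.sqrt_eq_rpow]; ring
  have hQd : (M / m) ^ (1 / 4 : ℝ) * (d : ℝ) ^ (3 / 2 : ℝ) / ε = d * Q := by
    rw [hQ, ← Real.sqrt_eq_rpow, HMC.rpow_three_halves hd0]; ring
  have hsteps := H.lintegral_sum_chainSteps_le hd N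
  -- Since c√d = 512 Q and Q ≥ 1, the constant is 51 · 512 + 1.
  have hcost : (1 : ℝ) + 51 * c * √d ≤ 26113 * Q := by
    rw [mul_assoc, hcQ]; linarith
  have hcost0 : 0 ≤ 1 + 51 * c * √d := by rw [mul_assoc, hcQ]; linarith
  refine ⟨N, h, S, ⟨HMC.stepSize_pos hm hM, (HMC.stepSize_eq hm hM).le⟩, hexec, fun ω => ?_, ?_, ?_,
    ?_, ?_⟩
  · refine ⟨(hS ω 0).1, fun k _ => (hS ω k).2.1, fun k _ => ?_⟩
    rw [(hS ω k).1, (hS ω (k + 1)).1]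
    obtain ⟨q, p, hq⟩ := H.exists_path (HMC.chain (gradient f) h c x₀ ω k) (HMC.velocity d k ω)
    exact ⟨q, p, hq, H.nextPoint_error hq⟩
  · refine hN.trans ?_
    gcongr
    norm_num
  · simp_rw [(hS _ N).1]
    refine H.W₂_chain_le hd ?_
    rwa [pow_two]
  · have h1 : ∀ ω, ((S ω N).queries : ENNReal) =
        ((∑ j ∈ Finset.range N, HMC.chainSteps (gradient f) h c x₀ ω j : ℕ) : ENNReal) + N := by
      intro ω
      rw [(hS ω N).2.2.2, Finset.sum_add_distrib]
      simp
    simp_rw [h1]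
    rw [lintegral_add_right _ measurable_const, lintegral_const, measure_univ, mul_one]
    refine (add_le_add_left hsteps _).trans ?_
    rw [← ENNReal.ofReal_natCast N, ← ENNReal.ofReal_add (by positivity) (by positivity)]
    refine ENNReal.ofReal_le_ofReal ?_
    have h2 : (N : ℝ) * (1 + 51 * c * √d) + N = N * (1 + 51 * c * √d + 1) := by ring
    rw [h2]
    gcongr
    nlinarith [mul_nonneg (zero_le_one.trans hQ1) hL0]
  · have h1 : ∀ ω, ((S ω N).time : ENNReal) ≤
        ((26 + 3 * N : ℕ) : ENNReal) + ((100 * d : ℕ) : ENNReal) *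
        ((∑ j ∈ Finset.range N, HMC.chainSteps (gradient f) h c x₀ ω j : ℕ) : ENNReal) := by
      intro ω
      exact_mod_cast (hS ω N).2.2.1
    refine (lintegral_mono h1).trans ?_
    rw [lintegral_add_left measurable_const, lintegral_const, measure_univ, mul_one,
      lintegral_const_mul' _ _ (ENNReal.natCast_ne_top _)]
    refine (add_le_add_right (mul_le_mul_right hsteps _) _).trans ?_
    rw [← ENNReal.ofReal_natCast, ← ENNReal.ofReal_natCast,
      ← ENNReal.ofReal_mul (Nat.cast_nonneg _), ← ENNReal.ofReal_add (by positivity) (by positivity)]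
    refine ENNReal.ofReal_le_ofReal ?_
    rw [hQd]
    push_cast
    have hdQ : 1 ≤ d * Q := one_le_mul_of_one_le_of_one_le hd1 hQ1
    calc (26 : ℝ) + 3 * N + 100 * d * (N * (1 + 51 * c * √d))
        ≤ 29 * N * 1 + 100 * d * (N * (26113 * Q)) := by
          gcongr
          linarith
      _ ≤ 29 * N * (d * Q) + 100 * d * (N * (26113 * Q)) := by gcongr
      _ = N * (2611329 * (d * Q)) := by ring
      -- The estimate already holds without the logarithmic factor, which is at least 1.
      _ ≤ N * (10 ^ 7 * (d * Q * (1 + Real.log (M / m * d / ε)))) := by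
          refine mul_le_mul_of_nonneg_left ?_ (by positivity)
          nlinarith [mul_nonneg (zero_le_one.trans hdQ) hL0]
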